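/- Let $d,m\ge 0$ be integers, $T>0$, let $A\subset\mathbb R^m$ be compact, and let $c:[0,T]\times\mathbb R^d\times A\to\mathbb R$, $f:[0,T]\times\mathbb R^d\times A\to\mathbb R^d$, $q:\mathbb R^d\to\mathbb R$. Assume that for all $(t,x,p)\in[0,T]\times\mathbb R^d\times\mathbb R^d$ the function $a\mapsto c(t,x,a)+p\cdot f(t,x,a)$ has a unique minimizer $\alpha(t,x,p)$ over $A$, and put $$H(t,x,p)=\inf_{a\in A}\big[c(t,x,a)+p\cdot f(t,x,a)\big].$$ Call $g:\mathbb R^d\to\mathbb R$ uniformly semi-concave with constant $C$ if $g(x+y)+g(x-y)-2g(x)\le C|y|^2$ for all $x,y\in\mathbb R^d$. For $h>0$ and $\varphi:\mathbb R^d\to\mathbb R$ put $$\nabla^h\varphi(x)=\Big(\tfrac{\varphi(x+he_i)-\varphi(x-he_i)}{2h}\Big)_{i=1}^d,\qquad \Delta^h\varphi(x)=\sum_{i=1}^d\tfrac{\varphi(x+he_i)-2\varphi(x)+\varphi(x-he_i)}{h^2}.$$ Assume: - (A1) $c,f,q$ are bounded and Lipschitz continuous in all their variables; - (A2) $\alpha$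 is Lipschitz continuous on $[0,T]\times\mathbb R^d\times\mathbb R^d$; - (A3) $q$ is uniformly semi-concave with some constant, and $c(t,\cdot,a)$, $f(t,\cdot,a)$ are bounded in $W^{2,\infty}(\mathbb R^d)$ uniformly in $t\in[0,T]$, $a\in A$; - $N\in\mathbb R$ satisfies $N\ge\max\{1,\|f\|_\infty/2\}$, where $\|f\|_\infty=\sup_{t,x,a}|f(t,x,a)|$. Let $v$ be the bounded continuous viscosity solution on $[0,T]\times\mathbb R^d$ of $$\partial_tv+H(t,x,\nabla v)=0\ \text{ in }(0,T)\times\mathbb R^d,\qquad v(T,\cdot)=q,$$ and for $h\in(0,1)$ let $v^h$ be the bounded continuous solution on $[0,T]\times\mathbb R^d$ (differentiable in $t$ on $(0,T)$) of $$\partial_tv^h+H(t,x,\nabla^hv^h)=-Nh\,\Delta^hv^h\ \text{ in }(0,T)\times\mathbb R^d,\qquad v^h(T,\cdot)=q.$$ **Theorem.** There is a constant $C>0$ such that for every $t\in[0,T]$ the function $v(t,\cdot)$ is uniformly semi-concave with constant $C$. Moreover, for every $t\in[0,T]$ and for a.e. $x\in\mathbb R^d$, the function $v(t,\cdot)$ is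 differentiable at $x$ and, for every family $(t_h,x_h)_{h\in(0,1)}$ in $[0,T]\times\mathbb R^d$ with $(t_h,x_h)\to(t,x)$ as $h\to0^+$, $$\alpha\big(t_h,x_h,\nabla^hv^h(t_h,x_h)\big)\longrightarrow\alpha\big(t,x,\nabla v(t,x)\big)\qquad\text{as }h\to0^+ .$$ -/

import Mathlib

open Set Filter Topology MeasureTheory
open scoped ENNReal NNReal ContDiff

namespace PolicyIteration

/-- `ℝ^n` with its Euclidean norm. -/
abbrev E (n : ℕ) : Type := EuclideanSpace ℝ (Fin n)

/-- The Hamiltonian `H(t,x,p) = inf_{a ∈ A} [c(t,x,a) + p · f(t,x,a)]`. -/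
noncomputable def hamiltonian {d m : ℕ} (A : Set (E m)) (c : ℝ → E d → E m → ℝ)
    (f : ℝ → E d → E m → E d) (t : ℝ) (x p : E d) : ℝ :=
  ⨅ a : A, (c t x a + inner ℝ p (f t x a))

/-- On `[0,T] × ℝ^d × ℝ^d`, `α(t,x,p)` is the one and only minimizer over `A` of
`a ↦ c(t,x,a) + p · f(t,x,a)`. -/
def IsArgminPolicy {d m : ℕ} (T : ℝ) (A : Set (E m)) (c : ℝ → E d → E m → ℝ)
    (f : ℝ → E d → E m → E d) (α : ℝ → E d → E d → E m) : Prop :=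
  ∀ t ∈ Icc 0 T, ∀ x p : E d,
    {a | a ∈ A ∧ IsMinOn (fun b => c t x b + inner ℝ p (f t x b)) A a} = {α t x p}

/-- A function of `(t,x,a)` is bounded and (jointly) Lipschitz on `[0,T] × ℝ^d × A`. -/
def BoundedLipschitz {d m : ℕ} {F : Type*} [NormedAddCommGroup F] (T : ℝ) (A : Set (E m))
    (g : ℝ → E d → E m → F) : Prop :=
  (∃ M : ℝ, ∀ t ∈ Icc 0 T, ∀ x : E d, ∀ a ∈ A, ‖g t x a‖ ≤ M) ∧
  ∃ L : ℝ≥0, LipschitzOnWith L (fun z : ℝ × E d × E m => g z.1 z.2.1 z.2.2)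
    (Icc 0 T ×ˢ univ ×ˢ A)

/-- The central difference gradient `∇^h φ(x)`. -/
noncomputable def discreteGradient {d : ℕ} (h : ℝ) (φ : E d → ℝ) (x : E d) : E d :=
  WithLp.toLp 2 fun i : Fin d =>
    (φ (x + h • EuclideanSpace.single i (1 : ℝ)) -
      φ (x - h • EuclideanSpace.single i (1 : ℝ))) / (2 * h)

/-- The discrete Laplacian `Δ^h φ(x)`. -/
noncomputable def discreteLaplacian {d : ℕ} (h : ℝ) (φ : E d → ℝ) (x : E d) : ℝ :=
  ∑ i : Fin d,
    (φ (x + h • EuclideanSpace.single i (1 : ℝ)) - 2 * φ x +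
      φ (x - h • EuclideanSpace.single i (1 : ℝ))) / h ^ 2

/-- `u` is bounded and continuous on `[0,T] × ℝ^d`. -/
def BoundedContinuous {d : ℕ} (T : ℝ) (u : ℝ → E d → ℝ) : Prop :=
  (∃ M : ℝ, ∀ t ∈ Icc 0 T, ∀ x : E d, |u t x| ≤ M) ∧
  ContinuousOn (fun z : ℝ × E d => u z.1 z.2) (Icc 0 T ×ˢ univ)

/-- `v` is a (bounded, continuous) viscosity solution of the terminal value problem
`∂_t v + H(t,x,∇v) = 0` in `(0,T) × ℝ^d`, `v(T,·) = q`. Since the problem runs backwards in time,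
the subsolution inequality is `≥ 0` at local maxima of `v - φ`, and the supersolution inequality
is `≤ 0` at local minima. -/
structure IsViscositySolution {d : ℕ} (T : ℝ) (H : ℝ → E d → E d → ℝ) (q : E d → ℝ)
    (v : ℝ → E d → ℝ) : Prop where
  boundedContinuous : BoundedContinuous T v
  terminal : ∀ x, v T x = q x
  subsolution : ∀ φ : ℝ → E d → ℝ, ContDiff ℝ 1 (fun z : ℝ × E d => φ z.1 z.2) →
    ∀ t ∈ Ioo 0 T, ∀ x : E d,
      IsLocalMax (fun z : ℝ × E d => v z.1 z.2 - φ z.1 z.2) (t, x) →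
        0 ≤ deriv (fun s => φ s x) t + H t x (gradient (φ t) x)
  supersolution : ∀ φ : ℝ → E d → ℝ, ContDiff ℝ 1 (fun z : ℝ × E d => φ z.1 z.2) →
    ∀ t ∈ Ioo 0 T, ∀ x : E d,
      IsLocalMin (fun z : ℝ × E d => v z.1 z.2 - φ z.1 z.2) (t, x) →
        deriv (fun s => φ s x) t + H t x (gradient (φ t) x) ≤ 0

/-- `u` is a (bounded, continuous) solution of the semi-discrete problem
`∂_t u + H(t,x,∇^h u) = - N h Δ^h u` in `(0,T) × ℝ^d`, `u(T,·) = q`. -/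
structure IsSemiDiscreteSolution {d : ℕ} (T : ℝ) (H : ℝ → E d → E d → ℝ) (q : E d → ℝ)
    (N h : ℝ) (u : ℝ → E d → ℝ) : Prop where
  boundedContinuous : BoundedContinuous T u
  terminal : ∀ x, u T x = q x
  equation : ∀ t ∈ Ioo 0 T, ∀ x : E d, ∃ u' : ℝ, HasDerivAt (fun s => u s x) u' t ∧
    u' + H t x (discreteGradient h (u t) x) = -(N * h * discreteLaplacian h (u t) x)

/-- `g(x+y) + g(x-y) - 2 g(x) ≤ C |y|²` for all `x, y`. -/
def SemiconcaveWith {d : ℕ} (C : ℝ) (g : E d → ℝ) : Prop :=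
  ∀ x y : E d, g (x + y) + g (x - y) - 2 * g x ≤ C * ‖y‖ ^ 2

/-- `g'` is the weak partial derivative `∂_i g` on `ℝ^d`. -/
def IsWeakPartialDeriv {d : ℕ} {F : Type*} [NormedAddCommGroup F] [NormedSpace ℝ F] (i : Fin d)
    (g g' : E d → F) : Prop :=
  LocallyIntegrable g ∧ LocallyIntegrable g' ∧
  ∀ φ : E d → ℝ, ContDiff ℝ ∞ φ → HasCompactSupport φ →
    ∫ x, φ x • g' x = -∫ x, (fderiv ℝ φ x (EuclideanSpace.single i (1 : ℝ))) • g x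

/-- `g ∈ W^{2,∞}(ℝ^d)`, where `g` and its weak partial derivatives of first and second order are
all bounded by `K` in `L^∞(ℝ^d)`. -/
def W2InftyBoundedBy {d : ℕ} {F : Type*} [NormedAddCommGroup F] [NormedSpace ℝ F] (K : ℝ≥0)
    (g : E d → F) : Prop :=
  (MemLp g ∞ volume ∧ eLpNorm g ∞ volume ≤ K) ∧
  ∃ (g₁ : Fin d → E d → F) (g₂ : Fin d → Fin d → E d → F),
    (∀ i, IsWeakPartialDeriv i g (g₁ i) ∧ MemLp (g₁ i) ∞ volume ∧
      eLpNorm (g₁ i) ∞ volume ≤ K) ∧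
    (∀ i j, IsWeakPartialDeriv j (g₁ i) (g₂ i j) ∧ MemLp (g₂ i j) ∞ volume ∧
      eLpNorm (g₂ i j) ∞ volume ≤ K)

end PolicyIteration

/-! Since `‖f‖ ≤ 2N`, for a frozen control the operator `p · f + N h Δ^h` is the generator of a jump
process from `x` to its neighbours `x ± h e_i`, with nonnegative rates `(2N ± f_i) / (2h)`. Coupling
the jumps at three points, and using the control that is optimal at the centre for all three,
compares `u(x₁) + θ u(x₂) - (1+θ) u(x₀)` with an explicit translation invariant function
(`IsSemiDiscreteSolution.threePoint_le`). For `θ = 0` this gives Lipschitz bounds uniform in `h`;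
for `θ = 1` it gives the weak semi-concavity `u(x+y) + u(x-y) - 2u(x) ≤ C (|y|² + μ + (h/μ)|y|)` for
`h ≤ μ ≤ 1`. Doubling the space variable yields `|v - v^h| ≤ C √h`, and the choice `μ = √h` makes
`v` semi-concave in the limit.

As `v(t,·)` is Lipschitz, it is differentiable a.e., and as `α` is Lipschitz, it suffices that the
discrete gradients converge to the gradient at each point of differentiability. With `μ = √(h s)`
the second differences at scale `s` are `O(s² + √(h s))`. Summing over dyadic scales shows that
slopes over `n + 1` grid steps exceed the slope of `v` asymptotically by at most `O(1/√(n+1))`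
(`eventually_slope_le`). For a single grid step this error does not vanish.

A blow-up removes it (`UniformApproximation.eventually_step_slope_le`). Let `S` be the limsup of the
one-step slopes in a direction `e = ±e_i`. Rescaling by `h` around points that realise `S` gives a
profile `V` with `V(w+e) - V(w) ≤ S` everywhere and equality at `0`. Slopes slightly later in time
cannot exceed `S` either, so where equality holds the scheme operator is no larger at `w` than at `w
+ e`. The rates may vanish, because `2N = ‖f‖_∞` is allowed, so a strong maximum principle need not
hold. Instead, the equality case of the Lipschitz bound of `H` in `p` shows that contact spreads to
at least one side, and concavity of `H` in `p` forbids a contact segment from stopping at both ends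
(`exists_long_maximal_slope`). So slope `S` occurs on segments of every length `n + 1`, whence `S ≤
p · e + O(1/√(n+1))` for all `n`. Using `e` and `-e` gives two-sided bounds, hence convergence. -/

namespace PolicyIteration

/-! ### Pointwise second differences of `W^{2,∞}` functions -/

section Mollification

open scoped Convolution

variable {d : ℕ} {F : Type*} [NormedAddCommGroup F] [NormedSpace ℝ F]

/-- The derivative falls on `ρ`, and testing the weak derivative against `z ↦ ρ (x - z)` moves it to
`g`. The formula for `D` does not involve `i`, which lets the partial derivatives for different `i`
be read off from one and the same `D`. -/
theorem IsWeakPartialDeriv.fderiv_convolution [CompleteSpace F] {i : Fin d} {g g' : E d → F}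
    (hg : IsWeakPartialDeriv i g g') {ρ : E d → ℝ} (hρ : ContDiff ℝ ∞ ρ)
    (hρc : HasCompactSupport ρ) (x : E d) :
    ∃ D : E d →L[ℝ] F,
      HasFDerivAt (ρ ⋆[ContinuousLinearMap.lsmul ℝ ℝ, volume] g) D x ∧
      D = ((fderiv ℝ ρ) ⋆[(ContinuousLinearMap.lsmul ℝ ℝ).precompL (E d), volume] g) x ∧
      D (EuclideanSpace.single i (1 : ℝ)) =
        (ρ ⋆[ContinuousLinearMap.lsmul ℝ ℝ, volume] g') x := by
  obtain ⟨hgl, hgl', hw⟩ := hg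
  have hρ1 : ContDiff ℝ 1 ρ := hρ.of_le (by exact_mod_cast le_top)
  refine ⟨_, hρc.hasFDerivAt_convolution_left (ContinuousLinearMap.lsmul ℝ ℝ) hρ1 hgl x, rfl, ?_⟩
  have hex : ConvolutionExistsAt (fderiv ℝ ρ) g x
      ((ContinuousLinearMap.lsmul ℝ ℝ : ℝ →L[ℝ] F →L[ℝ] F).precompL (E d)) volume :=
    (hρc.fderiv (𝕜 := ℝ)).convolutionExists_left _
      (hρ1.continuous_fderiv (by simp)) hgl x
  rw [convolution_def, ContinuousLinearMap.integral_apply hex]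
  simp only [ContinuousLinearMap.precompL_apply, ContinuousLinearMap.lsmul_apply]
  set φ : E d → ℝ := fun z => ρ (x - z) with hφ
  have hφs : ContDiff ℝ ∞ φ := hρ.comp (contDiff_const.sub contDiff_id)
  have hφc : HasCompactSupport φ :=
    hρc.comp_homeomorph (Homeomorph.subLeft x)
  have hφd : ∀ z, fderiv ℝ φ z (EuclideanSpace.single i (1 : ℝ)) =
      -(fderiv ℝ ρ (x - z) (EuclideanSpace.single i (1 : ℝ))) := by
    intro z
    have h1 : HasFDerivAt ρ (fderiv ℝ ρ (x - z)) (x - z) :=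
      (hρ1.differentiable (by simp) (x - z)).hasFDerivAt
    have h2 : HasFDerivAt (fun z : E d => x - z) (-(ContinuousLinearMap.id ℝ (E d))) z := by
      simpa using (hasFDerivAt_id z).const_sub x
    have h3 := (h1.comp z h2).fderiv
    have h4 : φ = ρ ∘ fun z => x - z := rfl
    rw [h4, h3]
    simp
  have key := hw φ hφs hφc
  simp only [hφd, neg_smul, integral_neg, neg_neg] at key
  rw [convolution_lsmul_swap]
  rw [key]
  rw [← integral_sub_left_eq_self _ volume x]
  simp

theorem norm_convolution_normed_le [CompleteSpace F] {K : ℝ} {g : E d → F}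
    (hg : ∀ᵐ z, ‖g z‖ ≤ K) (φ : ContDiffBump (0 : E d)) (x : E d) :
    ‖(φ.normed volume ⋆[ContinuousLinearMap.lsmul ℝ ℝ, volume] g) x‖ ≤ K := by
  rw [convolution_lsmul_swap]
  have h1 : Integrable (fun z => φ.normed volume (x - z) * K) :=
    (φ.integrable_normed.comp_sub_left x).mul_const K
  have h2 : ∫ z, φ.normed volume (x - z) * K = K := by
    rw [integral_mul_const, integral_sub_left_eq_self (φ.normed volume) volume x,
      φ.integral_normed, one_mul]
  rw [← h2]
  refine norm_integral_le_of_norm_le h1 ?_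
  filter_upwards [hg] with z hz
  rw [norm_smul, Real.norm_of_nonneg (φ.nonneg_normed _)]
  exact mul_le_mul_of_nonneg_left hz (φ.nonneg_normed _)

/-- The even function `ψ s + ψ (-s)` has derivative `ψ' s - ψ' (-s)`, of norm at most `2B` on
`[0,1]`. The factor `2` is not optimal. -/
theorem norm_secondDiff_le_of_deriv {ψ ψ' ψ'' : ℝ → F} {B : ℝ}
    (h1 : ∀ s, HasDerivAt ψ (ψ' s) s) (h2 : ∀ s, HasDerivAt ψ' (ψ'' s) s)
    (hB : ∀ s, ‖ψ'' s‖ ≤ B) : ‖ψ 1 + ψ (-1) - (2 : ℝ) • ψ 0‖ ≤ 2 * B := by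
  have hB0 : 0 ≤ B := (norm_nonneg _).trans (hB 0)
  have hlip : ∀ s t, ‖ψ' s - ψ' t‖ ≤ B * ‖s - t‖ := fun s t =>
    Convex.norm_image_sub_le_of_norm_hasDerivWithin_le (s := univ)
      (fun x _ => (h2 x).hasDerivWithinAt) (fun x _ => hB x) convex_univ (mem_univ _) (mem_univ _)
  have hχ : ∀ s, HasDerivAt (fun s => ψ s + ψ (-s)) (ψ' s - ψ' (-s)) s := by
    intro s
    have := (h1 s).add ((h1 (-s)).scomp s (hasDerivAt_neg s))
    have e : (fun s => ψ s + ψ (-s)) = ψ + ψ ∘ Neg.neg := rfl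
    rw [e, sub_eq_add_neg]
    simpa using this
  have := norm_image_sub_le_of_norm_deriv_le_segment' (f := fun s => ψ s + ψ (-s))
    (f' := fun s => ψ' s - ψ' (-s)) (a := 0) (b := 1) (C := 2 * B)
    (fun x _ => (hχ x).hasDerivWithinAt) (fun x hx => by
      refine (hlip _ _).trans ?_
      have : ‖x - -x‖ ≤ 2 := by
        rw [Real.norm_eq_abs, abs_le]; constructor <;> linarith [hx.1, hx.2]
      nlinarith) 1 (by simp)
  simpa [two_smul, sub_eq_add_neg, add_assoc] using this

theorem sum_smul_single (y : E d) :
    y = ∑ i, y i • (EuclideanSpace.single i (1 : ℝ) : E d) := by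
  ext j
  simp [Pi.single_apply]

/-- Mollification keeps the bounds on second derivatives, so the estimate holds for mollifications
along the line through `x` in direction `y`. Continuity of `g` makes them converge at every point
rather than almost everywhere. -/
theorem W2InftyBoundedBy.norm_secondDiff_le [CompleteSpace F] {K : ℝ≥0} {g : E d → F}
    (hg : W2InftyBoundedBy K g) (hgc : Continuous g) (x y : E d) :
    ‖g (x + y) + g (x - y) - (2 : ℝ) • g x‖ ≤ 2 * (d * d * K) * ‖y‖ ^ 2 := by
  obtain ⟨-, g₁, g₂, hg₁, hg₂⟩ := hg
  have hbd : ∀ i j, ∀ᵐ z, ‖g₂ i j z‖ ≤ K := by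
    intro i j
    have h := (hg₂ i j).2.2
    rw [eLpNorm_exponent_top] at h
    filter_upwards [enorm_ae_le_eLpNormEssSup (g₂ i j) volume] with z hz
    have := hz.trans h
    rwa [← ofReal_norm, ENNReal.ofReal_le_iff_le_toReal (by simp)] at this
  have hcoord : ∀ i, |y i| ≤ ‖y‖ := fun i => by
    simpa using PiLp.norm_apply_le y i
  have main : ∀ φ : ContDiffBump (0 : E d),
      ‖(φ.normed volume ⋆[ContinuousLinearMap.lsmul ℝ ℝ, volume] g) (x + y) +
        (φ.normed volume ⋆[ContinuousLinearMap.lsmul ℝ ℝ, volume] g) (x - y) -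
        (2 : ℝ) • (φ.normed volume ⋆[ContinuousLinearMap.lsmul ℝ ℝ, volume] g) x‖ ≤
        2 * (d * d * K) * ‖y‖ ^ 2 := by
    intro φ
    set ρ := φ.normed (volume : Measure (E d))
    have hρ : ContDiff ℝ ∞ ρ := φ.contDiff_normed
    have hρc : HasCompactSupport ρ := φ.hasCompactSupport_normed
    have hline : ∀ s : ℝ, HasDerivAt (fun s : ℝ => x + s • y) y s := fun s => by
      simpa using ((hasDerivAt_id s).smul_const y).const_add x
    have step : ∀ (g : E d → F) (g' : Fin d → E d → F), (∀ i, IsWeakPartialDeriv i g (g' i)) →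
        ∀ s : ℝ, HasDerivAt
          (fun s : ℝ => (ρ ⋆[ContinuousLinearMap.lsmul ℝ ℝ, volume] g) (x + s • y))
          (∑ i, y i • (ρ ⋆[ContinuousLinearMap.lsmul ℝ ℝ, volume] g' i) (x + s • y)) s := by
      intro g g' hgg s
      -- The derivative of the convolution is obtained from some coordinate `i₀`. In dimension zero
      -- there is none, but the space is a single point.
      by_cases hd : IsEmpty (Fin d)
      · have : Subsingleton (E d) := by
          constructor; intro a b; ext i; exact hd.elim i
        have h0 : (fun s : ℝ => (ρ ⋆[ContinuousLinearMap.lsmul ℝ ℝ, volume] g) (x + s • y)) =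
            fun _ => (ρ ⋆[ContinuousLinearMap.lsmul ℝ ℝ, volume] g) x := by
          funext s; congr 1; exact Subsingleton.elim _ _
        rw [h0]
        simpa using hasDerivAt_const s _
      · rw [not_isEmpty_iff] at hd
        obtain ⟨i₀⟩ := hd
        obtain ⟨D, hD, hDe, -⟩ := (hgg i₀).fderiv_convolution hρ hρc (x + s • y)
        have h := hD.comp_hasDerivAt s (hline s)
        have hDy : D y =
            ∑ i, y i • (ρ ⋆[ContinuousLinearMap.lsmul ℝ ℝ, volume] g' i) (x + s • y) := by
          conv_lhs => rw [sum_smul_single y]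
          rw [map_sum]
          refine Finset.sum_congr rfl fun i _ => ?_
          obtain ⟨D', -, hDe', hDi⟩ := (hgg i).fderiv_convolution hρ hρc (x + s • y)
          rw [map_smul, hDe, ← hDe', hDi]
        rw [← hDy]
        exact h
    have h1 := step g g₁ (fun i => (hg₁ i).1)
    have h2 : ∀ s : ℝ, HasDerivAt
        (fun s : ℝ => ∑ i, y i • (ρ ⋆[ContinuousLinearMap.lsmul ℝ ℝ, volume] g₁ i) (x + s • y))
        (∑ i, y i • ∑ j, y j • (ρ ⋆[ContinuousLinearMap.lsmul ℝ ℝ, volume] g₂ i j) (x + s • y))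
        s := by
      intro s
      refine HasDerivAt.fun_sum fun i _ => ?_
      exact (step (g₁ i) (g₂ i) (fun j => (hg₂ i j).1) s).const_smul (y i)
    have h3 := norm_secondDiff_le_of_deriv h1 h2 (B := d * d * K * ‖y‖ ^ 2) (fun s => by
      have : ∀ i ∈ Finset.univ, ‖y i • ∑ j, y j •
          (ρ ⋆[ContinuousLinearMap.lsmul ℝ ℝ, volume] g₂ i j) (x + s • y)‖ ≤
          ‖y‖ * (d * (‖y‖ * K)) := by
        intro i _
        rw [norm_smul]
        refine mul_le_mul (hcoord i) ?_ (norm_nonneg _) (norm_nonneg _)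
        refine (norm_sum_le_of_le (Finset.univ) (f := fun j => y j •
          (ρ ⋆[ContinuousLinearMap.lsmul ℝ ℝ, volume] g₂ i j) (x + s • y))
          (n := fun _ => ‖y‖ * K) fun j _ => ?_).trans (by simp)
        rw [norm_smul]
        exact mul_le_mul (hcoord j) (norm_convolution_normed_le (hbd i j) φ _)
          (norm_nonneg _) (norm_nonneg _)
      refine (norm_sum_le_of_le _ this).trans (le_of_eq ?_)
      simp
      ring)
    simp only [one_smul, neg_smul, zero_smul, add_zero, ← sub_eq_add_neg] at h3
    linarith
  let φ : ℕ → ContDiffBump (0 : E d) := fun n =>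
    ⟨1 / (2 * (n + 1)), 1 / (n + 1), by positivity, by
      apply one_div_lt_one_div_of_lt <;> [positivity; linarith [(n.cast_nonneg : (0 : ℝ) ≤ n)]]⟩
  have hφ : Tendsto (fun n => (φ n).rOut) atTop (𝓝 0) := tendsto_one_div_add_atTop_nhds_zero_nat
  have hlim := fun z => ContDiffBump.convolution_tendsto_right_of_continuous (μ := volume)
    hφ hgc z
  exact le_of_tendsto (((hlim (x + y)).add (hlim (x - y))).sub
    ((hlim x).const_smul (2 : ℝ))).norm (Eventually.of_forall fun n => main (φ n))

end Mollification

end PolicyIteration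

/-! ### Coupling of the jumps at three points -/

namespace PolicyIteration

/-- Control data with quantitative regularity: `c` and `f` are bounded, Lipschitz in `(t,x)` and
have second differences in `x` of quadratic order, and `H` is the attained minimum. -/
structure RegularControl {d m : ℕ} (T N K : ℝ) (A : Set (E m)) (c : ℝ → E d → E m → ℝ)
    (f : ℝ → E d → E m → E d) (H : ℝ → E d → E d → ℝ) : Prop where
  one_le_K : 1 ≤ K
  N_pos : 0 < N
  abs_c_le : ∀ t ∈ Icc 0 T, ∀ x, ∀ a ∈ A, |c t x a| ≤ K
  norm_f_le : ∀ t ∈ Icc 0 T, ∀ x, ∀ a ∈ A, ‖f t x a‖ ≤ 2 * N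
  lip_c : ∀ t ∈ Icc 0 T, ∀ s ∈ Icc 0 T, ∀ x y, ∀ a ∈ A,
    |c t x a - c s y a| ≤ K * (|t - s| + ‖x - y‖)
  lip_f : ∀ t ∈ Icc 0 T, ∀ s ∈ Icc 0 T, ∀ x y, ∀ a ∈ A,
    ‖f t x a - f s y a‖ ≤ K * (|t - s| + ‖x - y‖)
  second_c : ∀ t ∈ Icc 0 T, ∀ x y, ∀ a ∈ A,
    |c t (x + y) a + c t (x - y) a - 2 * c t x a| ≤ K * ‖y‖ ^ 2
  second_f : ∀ t ∈ Icc 0 T, ∀ x y, ∀ a ∈ A,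
    ‖f t (x + y) a + f t (x - y) a - (2 : ℝ) • f t x a‖ ≤ K * ‖y‖ ^ 2
  H_le : ∀ t ∈ Icc 0 T, ∀ x p, ∀ a ∈ A, H t x p ≤ c t x a + inner ℝ p (f t x a)
  H_attained : ∀ t ∈ Icc 0 T, ∀ x p, ∃ a ∈ A, H t x p = c t x a + inner ℝ p (f t x a)

section Elementary

variable {d : ℕ} {F : Type*} [NormedAddCommGroup F] [NormedSpace ℝ F]

/-- Compare with the midpoint of `x₁` and `x₂`: the second difference there accounts for `‖x₁ -
x₂‖²`, and the Lipschitz bound for replacing the midpoint by `x₀`. -/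
theorem norm_threePoint_le {K : ℝ} (hK : 0 ≤ K) {g : E d → F}
    (hlip : ∀ x y, ‖g x - g y‖ ≤ K * ‖x - y‖)
    (hsec : ∀ x y, ‖g (x + y) + g (x - y) - (2 : ℝ) • g x‖ ≤ K * ‖y‖ ^ 2) (x₁ x₂ x₀ : E d) :
    ‖g x₁ + g x₂ - (2 : ℝ) • g x₀‖ ≤ K * (‖x₁ - x₂‖ ^ 2 + ‖x₁ + x₂ - (2 : ℝ) • x₀‖) := by
  set mid : E d := (1 / 2 : ℝ) • (x₁ + x₂)
  set y : E d := (1 / 2 : ℝ) • (x₁ - x₂)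
  have e1 : mid + y = x₁ := by simp only [mid, y]; module
  have e2 : mid - y = x₂ := by simp only [mid, y]; module
  have e3 : ‖mid - x₀‖ = 1 / 2 * ‖x₁ + x₂ - (2 : ℝ) • x₀‖ := by
    rw [show mid - x₀ = (1 / 2 : ℝ) • (x₁ + x₂ - (2 : ℝ) • x₀) by simp only [mid]; module,
      norm_smul]; norm_num
  have e4 : ‖y‖ = 1 / 2 * ‖x₁ - x₂‖ := by simp only [y]; rw [norm_smul]; norm_num
  have h1 := hsec mid y
  have h2 := hlip mid x₀
  rw [e1, e2, e4] at h1
  rw [e3] at h2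
  have e5 : g x₁ + g x₂ - (2 : ℝ) • g x₀ =
      (g x₁ + g x₂ - (2 : ℝ) • g mid) + (2 : ℝ) • (g mid - g x₀) := by module
  rw [e5]
  refine (norm_add_le _ _).trans ?_
  rw [norm_smul]
  norm_num
  nlinarith [sq_nonneg ‖x₁ - x₂‖, mul_nonneg hK (sq_nonneg ‖x₁ - x₂‖)]

theorem abs_coord_le (y : E d) (i : Fin d) : |y i| ≤ ‖y‖ := by
  simpa using PiLp.norm_apply_le y i

theorem inner_eq_sum (x y : E d) : inner ℝ x y = ∑ i, x i * y i := by
  simp [PiLp.inner_apply, mul_comm]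

theorem norm_smul_single {h : ℝ} (hh : 0 ≤ h) (i : Fin d) :
    ‖h • (EuclideanSpace.single i (1 : ℝ) : E d)‖ = h := by
  rw [norm_smul]; simp [abs_of_nonneg hh]

theorem inner_smul_single (h : ℝ) (i : Fin d) (x : E d) :
    inner ℝ x (h • (EuclideanSpace.single i (1 : ℝ) : E d)) = h * x i := by
  rw [inner_smul_right, EuclideanSpace.inner_single_right]; simp

/-- The semi-discrete operator written as a jump generator. -/
theorem inner_discreteGradient_add {h : ℝ} (hh : 0 < h) (N : ℝ) (φ : E d → ℝ) (x F : E d) :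
    inner ℝ (discreteGradient h φ x) F + N * h * discreteLaplacian h φ x =
      (1 / (2 * h)) * ∑ i : Fin d,
        ((2 * N + F i) * (φ (x + h • EuclideanSpace.single i (1 : ℝ)) - φ x) +
          (2 * N - F i) * (φ (x - h • EuclideanSpace.single i (1 : ℝ)) - φ x)) := by
  rw [inner_eq_sum, discreteLaplacian, Finset.mul_sum, Finset.mul_sum, ← Finset.sum_add_distrib]
  refine Finset.sum_congr rfl fun i _ => ?_
  simp only [discreteGradient]
  field_simp
  ring

end Elementary

/-- A Gronwall-type maximum principle without topology on the state space. -/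
theorem nonpos_of_backward_inequality {Z : Type*} {T R : ℝ} (hR : 0 ≤ R)
    {g : ℝ → Z → ℝ} (hbdd : ∃ M, ∀ t ∈ Icc 0 T, ∀ z, g t z ≤ M)
    (hcont : ∀ z, ContinuousOn (fun t => g t z) (Icc 0 T)) (hterm : ∀ z, g T z ≤ 0)
    (hd : ∀ t ∈ Ioo 0 T, ∀ z, ∃ g', HasDerivAt (fun s => g s z) g' t ∧
      ∀ M, 0 ≤ M → (∀ z', g t z' ≤ M) → -g' ≤ R * (M - g t z)) :
    ∀ t ∈ Icc 0 T, ∀ z, g t z ≤ 0 := by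
  obtain ⟨M₀, hM₀⟩ := hbdd
  -- No maximum need be attained. The least nonnegative upper bound `M` is used instead: `exp (-R s)
  -- (M - g s z)` is nonincreasing in `s`, which improves the bound to `M (1 - exp (-R T))` and
  -- forces `M = 0`.
  set S : Set ℝ := {M | 0 ≤ M ∧ ∀ t ∈ Icc 0 T, ∀ z, g t z ≤ M} with hS
  have hSne : S.Nonempty := ⟨max M₀ 0, le_max_right _ _, fun t ht z =>
    (hM₀ t ht z).trans (le_max_left _ _)⟩
  have hSbd : BddBelow S := ⟨0, fun M hM => hM.1⟩
  set M := sInf S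
  have hM0 : 0 ≤ M := le_csInf hSne fun M hM => hM.1
  have hMS : ∀ t ∈ Icc 0 T, ∀ z, g t z ≤ M := fun t ht z => le_csInf hSne fun M hM => hM.2 t ht z
  have key : ∀ t ∈ Icc 0 T, ∀ z, g t z ≤ M * (1 - Real.exp (-(R * T))) := by
    intro t ht z
    set k : ℝ → ℝ := fun s => Real.exp (-(R * s)) * (M - g s z) with hk
    have hkc : ContinuousOn k (Icc 0 T) := by
      refine ContinuousOn.mul (by fun_prop) (continuousOn_const.sub (hcont z))
    have hkd : ∀ s ∈ Ioo 0 T, ∃ k', HasDerivAt k k' s ∧ k' ≤ 0 := by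
      intro s hs
      obtain ⟨g', hg', hle⟩ := hd s hs z
      have h1 : HasDerivAt (fun s => Real.exp (-(R * s))) (Real.exp (-(R * s)) * (-(R * 1))) s :=
        (((hasDerivAt_id s).const_mul R).neg).exp
      have h2 := h1.mul (hg'.const_sub M)
      refine ⟨_, h2, ?_⟩
      have h3 := hle M hM0 (hMS s (Ioo_subset_Icc_self hs))
      have h4 := Real.exp_pos (-(R * s))
      nlinarith
    have hanti : AntitoneOn k (Icc 0 T) := by
      refine antitoneOn_of_deriv_nonpos (convex_Icc 0 T) hkc ?_ ?_
      · rw [interior_Icc]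
        intro s hs
        obtain ⟨k', hk', -⟩ := hkd s hs
        exact hk'.differentiableAt.differentiableWithinAt
      · rw [interior_Icc]
        intro s hs
        obtain ⟨k', hk', h0⟩ := hkd s hs
        rwa [hk'.deriv]
    have hT : T ∈ Icc 0 T := ⟨ht.1.trans ht.2, le_rfl⟩
    have h5 := hanti ht hT ht.2
    simp only [hk] at h5
    have h6 : Real.exp (-(R * t)) ≤ 1 := Real.exp_le_one_iff.2 (by nlinarith [ht.1])
    have h7 : Real.exp (-(R * T)) * M ≤ Real.exp (-(R * T)) * (M - g T z) :=
      mul_le_mul_of_nonneg_left (by linarith [hterm z]) (Real.exp_pos _).le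
    have h8 : Real.exp (-(R * t)) * (M - g t z) ≤ 1 * (M - g t z) :=
      mul_le_mul_of_nonneg_right h6 (by linarith [hMS t ht z])
    linarith
  intro t ht z
  have he1 : 0 ≤ 1 - Real.exp (-(R * T)) := by
    have : Real.exp (-(R * T)) ≤ 1 := Real.exp_le_one_iff.2 (by nlinarith [ht.1, ht.2])
    linarith
  have h9 : M ≤ M * (1 - Real.exp (-(R * T))) := csInf_le hSbd ⟨mul_nonneg hM0 he1, key⟩
  have h10 : M * Real.exp (-(R * T)) ≤ 0 := by linarith
  have h11 : M ≤ 0 := by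
    by_contra hc
    push Not at hc
    exact absurd h10 (not_le.2 (mul_pos hc (Real.exp_pos _)))
  exact (hMS t ht z).trans h11

/-- At the common rate `ρ = min r₁ r₂ r₀` the three points jump together, at cost `B`. The excess
rates move one point alone, at cost `B + e (z + κ)`. As the `z` sum to zero, subtracting `ρ` from
the rates does not change `∑ r z`, while `κ` is only paid on the excess, which the differences of
the rates control. -/
theorem coupled_increment_le {r₁ r₂ r₀ p₁ p₂ p₀ z₁ z₂ z₀ θ κ B e D₁ D₂ : ℝ}
    (hr₁ : 0 ≤ r₁) (hr₂ : 0 ≤ r₂) (hr₀ : 0 ≤ r₀) (hκ : 0 ≤ κ) (hB : 0 ≤ B) (he : 0 ≤ e)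
    (hall : p₁ + θ * p₂ - (1 + θ) * p₀ ≤ B) (h₁ : p₁ ≤ B + e * (z₁ + κ))
    (h₂ : θ * p₂ ≤ B + e * (z₂ + κ)) (h₀ : -((1 + θ) * p₀) ≤ B + e * (z₀ + κ))
    (hz : z₁ + z₂ + z₀ = 0) (hD₁ : |r₁ - r₀| ≤ D₁) (hD₂ : |r₂ - r₀| ≤ D₂) :
    r₁ * p₁ + θ * (r₂ * p₂) - (1 + θ) * (r₀ * p₀) ≤
      (r₁ + r₂ + r₀) * B + e * (r₁ * z₁ + r₂ * z₂ + r₀ * z₀ + 3 * κ * (D₁ + D₂)) := by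
  obtain ⟨ρ, hρ0, hρ₁, hρ₂, hρ₀, hρ⟩ : ∃ ρ, 0 ≤ ρ ∧ ρ ≤ r₁ ∧ ρ ≤ r₂ ∧ ρ ≤ r₀ ∧
      (r₁ - ρ) + (r₂ - ρ) + (r₀ - ρ) ≤ 3 * (D₁ + D₂) := by
    rw [abs_le] at hD₁ hD₂
    refine ⟨min r₁ (min r₂ r₀), le_min hr₁ (le_min hr₂ hr₀), min_le_left _ _,
      (min_le_right _ _).trans (min_le_left _ _), (min_le_right _ _).trans (min_le_right _ _), ?_⟩
    rcases min_cases r₁ (min r₂ r₀) with ⟨h, _⟩ | ⟨h, _⟩ <;> rw [h] <;>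
    rcases min_cases r₂ r₀ with ⟨h', _⟩ | ⟨h', _⟩ <;> linarith
  have a1 := mul_le_mul_of_nonneg_left hall hρ0
  have a2 := mul_le_mul_of_nonneg_left h₁ (sub_nonneg.2 hρ₁)
  have a3 := mul_le_mul_of_nonneg_left h₂ (sub_nonneg.2 hρ₂)
  have a4 := mul_le_mul_of_nonneg_left h₀ (sub_nonneg.2 hρ₀)
  have a5 := mul_le_mul_of_nonneg_left hρ (mul_nonneg he hκ)
  have a6 := mul_nonneg hρ0 hB
  have a7 : z₀ = -z₁ - z₂ := by linarith
  subst a7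
  nlinarith

section ThreePoint

variable {d m : ℕ} {T N K : ℝ} {A : Set (E m)} {c : ℝ → E d → E m → ℝ}
  {f : ℝ → E d → E m → E d} {H : ℝ → E d → E d → ℝ} {q : E d → ℝ} {h : ℝ} {u : ℝ → E d → ℝ}

/-- Bound for the jump generators at three points, obtained by coupling the jumps. -/
theorem coupled_generator_le (hh : 0 < h) (hN : 0 < N) {φ : E d → ℝ}
    {F₁ F₂ F₀ : E d} (hF₁ : ‖F₁‖ ≤ 2 * N) (hF₂ : ‖F₂‖ ≤ 2 * N) (hF₀ : ‖F₀‖ ≤ 2 * N)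
    {x₁ x₂ x₀ ζ₁ ζ₂ ζ₀ : E d} {θ κ B e : ℝ} (hκ : 0 ≤ κ) (hB : 0 ≤ B) (he : 0 ≤ e)
    (hζ : ζ₁ + ζ₂ + ζ₀ = 0)
    (hall : ∀ v, φ (x₁ + v) - φ x₁ + θ * (φ (x₂ + v) - φ x₂) -
      (1 + θ) * (φ (x₀ + v) - φ x₀) ≤ B)
    (h₁ : ∀ v, ‖v‖ = h → φ (x₁ + v) - φ x₁ ≤ B + e * (inner ℝ ζ₁ v + κ))
    (h₂ : ∀ v, ‖v‖ = h → θ * (φ (x₂ + v) - φ x₂) ≤ B + e * (inner ℝ ζ₂ v + κ))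
    (h₀ : ∀ v, ‖v‖ = h → -((1 + θ) * (φ (x₀ + v) - φ x₀)) ≤ B + e * (inner ℝ ζ₀ v + κ)) :
    (inner ℝ (discreteGradient h φ x₁) F₁ + N * h * discreteLaplacian h φ x₁) +
      θ * (inner ℝ (discreteGradient h φ x₂) F₂ + N * h * discreteLaplacian h φ x₂) -
      (1 + θ) * (inner ℝ (discreteGradient h φ x₀) F₀ + N * h * discreteLaplacian h φ x₀) ≤
    12 * d * N / h * B + e * (inner ℝ ζ₁ F₁ + inner ℝ ζ₂ F₂ + inner ℝ ζ₀ F₀ +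
      3 * d / h * κ * (‖F₁ - F₀‖ + ‖F₂ - F₀‖)) := by
  simp only [inner_discreteGradient_add hh]
  have hrate : ∀ {F : E d}, ‖F‖ ≤ 2 * N → ∀ i, 0 ≤ 2 * N + F i ∧ 0 ≤ 2 * N - F i := by
    intro F hF i
    have := abs_le.1 ((abs_coord_le F i).trans hF)
    constructor <;> linarith [this.1, this.2]
  set D : ℝ := ‖F₁ - F₀‖ + ‖F₂ - F₀‖ with hD
  have term : ∀ i : Fin d,
      ((2 * N + F₁ i) * (φ (x₁ + h • EuclideanSpace.single i (1 : ℝ)) - φ x₁) +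
        (2 * N - F₁ i) * (φ (x₁ - h • EuclideanSpace.single i (1 : ℝ)) - φ x₁)) +
      θ * ((2 * N + F₂ i) * (φ (x₂ + h • EuclideanSpace.single i (1 : ℝ)) - φ x₂) +
        (2 * N - F₂ i) * (φ (x₂ - h • EuclideanSpace.single i (1 : ℝ)) - φ x₂)) -
      (1 + θ) * ((2 * N + F₀ i) * (φ (x₀ + h • EuclideanSpace.single i (1 : ℝ)) - φ x₀) +
        (2 * N - F₀ i) * (φ (x₀ - h • EuclideanSpace.single i (1 : ℝ)) - φ x₀)) ≤
      24 * N * B +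
        e * (2 * h * (ζ₁ i * F₁ i + ζ₂ i * F₂ i + ζ₀ i * F₀ i) + 6 * κ * D) := by
    intro i
    set v : E d := h • EuclideanSpace.single i (1 : ℝ) with hv
    have hvn : ‖v‖ = h := norm_smul_single hh.le i
    have hvn' : ‖-v‖ = h := by rw [norm_neg, hvn]
    obtain ⟨a1, b1⟩ := hrate hF₁ i
    obtain ⟨a2, b2⟩ := hrate hF₂ i
    obtain ⟨a0, b0⟩ := hrate hF₀ i
    have c1 : |F₁ i - F₀ i| ≤ ‖F₁ - F₀‖ := by simpa using abs_coord_le (F₁ - F₀) i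
    have c2 : |F₂ i - F₀ i| ≤ ‖F₂ - F₀‖ := by simpa using abs_coord_le (F₂ - F₀) i
    have hζi : ζ₁ i + ζ₂ i + ζ₀ i = 0 := by
      have := congrArg (fun w : E d => w i) hζ
      simpa using this
    have i1 : ∀ ζ : E d, inner ℝ ζ v = h * ζ i := fun ζ => inner_smul_single h i ζ
    have hp := coupled_increment_le (θ := θ) (κ := κ) (B := B) (e := e) a1 a2 a0 hκ hB he
      (hall v) (h₁ v hvn) (h₂ v hvn) (h₀ v hvn)
      (by rw [i1, i1, i1]; linear_combination h * hζi)
      (D₁ := ‖F₁ - F₀‖) (D₂ := ‖F₂ - F₀‖)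
      (by simpa using c1) (by simpa using c2)
    have hm := coupled_increment_le (θ := θ) (κ := κ) (B := B) (e := e) b1 b2 b0 hκ hB he
      (hall (-v)) (h₁ (-v) hvn') (h₂ (-v) hvn') (h₀ (-v) hvn')
      (by rw [inner_neg_right, inner_neg_right, inner_neg_right, i1, i1, i1]
          linear_combination (-h) * hζi)
      (D₁ := ‖F₁ - F₀‖) (D₂ := ‖F₂ - F₀‖)
      (by rw [abs_sub_comm]; simpa using c1) (by rw [abs_sub_comm]; simpa using c2)
    simp only [inner_neg_right, i1, ← sub_eq_add_neg] at hp hm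
    -- The six rates sum to `12 N`; the bound has slack.
    have hab : (2 * N + F₁ i + (2 * N + F₂ i) + (2 * N + F₀ i)) * B +
      (2 * N - F₁ i + (2 * N - F₂ i) + (2 * N - F₀ i)) * B ≤ 24 * N * B := by nlinarith
    rw [← hD] at hp hm
    nlinarith [hp, hm, hab]
  have hsum := Finset.sum_le_sum (s := Finset.univ) fun i _ => term i
  simp only [Finset.sum_sub_distrib, Finset.sum_add_distrib, ← Finset.mul_sum,
    Finset.sum_const, Finset.card_univ, Fintype.card_fin, nsmul_eq_mul] at hsum
  simp only [inner_eq_sum, Finset.sum_add_distrib]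
  have h2h : 0 < 1 / (2 * h) := by positivity
  have := mul_le_mul_of_nonneg_left hsum h2h.le
  refine le_trans (le_of_eq ?_) (this.trans (le_of_eq ?_))
  · ring
  · field_simp
    ring

/-- The function `exp ((l₁ + l₂)(T - t)) ψ` is a supersolution of the coupled problem: `l₁` absorbs
the running cost and `l₂` the drift together with the cost of uncoupled jumps. Invariance of `ψ`
makes simultaneous jumps free. In `hψ`, the vectors `ζ` are first-order coefficients for moving one
point alone and `κ` bounds the remainder at distance `h`. The factor `12 d N / h` enters only the
maximum principle, so the final bound does not see it. -/
theorem IsSemiDiscreteSolution.threePoint_le (hR : RegularControl T N K A c f H) (hh : 0 < h)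
    (hu : IsSemiDiscreteSolution T H q N h u) {θ l₁ l₂ : ℝ} (hθ : 0 ≤ θ) (hl₁ : 0 ≤ l₁)
    (hl₂ : 0 ≤ l₂) {ψ : E d → E d → E d → ℝ} (hψ0 : ∀ x₁ x₂ x₀, 0 ≤ ψ x₁ x₂ x₀)
    (hinv : ∀ x₁ x₂ x₀ v, ψ (x₁ + v) (x₂ + v) (x₀ + v) = ψ x₁ x₂ x₀)
    (hcψ : ∀ x₁ x₂ x₀, ∀ t ∈ Icc 0 T, ∀ a ∈ A,
      c t x₁ a + θ * c t x₂ a - (1 + θ) * c t x₀ a ≤ l₁ * ψ x₁ x₂ x₀)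
    (hψ : ∀ x₁ x₂ x₀, ∃ ζ₁ ζ₂ ζ₀ : E d, ∃ κ : ℝ, 0 ≤ κ ∧ ζ₁ + ζ₂ + ζ₀ = 0 ∧
      (∀ v, ‖v‖ = h → ψ (x₁ + v) x₂ x₀ - ψ x₁ x₂ x₀ ≤ inner ℝ ζ₁ v + κ) ∧
      (∀ v, ‖v‖ = h → ψ x₁ (x₂ + v) x₀ - ψ x₁ x₂ x₀ ≤ inner ℝ ζ₂ v + κ) ∧
      (∀ v, ‖v‖ = h → ψ x₁ x₂ (x₀ + v) - ψ x₁ x₂ x₀ ≤ inner ℝ ζ₀ v + κ) ∧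
      ∀ t ∈ Icc 0 T, ∀ a ∈ A,
        inner ℝ ζ₁ (f t x₁ a) + inner ℝ ζ₂ (f t x₂ a) + inner ℝ ζ₀ (f t x₀ a) +
          3 * d / h * κ * (‖f t x₁ a - f t x₀ a‖ + ‖f t x₂ a - f t x₀ a‖) ≤ l₂ * ψ x₁ x₂ x₀)
    (hq : ∀ x₁ x₂ x₀, q x₁ + θ * q x₂ - (1 + θ) * q x₀ ≤ ψ x₁ x₂ x₀) :
    ∀ t ∈ Icc 0 T, ∀ x₁ x₂ x₀, u t x₁ + θ * u t x₂ - (1 + θ) * u t x₀ ≤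
      Real.exp ((l₁ + l₂) * (T - t)) * ψ x₁ x₂ x₀ := by
  obtain ⟨⟨M, hM⟩, huc⟩ := hu.boundedContinuous
  set g : ℝ → E d × E d × E d → ℝ := fun t z => u t z.1 + θ * u t z.2.1 - (1 + θ) * u t z.2.2 -
    Real.exp ((l₁ + l₂) * (T - t)) * ψ z.1 z.2.1 z.2.2 with hg
  have hucont : ∀ x, ContinuousOn (fun t => u t x) (Icc 0 T) := fun x =>
    huc.comp (f := fun t => (t, x)) (by fun_prop) fun t ht => ⟨ht, mem_univ _⟩
  have hexp1 : ∀ t ∈ Icc 0 T, 1 ≤ Real.exp ((l₁ + l₂) * (T - t)) := fun t ht =>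
    Real.one_le_exp (mul_nonneg (by positivity) (by linarith [ht.2]))
  suffices hmain : ∀ t ∈ Icc 0 T, ∀ z, g t z ≤ 0 by
    intro t ht x₁ x₂ x₀
    have := hmain t ht (x₁, x₂, x₀)
    simp only [hg] at this
    linarith
  refine nonpos_of_backward_inequality (R := 12 * d * N / h)
    (by have := hR.N_pos; positivity) ⟨M + θ * M + (1 + θ) * M, ?_⟩ ?_ ?_ ?_
  · intro t ht z
    have b1 := abs_le.1 (hM t ht z.1)
    have b2 := abs_le.1 (hM t ht z.2.1)
    have b3 := abs_le.1 (hM t ht z.2.2)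
    have b4 := mul_nonneg (Real.exp_pos ((l₁ + l₂) * (T - t))).le (hψ0 z.1 z.2.1 z.2.2)
    simp only [hg]
    nlinarith [mul_le_mul_of_nonneg_left b2.2 hθ,
      mul_le_mul_of_nonneg_left b3.1 (by linarith : 0 ≤ 1 + θ)]
  · intro z
    simp only [hg]
    exact (((hucont _).add ((hucont _).const_mul θ)).sub ((hucont _).const_mul (1 + θ))).sub
      (by fun_prop)
  · intro z
    simp only [hg, hu.terminal, sub_self, mul_zero, Real.exp_zero, one_mul]
    linarith [hq z.1 z.2.1 z.2.2]
  · rintro t ht ⟨x₁, x₂, x₀⟩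
    have htc := Ioo_subset_Icc_self ht
    obtain ⟨u₁, hu₁, e₁⟩ := hu.equation t ht x₁
    obtain ⟨u₂, hu₂, e₂⟩ := hu.equation t ht x₂
    obtain ⟨u₀, hu₀, e₀⟩ := hu.equation t ht x₀
    set e := Real.exp ((l₁ + l₂) * (T - t)) with he
    have hde : HasDerivAt (fun s => Real.exp ((l₁ + l₂) * (T - s)))
        (e * ((l₁ + l₂) * (-1))) t :=
      (((hasDerivAt_id t).const_sub T).const_mul (l₁ + l₂)).exp
    refine ⟨_, ((hu₁.add (hu₂.const_mul θ)).sub (hu₀.const_mul (1 + θ))).sub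
      (hde.mul_const (ψ x₁ x₂ x₀)), ?_⟩
    intro B₀ hB₀ hle
    -- The minimizer at `x₀`, the point with negative weight, is admissible though suboptimal at
    -- `x₁` and `x₂`, so every error has the favourable sign.
    obtain ⟨a, ha, hHa⟩ := hR.H_attained t htc x₀ (discreteGradient h (u t) x₀)
    have hH₁ := hR.H_le t htc x₁ (discreteGradient h (u t) x₁) a ha
    have hH₂ := hR.H_le t htc x₂ (discreteGradient h (u t) x₂) a ha
    obtain ⟨ζ₁, ζ₂, ζ₀, κ, hκ, hζ, k₁, k₂, k₀, kf⟩ := hψ x₁ x₂ x₀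
    have hepos : 0 ≤ e := (Real.exp_pos _).le
    have hgen := coupled_generator_le (φ := u t) (x₁ := x₁) (x₂ := x₂) (x₀ := x₀) (θ := θ)
      (B := B₀ - g t (x₁, x₂, x₀)) (e := e) hh hR.N_pos
      (hR.norm_f_le t htc x₁ a ha) (hR.norm_f_le t htc x₂ a ha) (hR.norm_f_le t htc x₀ a ha)
      hκ (by linarith [hle (x₁, x₂, x₀)]) hepos hζ
      (fun v => by
        have := hle (x₁ + v, x₂ + v, x₀ + v)
        simp only [hg, hinv, ← he] at this ⊢
        linarith)
      (fun v hv => by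
        have := hle (x₁ + v, x₂, x₀)
        have h2 := mul_le_mul_of_nonneg_left (k₁ v hv) hepos
        simp only [hg, ← he] at this ⊢
        linarith)
      (fun v hv => by
        have := hle (x₁, x₂ + v, x₀)
        have h2 := mul_le_mul_of_nonneg_left (k₂ v hv) hepos
        simp only [hg, ← he] at this ⊢
        linarith)
      (fun v hv => by
        have := hle (x₁, x₂, x₀ + v)
        have h2 := mul_le_mul_of_nonneg_left (k₀ v hv) hepos
        simp only [hg, ← he] at this ⊢
        linarith)
    have hc1 := hcψ x₁ x₂ x₀ t htc a ha
    have hc2 : l₁ * ψ x₁ x₂ x₀ ≤ e * (l₁ * ψ x₁ x₂ x₀) :=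
      le_mul_of_one_le_left (mul_nonneg hl₁ (hψ0 _ _ _)) (hexp1 t htc)
    have hf2 := mul_le_mul_of_nonneg_left (kf t htc a ha) hepos
    have hθH := mul_le_mul_of_nonneg_left hH₂ hθ
    rw [hHa] at e₀
    have E₁ : u₁ = -(N * h * discreteLaplacian h (u t) x₁) -
      H t x₁ (discreteGradient h (u t) x₁) := by linarith
    have E₂ : u₂ = -(N * h * discreteLaplacian h (u t) x₂) -
      H t x₂ (discreteGradient h (u t) x₂) := by linarith
    have E₀ : u₀ = -(N * h * discreteLaplacian h (u t) x₀) -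
      (c t x₀ a + inner ℝ (discreteGradient h (u t) x₀) (f t x₀ a)) := by linarith
    rw [E₁, E₂, E₀]
    linarith

end ThreePoint

end PolicyIteration

namespace PolicyIteration

/-! ### Estimates for the scheme that are uniform in the mesh size -/

section Estimates

variable {d m : ℕ} {T N K : ℝ} {A : Set (E m)} {c : ℝ → E d → E m → ℝ}
  {f : ℝ → E d → E m → E d} {H : ℝ → E d → E d → ℝ} {q : E d → ℝ}

/-- As an infimum of affine functions of `p`, `H` is concave, and the drift of a minimizing control
is a supergradient. -/
theorem RegularControl.exists_supergradient (hR : RegularControl T N K A c f H) {t : ℝ}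
    (ht : t ∈ Icc 0 T) (x p : E d) :
    ∃ b : E d, ‖b‖ ≤ 2 * N ∧ ∀ p', H t x p' ≤ H t x p + inner ℝ (p' - p) b := by
  obtain ⟨a, ha, hH⟩ := hR.H_attained t ht x p
  refine ⟨f t x a, hR.norm_f_le t ht x a ha, fun p' => ?_⟩
  rw [hH, inner_sub_left]
  linarith [hR.H_le t ht x p' a ha]

theorem RegularControl.H_sub_le (hR : RegularControl T N K A c f H) {t : ℝ}
    (ht : t ∈ Icc 0 T) (x p p' : E d) : H t x p - H t x p' ≤ 2 * N * ‖p - p'‖ := by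
  obtain ⟨b, hb, hle⟩ := hR.exists_supergradient ht x p'
  have h1 := real_inner_le_norm (p - p') b
  have h2 := mul_le_mul_of_nonneg_left hb (norm_nonneg (p - p'))
  linarith [hle p]

theorem RegularControl.abs_H_sub_le (hR : RegularControl T N K A c f H) {t s : ℝ}
    (ht : t ∈ Icc 0 T) (hs : s ∈ Icc 0 T) (x y p : E d) :
    |H t x p - H s y p| ≤ K * (1 + ‖p‖) * (|t - s| + ‖x - y‖) := by
  have key : ∀ t ∈ Icc 0 T, ∀ s ∈ Icc 0 T, ∀ x y,
      H t x p - H s y p ≤ K * (1 + ‖p‖) * (|t - s| + ‖x - y‖) := by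
    intro t ht s hs x y
    obtain ⟨a, ha, hH⟩ := hR.H_attained s hs y p
    have h1 := hR.H_le t ht x p a ha
    have h2 := (abs_le.1 (hR.lip_c t ht s hs x y a ha)).2
    have h3 := real_inner_le_norm p (f t x a - f s y a)
    have h4 := mul_le_mul_of_nonneg_left (hR.lip_f t ht s hs x y a ha) (norm_nonneg p)
    rw [inner_sub_right] at h3
    rw [hH]
    nlinarith
  rw [abs_le]
  constructor
  · have := key s hs t ht y x
    rw [abs_sub_comm, norm_sub_rev] at this
    linarith
  · exact key t ht s hs x y

theorem threePoint_le_of_semiconcave (hK : 0 ≤ K) {g : E d → ℝ}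
    (hlip : ∀ x y, |g x - g y| ≤ K * ‖x - y‖)
    (hsec : ∀ x y, g (x + y) + g (x - y) - 2 * g x ≤ K * ‖y‖ ^ 2) (x₁ x₂ x₀ : E d) :
    g x₁ + g x₂ - 2 * g x₀ ≤ K * (‖x₁ - x₂‖ ^ 2 + ‖x₁ + x₂ - (2 : ℝ) • x₀‖) := by
  set mid : E d := (1 / 2 : ℝ) • (x₁ + x₂)
  set y : E d := (1 / 2 : ℝ) • (x₁ - x₂)
  have e1 : mid + y = x₁ := by simp only [mid, y]; module
  have e2 : mid - y = x₂ := by simp only [mid, y]; module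
  have e3 : ‖mid - x₀‖ = 1 / 2 * ‖x₁ + x₂ - (2 : ℝ) • x₀‖ := by
    rw [show mid - x₀ = (1 / 2 : ℝ) • (x₁ + x₂ - (2 : ℝ) • x₀) by simp only [mid]; module,
      norm_smul]; norm_num
  have e4 : ‖y‖ = 1 / 2 * ‖x₁ - x₂‖ := by simp only [y]; rw [norm_smul]; norm_num
  have h1 := hsec mid y
  have h2 := (abs_le.1 (hlip mid x₀)).2
  rw [e1, e2, e4] at h1
  rw [e3] at h2
  nlinarith [mul_nonneg hK (sq_nonneg ‖x₁ - x₂‖)]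

/-- Three-point comparison with `θ = 0` and `x₂ = x₀`. A jump of one point changes `ψ` by at most `2
K h`, which cancels the `1/h` in front of `κ`; this is why `ζ = 0` is enough. -/
theorem RegularControl.exists_lipschitz_bound (hR : RegularControl T N K A c f H)
    (hq : ∀ x y, |q x - q y| ≤ K * ‖x - y‖) :
    ∃ L : ℝ, 0 ≤ L ∧ ∀ h > 0, ∀ u, IsSemiDiscreteSolution T H q N h u →
      ∀ t ∈ Icc 0 T, ∀ x y, |u t x - u t y| ≤ L * ‖x - y‖ := by
  have hK : 0 ≤ K := zero_le_one.trans hR.one_le_K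
  refine ⟨Real.exp ((1 + 6 * d * K) * T) * K, by positivity, fun h hh u hu => ?_⟩
  have key : ∀ t ∈ Icc 0 T, ∀ x y,
      u t x - u t y ≤ Real.exp ((1 + 6 * d * K) * T) * K * ‖x - y‖ := by
    intro t ht x y
    have := hu.threePoint_le hR hh (θ := 0) (l₁ := 1) (l₂ := 6 * d * K) le_rfl zero_le_one
      (by positivity) (ψ := fun x₁ x₂ x₀ => K * (‖x₁ - x₀‖ + ‖x₂ - x₀‖))
      (fun _ _ _ => by positivity) (fun x₁ x₂ x₀ v => by simp)
      (fun x₁ x₂ x₀ t ht a ha => by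
        have h1 := (abs_le.1 (hR.lip_c t ht t ht x₁ x₀ a ha)).2
        have h2 : 0 ≤ K * ‖x₂ - x₀‖ := by positivity
        simp only [sub_self, abs_zero, zero_add] at h1
        linarith)
      (fun x₁ x₂ x₀ => by
        refine ⟨0, 0, 0, 2 * K * h, by positivity, by simp, ?_, ?_, ?_, ?_⟩
        · intro v hv
          have h1 : ‖x₁ + v - x₀‖ ≤ ‖x₁ - x₀‖ + ‖v‖ := by
            rw [show x₁ + v - x₀ = (x₁ - x₀) + v by abel]; exact norm_add_le _ _
          have h2 := mul_le_mul_of_nonneg_left h1 hK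
          simp only [inner_zero_left]
          rw [hv] at h2
          nlinarith
        · intro v hv
          have h1 : ‖x₂ + v - x₀‖ ≤ ‖x₂ - x₀‖ + ‖v‖ := by
            rw [show x₂ + v - x₀ = (x₂ - x₀) + v by abel]; exact norm_add_le _ _
          have h2 := mul_le_mul_of_nonneg_left h1 hK
          simp only [inner_zero_left]
          rw [hv] at h2
          nlinarith
        · intro v hv
          have h1 : ‖x₁ - (x₀ + v)‖ ≤ ‖x₁ - x₀‖ + ‖v‖ := by
            rw [show x₁ - (x₀ + v) = (x₁ - x₀) - v by abel]; exact norm_sub_le _ _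
          have h2 := mul_le_mul_of_nonneg_left h1 hK
          have h3 : ‖x₂ - (x₀ + v)‖ ≤ ‖x₂ - x₀‖ + ‖v‖ := by
            rw [show x₂ - (x₀ + v) = (x₂ - x₀) - v by abel]; exact norm_sub_le _ _
          have h4 := mul_le_mul_of_nonneg_left h3 hK
          simp only [inner_zero_left]
          rw [hv] at h2 h4
          nlinarith
        · intro t ht a ha
          have h1 := hR.lip_f t ht t ht x₁ x₀ a ha
          have h2 := hR.lip_f t ht t ht x₂ x₀ a ha
          simp only [sub_self, abs_zero, zero_add] at h1 h2
          simp only [inner_zero_left, zero_add]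
          have e : 3 * (d : ℝ) / h * (2 * K * h) = 6 * d * K := by field_simp; ring
          rw [e]
          refine mul_le_mul_of_nonneg_left ?_ (by positivity)
          linarith)
      (fun x₁ x₂ x₀ => by
        have h1 := (abs_le.1 (hq x₁ x₀)).2
        have h2 : 0 ≤ K * ‖x₂ - x₀‖ := by positivity
        linarith) t ht x y y
    simp only [sub_self, norm_zero, add_zero, zero_mul, one_mul] at this
    have h3 : Real.exp ((1 + 6 * d * K) * (T - t)) ≤ Real.exp ((1 + 6 * d * K) * T) :=
      Real.exp_le_exp.2 (mul_le_mul_of_nonneg_left (by linarith [ht.1]) (by positivity))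
    have h4 := mul_le_mul_of_nonneg_right h3 (by positivity : 0 ≤ K * ‖x - y‖)
    linarith
  intro t ht x y
  rw [abs_le]
  constructor
  · have := key t ht y x
    rw [norm_sub_rev] at this
    linarith
  · exact key t ht x y

/-- The regularized norm has second derivatives of order `1/μ`, so a jump of length `h` leaves a
remainder of order `h²/μ`, where the norm itself would leave one of order `h`. -/
theorem sqrt_norm_sq_add_le {μ : ℝ} (hμ : 0 < μ) (ξ w : E d) :
    √(‖ξ + w‖ ^ 2 + μ ^ 2) ≤ √(‖ξ‖ ^ 2 + μ ^ 2) +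
      inner ℝ ((1 / √(‖ξ‖ ^ 2 + μ ^ 2)) • ξ) w + ‖w‖ ^ 2 / (2 * μ) := by
  set s := √(‖ξ‖ ^ 2 + μ ^ 2) with hs
  have hs2 : s ^ 2 = ‖ξ‖ ^ 2 + μ ^ 2 := Real.sq_sqrt (by positivity)
  have hsμ : μ ≤ s := Real.le_sqrt_of_sq_le (by nlinarith [sq_nonneg ‖ξ‖])
  have hs0 : 0 < s := hμ.trans_le hsμ
  have h1 : ‖ξ + w‖ ^ 2 = ‖ξ‖ ^ 2 + 2 * inner ℝ ξ w + ‖w‖ ^ 2 := norm_add_sq_real ξ w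
  set i := inner ℝ ξ w
  have h2 : inner ℝ ((1 / s) • ξ) w = i / s := by
    rw [real_inner_smul_left]; simp only [i]; ring
  have h0 : 0 ≤ s ^ 2 + 2 * i + ‖w‖ ^ 2 := by rw [hs2]; nlinarith [sq_nonneg ‖ξ + w‖, sq_nonneg μ]
  have h3 : √(‖ξ + w‖ ^ 2 + μ ^ 2) ≤ s + i / s + ‖w‖ ^ 2 / (2 * s) := by
    have e : s + i / s + ‖w‖ ^ 2 / (2 * s) = (2 * s ^ 2 + 2 * i + ‖w‖ ^ 2) / (2 * s) := by
      field_simp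
    rw [e]
    refine Real.sqrt_le_iff.2 ⟨div_nonneg (by nlinarith) (by positivity), ?_⟩
    rw [div_pow, le_div_iff₀ (by positivity), h1]
    nlinarith [sq_nonneg (2 * i + ‖w‖ ^ 2)]
  have h4 : ‖w‖ ^ 2 / (2 * s) ≤ ‖w‖ ^ 2 / (2 * μ) := by gcongr
  rw [h2]
  linarith

/-- Three-point comparison with `θ = 1`. The first two terms of `ψ` are the three-point modulus of a
semi-concave function with the norm smoothed at scale `μ`. Uncoupled jumps then cost `(h/μ)(‖ξ‖ +
‖η‖)`, with `η = x₁ - x₂` and `ξ = x₁ + x₂ - 2x₀`. The smoothed norm absorbs the `ξ` part, and the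
third term `(h/μ)‖η‖` is there to absorb the rest. -/
theorem RegularControl.exists_weak_semiconcavity (hR : RegularControl T N K A c f H)
    (hq : ∀ x y, |q x - q y| ≤ K * ‖x - y‖)
    (hqs : ∀ x y, q (x + y) + q (x - y) - 2 * q x ≤ K * ‖y‖ ^ 2) :
    ∃ C : ℝ, 0 ≤ C ∧ ∀ h > 0, ∀ μ, h ≤ μ → μ ≤ 1 → ∀ u, IsSemiDiscreteSolution T H q N h u →
      ∀ t ∈ Icc 0 T, ∀ x y, u t (x + y) + u t (x - y) - 2 * u t x ≤
        C * (‖y‖ ^ 2 + μ + h / μ * ‖y‖) := by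
  have hK : 0 ≤ K := zero_le_one.trans hR.one_le_K
  refine ⟨4 * Real.exp ((1 + (3 + 9 * d) * K) * T) * K, by positivity,
    fun h hh μ hhμ hμ1 u hu t ht x y => ?_⟩
  have hμ : 0 < μ := hh.trans_le hhμ
  have hhμ' : 0 ≤ h / μ := by positivity
  have hhμ1 : h / μ ≤ 1 := (div_le_one hμ).2 hhμ
  have hs : ∀ ξ : E d, ‖ξ‖ ≤ √(‖ξ‖ ^ 2 + μ ^ 2) := fun ξ =>
    Real.le_sqrt_of_sq_le (by nlinarith [sq_nonneg μ])
  have hs0 : ∀ ξ : E d, 0 < √(‖ξ‖ ^ 2 + μ ^ 2) := fun ξ => Real.sqrt_pos.2 (by positivity)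
  have this := hu.threePoint_le hR hh (θ := 1) (l₁ := 1) (l₂ := (3 + 9 * d) * K) zero_le_one
    zero_le_one (by positivity)
    (ψ := fun x₁ x₂ x₀ => K * (‖x₁ - x₂‖ ^ 2 + √(‖x₁ + x₂ - (2 : ℝ) • x₀‖ ^ 2 + μ ^ 2) +
      h / μ * ‖x₁ - x₂‖))
    (fun _ _ _ => by positivity)
    (fun x₁ x₂ x₀ v => by
      have e1 : x₁ + v - (x₂ + v) = x₁ - x₂ := by abel
      have e2 : x₁ + v + (x₂ + v) - (2 : ℝ) • (x₀ + v) = x₁ + x₂ - (2 : ℝ) • x₀ := by module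
      rw [e1, e2])
    (fun x₁ x₂ x₀ t ht a ha => by
      have h1 := norm_threePoint_le (g := fun x => c t x a) hK
        (fun x y => by simpa using hR.lip_c t ht t ht x y a ha)
        (fun x y => by simpa using hR.second_c t ht x y a ha) x₁ x₂ x₀
      simp only [smul_eq_mul, Real.norm_eq_abs] at h1
      have h2 := (abs_le.1 h1).2
      have h3 := mul_le_mul_of_nonneg_left (hs (x₁ + x₂ - (2 : ℝ) • x₀)) hK
      have h4 : 0 ≤ K * (h / μ * ‖x₁ - x₂‖) := by positivity
      linarith)
    (fun x₁ x₂ x₀ => by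
      set η := x₁ - x₂ with hη
      set ξ := x₁ + x₂ - (2 : ℝ) • x₀ with hξ
      set s := √(‖ξ‖ ^ 2 + μ ^ 2) with hsdef
      have hκ1 : h ^ 2 ≤ h ^ 2 / μ := by
        rw [le_div_iff₀ hμ]; nlinarith [sq_nonneg h]
      have hηv : ∀ v : E d, ‖v‖ = h → ‖η + v‖ ^ 2 - ‖η‖ ^ 2 = inner ℝ ((2 : ℝ) • η) v + h ^ 2 := by
        intro v hv
        rw [norm_add_sq_real, real_inner_smul_left, hv]; ring
      have hηn : ∀ v : E d, ‖v‖ = h → h / μ * (‖η + v‖ - ‖η‖) ≤ h ^ 2 / μ := by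
        intro v hv
        have h1 := norm_add_le η v
        rw [hv] at h1
        calc h / μ * (‖η + v‖ - ‖η‖) ≤ h / μ * h := by gcongr; linarith
          _ = h ^ 2 / μ := by ring
      -- These are the partial gradients of the two smooth terms of `ψ`. The third term needs none:
      -- its whole increment is at most `h²/μ` and goes into `κ`.
      refine ⟨K • ((2 : ℝ) • η + (1 / s) • ξ), K • (-(2 : ℝ) • η + (1 / s) • ξ),
        K • (-(2 : ℝ) • (1 / s) • ξ), K * (3 * (h ^ 2 / μ)), by positivity, by module,
        ?_, ?_, ?_, ?_⟩
      · intro v hv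
        have e1 : x₁ + v - x₂ = η + v := by rw [hη]; abel
        have e2 : x₁ + v + x₂ - (2 : ℝ) • x₀ = ξ + v := by rw [hξ]; abel
        rw [e1, e2, real_inner_smul_left, inner_add_left]
        have h1 := sqrt_norm_sq_add_le hμ ξ v
        rw [hv, ← hsdef] at h1
        have e3 : h ^ 2 / (2 * μ) = h ^ 2 / μ / 2 := by field_simp
        have h5 : 0 ≤ h ^ 2 / μ := by positivity
        have : ‖η + v‖ ^ 2 + √(‖ξ + v‖ ^ 2 + μ ^ 2) + h / μ * ‖η + v‖ -
          (‖η‖ ^ 2 + s + h / μ * ‖η‖) ≤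
          inner ℝ ((2 : ℝ) • η) v + inner ℝ ((1 / s) • ξ) v + 3 * (h ^ 2 / μ) := by
          linarith [hηv v hv, hηn v hv]
        have := mul_le_mul_of_nonneg_left this hK
        linarith
      · intro v hv
        have hv' : ‖-v‖ = h := by rw [norm_neg, hv]
        have e1 : x₁ - (x₂ + v) = η + -v := by rw [hη]; abel
        have e2 : x₁ + (x₂ + v) - (2 : ℝ) • x₀ = ξ + v := by rw [hξ]; abel
        rw [e1, e2, real_inner_smul_left, inner_add_left, neg_smul, inner_neg_left]
        have h1 := sqrt_norm_sq_add_le hμ ξ v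
        rw [hv, ← hsdef] at h1
        have e3 : h ^ 2 / (2 * μ) = h ^ 2 / μ / 2 := by field_simp
        have h5 : 0 ≤ h ^ 2 / μ := by positivity
        have h6 := hηv (-v) hv'
        rw [inner_neg_right] at h6
        have : ‖η + -v‖ ^ 2 + √(‖ξ + v‖ ^ 2 + μ ^ 2) + h / μ * ‖η + -v‖ -
          (‖η‖ ^ 2 + s + h / μ * ‖η‖) ≤
          -inner ℝ ((2 : ℝ) • η) v + inner ℝ ((1 / s) • ξ) v + 3 * (h ^ 2 / μ) := by
          linarith [hηn (-v) hv']
        have := mul_le_mul_of_nonneg_left this hK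
        linarith
      · intro v hv
        have e2 : x₁ + x₂ - (2 : ℝ) • (x₀ + v) = ξ + -(2 : ℝ) • v := by rw [hξ]; module
        have hw : ‖-(2 : ℝ) • v‖ = 2 * h := by rw [norm_smul, hv]; norm_num
        rw [e2, real_inner_smul_left, real_inner_smul_left]
        have h1 := sqrt_norm_sq_add_le hμ ξ (-(2 : ℝ) • v)
        rw [hw, ← hsdef, real_inner_smul_right] at h1
        have e3 : (2 * h) ^ 2 / (2 * μ) = 2 * (h ^ 2 / μ) := by field_simp
        have h5 : 0 ≤ h ^ 2 / μ := by positivity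
        have : ‖η‖ ^ 2 + √(‖ξ + -(2 : ℝ) • v‖ ^ 2 + μ ^ 2) + h / μ * ‖η‖ -
          (‖η‖ ^ 2 + s + h / μ * ‖η‖) ≤
          -2 * inner ℝ ((1 / s) • ξ) v + 3 * (h ^ 2 / μ) := by linarith
        have := mul_le_mul_of_nonneg_left this hK
        linarith
      · intro t ht a ha
        set F₁ := f t x₁ a
        set F₂ := f t x₂ a
        set F₀ := f t x₀ a
        have hlip : ∀ x y, ‖f t x a - f t y a‖ ≤ K * ‖x - y‖ := fun x y => by
          simpa using hR.lip_f t ht t ht x y a ha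
        have h1 : ‖F₁ + F₂ - (2 : ℝ) • F₀‖ ≤ K * (‖η‖ ^ 2 + ‖ξ‖) :=
          norm_threePoint_le (g := fun x => f t x a) hK hlip
            (fun x y => hR.second_f t ht x y a ha) x₁ x₂ x₀
        have h2 : ‖F₁ - F₂‖ ≤ K * ‖η‖ := hlip x₁ x₂
        have hx1 : ‖x₁ - x₀‖ ≤ 1 / 2 * (‖ξ‖ + ‖η‖) := by
          rw [show x₁ - x₀ = (1 / 2 : ℝ) • (ξ + η) by rw [hξ, hη]; module, norm_smul]
          norm_num
          exact norm_add_le _ _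
        have hx2 : ‖x₂ - x₀‖ ≤ 1 / 2 * (‖ξ‖ + ‖η‖) := by
          rw [show x₂ - x₀ = (1 / 2 : ℝ) • (ξ - η) by rw [hξ, hη]; module, norm_smul]
          norm_num
          exact norm_sub_le _ _
        have h3 : ‖F₁ - F₀‖ + ‖F₂ - F₀‖ ≤ K * (‖ξ‖ + ‖η‖) := by
          have a1 := (hlip x₁ x₀).trans (mul_le_mul_of_nonneg_left hx1 hK)
          have a2 := (hlip x₂ x₀).trans (mul_le_mul_of_nonneg_left hx2 hK)
          linarith
        have e1 : inner ℝ (K • ((2 : ℝ) • η + (1 / s) • ξ)) F₁ +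
            inner ℝ (K • (-(2 : ℝ) • η + (1 / s) • ξ)) F₂ +
            inner ℝ (K • (-(2 : ℝ) • (1 / s) • ξ)) F₀ =
            K * (2 * inner ℝ η (F₁ - F₂) +
              inner ℝ ((1 / s) • ξ) (F₁ + F₂ - (2 : ℝ) • F₀)) := by
          simp only [inner_add_left, inner_sub_right, inner_add_right, real_inner_smul_left,
            real_inner_smul_right]
          ring
        rw [e1]
        have h4 : inner ℝ η (F₁ - F₂) ≤ K * ‖η‖ ^ 2 := by
          refine (real_inner_le_norm _ _).trans ?_
          nlinarith [norm_nonneg η]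
        have h5 : inner ℝ ((1 / s) • ξ) (F₁ + F₂ - (2 : ℝ) • F₀) ≤ K * (‖η‖ ^ 2 + ‖ξ‖) := by
          refine (real_inner_le_norm _ _).trans ?_
          have : ‖(1 / s) • ξ‖ ≤ 1 := by
            rw [norm_smul, Real.norm_of_nonneg (by have := hs0 ξ; positivity), one_div,
              inv_mul_le_iff₀ (hs0 ξ), mul_one]
            exact hs ξ
          calc _ ≤ 1 * ‖F₁ + F₂ - (2 : ℝ) • F₀‖ := by gcongr
            _ ≤ _ := by rw [one_mul]; exact h1
        have h6 : 3 * (d : ℝ) / h * (K * (3 * (h ^ 2 / μ))) * (‖F₁ - F₀‖ + ‖F₂ - F₀‖) ≤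
            9 * d * K * (K * (s + h / μ * ‖η‖)) := by
          have e : 3 * (d : ℝ) / h * (K * (3 * (h ^ 2 / μ))) = 9 * d * K * (h / μ) := by
            field_simp; ring
          rw [e, mul_assoc]
          refine mul_le_mul_of_nonneg_left ?_ (by positivity)
          calc h / μ * (‖F₁ - F₀‖ + ‖F₂ - F₀‖) ≤ h / μ * (K * (‖ξ‖ + ‖η‖)) := by gcongr
            _ = K * (h / μ * ‖ξ‖ + h / μ * ‖η‖) := by ring
            _ ≤ K * (s + h / μ * ‖η‖) := by
              gcongr
              have := hs ξ
              calc h / μ * ‖ξ‖ ≤ 1 * ‖ξ‖ := by gcongr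
                _ ≤ s := by rw [one_mul]; exact this
        have h7 : 2 * inner ℝ η (F₁ - F₂) + inner ℝ ((1 / s) • ξ) (F₁ + F₂ - (2 : ℝ) • F₀) ≤
            3 * K * (‖η‖ ^ 2 + s + h / μ * ‖η‖) := by
          have a1 := mul_le_mul_of_nonneg_left (hs ξ) hK
          have a2 : 0 ≤ K * (h / μ * ‖η‖) := by positivity
          have a3 : 0 ≤ K * s := by have := hs0 ξ; positivity
          linarith
        have h8 := mul_le_mul_of_nonneg_left h7 hK
        have h9 : 0 ≤ 9 * d * K * (K * ‖η‖ ^ 2) := by positivity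
        linarith)
    (fun x₁ x₂ x₀ => by
      have h2 := threePoint_le_of_semiconcave hK hq hqs x₁ x₂ x₀
      have h3 := mul_le_mul_of_nonneg_left (hs (x₁ + x₂ - (2 : ℝ) • x₀)) hK
      have h4 : 0 ≤ K * (h / μ * ‖x₁ - x₂‖) := by positivity
      linarith) t ht (x + y) (x - y) x
  have e1 : x + y - (x - y) = (2 : ℝ) • y := by module
  have e2 : x + y + (x - y) - (2 : ℝ) • x = 0 := by module
  have e3 : ‖(2 : ℝ) • y‖ = 2 * ‖y‖ := by rw [norm_smul]; norm_num
  simp only [e1, e2, e3, norm_zero] at this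
  rw [show (0 : ℝ) ^ 2 + μ ^ 2 = μ ^ 2 by ring, Real.sqrt_sq hμ.le] at this
  have h3 : Real.exp ((1 + (3 + 9 * d) * K) * (T - t)) ≤
      Real.exp ((1 + (3 + 9 * d) * K) * T) :=
    Real.exp_le_exp.2 (mul_le_mul_of_nonneg_left (by linarith [ht.1]) (by positivity))
  have h5 : K * ((2 * ‖y‖) ^ 2 + μ + h / μ * (2 * ‖y‖)) ≤
      4 * K * (‖y‖ ^ 2 + μ + h / μ * ‖y‖) := by
    have : 0 ≤ K * (h / μ * ‖y‖) := by positivity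
    have : 0 ≤ K * μ := by positivity
    nlinarith
  have h4 := mul_le_mul h3 h5 (by positivity) (Real.exp_pos _).le
  linarith

theorem IsSemiDiscreteSolution.continuousOn_time {h : ℝ} {u : ℝ → E d → ℝ}
    (hu : IsSemiDiscreteSolution T H q N h u) (x : E d) :
    ContinuousOn (fun t => u t x) (Icc 0 T) :=
  hu.boundedContinuous.2.comp (f := fun t => (t, x)) (by fun_prop) fun t ht => ⟨ht, mem_univ _⟩

/-- In jump form the equation has rates of order `1/h` and spatial increments of size at most `L h`,
so the time derivative is bounded independently of `h`. -/
theorem RegularControl.exists_time_lipschitz_bound (hR : RegularControl T N K A c f H)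
    {L : ℝ} (hL : 0 ≤ L) :
    ∃ L' : ℝ, 0 ≤ L' ∧ ∀ h > 0, ∀ u, IsSemiDiscreteSolution T H q N h u →
      (∀ t ∈ Icc 0 T, ∀ x y, |u t x - u t y| ≤ L * ‖x - y‖) →
      ∀ t ∈ Icc 0 T, ∀ s ∈ Icc 0 T, ∀ x, |u t x - u s x| ≤ L' * |t - s| := by
  have hK : 0 ≤ K := zero_le_one.trans hR.one_le_K
  have hN := hR.N_pos
  refine ⟨K + 4 * d * N * L, by positivity, fun h hh u hu hlip => ?_⟩
  have hder : ∀ t ∈ Ioo 0 T, ∀ x, ∃ u', HasDerivAt (fun s => u s x) u' t ∧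
      |u'| ≤ K + 4 * d * N * L := by
    intro t ht x
    have htc := Ioo_subset_Icc_self ht
    obtain ⟨u', hu', e⟩ := hu.equation t ht x
    refine ⟨u', hu', ?_⟩
    obtain ⟨a, ha, hH⟩ := hR.H_attained t htc x (discreteGradient h (u t) x)
    have h1 := inner_discreteGradient_add hh N (u t) x (f t x a)
    have e' : u' = -(c t x a) - (1 / (2 * h)) * ∑ i : Fin d,
        ((2 * N + f t x a i) * (u t (x + h • EuclideanSpace.single i (1 : ℝ)) - u t x) +
          (2 * N - f t x a i) * (u t (x - h • EuclideanSpace.single i (1 : ℝ)) - u t x)) := by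
      rw [← h1]; linarith
    have hsum : |∑ i : Fin d,
        ((2 * N + f t x a i) * (u t (x + h • EuclideanSpace.single i (1 : ℝ)) - u t x) +
          (2 * N - f t x a i) * (u t (x - h • EuclideanSpace.single i (1 : ℝ)) - u t x))| ≤
        d * (8 * N * (L * h)) := by
      refine (Finset.abs_sum_le_sum_abs _ _).trans ?_
      refine (Finset.sum_le_card_nsmul _ _ (8 * N * (L * h)) fun i _ => ?_).trans
        (le_of_eq (by simp))
      have hf := abs_le.1 ((abs_coord_le (f t x a) i).trans (hR.norm_f_le t htc x a ha))
      have b1 : |u t (x + h • EuclideanSpace.single i (1 : ℝ)) - u t x| ≤ L * h := by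
        have := hlip t htc (x + h • EuclideanSpace.single i (1 : ℝ)) x
        rwa [add_sub_cancel_left, norm_smul_single hh.le] at this
      have b2 : |u t (x - h • EuclideanSpace.single i (1 : ℝ)) - u t x| ≤ L * h := by
        have := hlip t htc (x - h • EuclideanSpace.single i (1 : ℝ)) x
        rwa [sub_sub_cancel_left, norm_neg, norm_smul_single hh.le] at this
      have c1 : |2 * N + f t x a i| ≤ 4 * N := abs_le.2 ⟨by linarith, by linarith⟩
      have c2 : |2 * N - f t x a i| ≤ 4 * N := abs_le.2 ⟨by linarith, by linarith⟩
      refine (abs_add_le _ _).trans ?_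
      rw [abs_mul, abs_mul]
      have d1 := mul_le_mul c1 b1 (abs_nonneg _) (by positivity)
      have d2 := mul_le_mul c2 b2 (abs_nonneg _) (by positivity)
      linarith
    rw [e']
    refine (abs_sub _ _).trans ?_
    rw [abs_neg, abs_mul, abs_of_pos (by positivity : 0 < 1 / (2 * h))]
    have h2 := mul_le_mul_of_nonneg_left hsum (by positivity : 0 ≤ 1 / (2 * h))
    have h3 : 1 / (2 * h) * (d * (8 * N * (L * h))) = 4 * d * N * L := by field_simp; ring
    linarith [hR.abs_c_le t htc x a ha]
  have key : ∀ t ∈ Icc 0 T, ∀ s ∈ Icc 0 T, t < s → ∀ x,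
      |u t x - u s x| ≤ (K + 4 * d * N * L) * |t - s| := by
    intro t ht s hs hts x
    have hsub : Icc t s ⊆ Icc 0 T := Icc_subset_Icc ht.1 hs.2
    have hsub' : Ioo t s ⊆ Ioo 0 T := Ioo_subset_Ioo ht.1 hs.2
    obtain ⟨r, hr, e⟩ := exists_deriv_eq_slope (fun t => u t x) hts
      ((hu.continuousOn_time x).mono hsub) fun r hr => by
        obtain ⟨u', hu', -⟩ := hder r (hsub' hr) x
        exact hu'.differentiableAt.differentiableWithinAt
    obtain ⟨u', hu', hb⟩ := hder r (hsub' hr) x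
    rw [hu'.deriv, eq_div_iff (by linarith)] at e
    rw [abs_sub_comm (u t x), ← e, abs_mul, abs_sub_comm s t]
    gcongr
  intro t ht s hs x
  rcases lt_trichotomy t s with hts | rfl | hts
  · exact key t ht s hs hts x
  · simp
  · rw [abs_sub_comm, abs_sub_comm t]
    exact key s hs t ht hts x

end Estimates

end PolicyIteration

/-! ### Convergence of the scheme with rate `√h` -/

namespace PolicyIteration

/-- A function with continuous derivative on an open interval agrees near each point of it
with a globally `C¹` function. -/
theorem exists_contDiff_eventuallyEq {a b t₀ : ℝ} {g g' : ℝ → ℝ}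
    (hg : ∀ t ∈ Ioo a b, HasDerivAt g (g' t) t) (hg' : ContinuousOn g' (Ioo a b))
    (ht₀ : t₀ ∈ Ioo a b) : ∃ G : ℝ → ℝ, ContDiff ℝ 1 G ∧ G =ᶠ[𝓝 t₀] g := by
  obtain ⟨δ, hδ, hball⟩ := Metric.nhds_basis_closedBall.mem_iff.1 (Ioo_mem_nhds ht₀.1 ht₀.2)
  rw [Real.closedBall_eq_Icc] at hball
  have hle : t₀ - δ ≤ t₀ + δ := by linarith
  set k : ℝ → ℝ := IccExtend hle (Set.domRestrict (Icc (t₀ - δ) (t₀ + δ)) g') with hk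
  have hkc : Continuous k := (continuousOn_iff_continuous_domRestrict.1 (hg'.mono hball)).Icc_extend'
  have hkeq : ∀ s ∈ Icc (t₀ - δ) (t₀ + δ), k s = g' s := fun s hs => by
    rw [hk, IccExtend_of_mem hle _ hs, domRestrict_apply]
  set G : ℝ → ℝ := fun s => g t₀ + ∫ r in t₀..s, k r with hG
  have hGd : ∀ s, HasDerivAt G (k s) s := fun s =>
    (intervalIntegral.integral_hasDerivAt_right (hkc.intervalIntegrable _ _)
      hkc.aestronglyMeasurable.stronglyMeasurableAtFilter hkc.continuousAt).const_add _
  refine ⟨G, ?_, ?_⟩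
  · rw [contDiff_one_iff_deriv]
    refine ⟨fun s => (hGd s).differentiableAt, ?_⟩
    rwa [show deriv G = k from funext fun s => (hGd s).deriv]
  · filter_upwards [Ioo_mem_nhds (sub_lt_self t₀ hδ) (lt_add_of_pos_right t₀ hδ)] with s hs
    have hsub : uIcc t₀ s ⊆ Icc (t₀ - δ) (t₀ + δ) :=
      uIcc_subset_Icc ⟨by linarith, by linarith⟩ (Ioo_subset_Icc_self hs)
    have h1 : ∫ r in t₀..s, k r = g s - g t₀ := by
      refine intervalIntegral.integral_eq_sub_of_hasDerivAt (fun r hr => ?_)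
        (hkc.intervalIntegrable _ _)
      rw [hkeq r (hsub hr)]
      exact hg r (hball (hsub hr))
    simp only [hG, h1]
    ring

section Scheme

variable {d : ℕ}

theorem norm_le_sum_abs (x : E d) : ‖x‖ ≤ ∑ i, |x i| := by
  conv_lhs => rw [sum_smul_single x]
  refine (norm_sum_le _ _).trans (le_of_eq (Finset.sum_congr rfl fun i _ => ?_))
  rw [norm_smul]; simp

/-- Monotonicity of the scheme against a touching paraboloid. -/
theorem scheme_ge_of_min {N h ε : ℝ} (hN : 0 < N) (hh : 0 < h)
    {G : E d → ℝ} (hG : ∀ p p', G p - G p' ≤ 2 * N * ‖p - p'‖) {w : E d → ℝ} {x y : E d}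
    (hmin : ∀ z, w y + ‖x - y‖ ^ 2 / ε ≤ w z + ‖x - z‖ ^ 2 / ε) :
    G ((2 / ε) • (x - y)) - 2 * d * N * h / ε ≤
      G (discreteGradient h w y) + N * h * discreteLaplacian h w y := by
  set e : Fin d → E d := fun i => h • EuclideanSpace.single i (1 : ℝ) with he
  have hen : ∀ i, ‖e i‖ = h := fun i => norm_smul_single hh.le i
  set a : Fin d → ℝ := fun i => w (y + e i) + ‖x - (y + e i)‖ ^ 2 / ε - (w y + ‖x - y‖ ^ 2 / ε)
    with ha
  set b : Fin d → ℝ := fun i => w (y - e i) + ‖x - (y - e i)‖ ^ 2 / ε - (w y + ‖x - y‖ ^ 2 / ε)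
    with hb
  have ha0 : ∀ i, 0 ≤ a i := fun i => by simp only [ha]; linarith [hmin (y + e i)]
  have hb0 : ∀ i, 0 ≤ b i := fun i => by simp only [hb]; linarith [hmin (y - e i)]
  have hi : ∀ i, inner ℝ (x - y) (e i) = h * (x - y) i := fun i => inner_smul_single h i _
  have hp : ∀ i, w (y + e i) = w y + a i - (-(2 * (h * (x - y) i)) + h ^ 2) / ε := fun i => by
    simp only [ha]
    rw [show x - (y + e i) = (x - y) - e i by abel, norm_sub_sq_real, hi, hen]
    ring
  have hm : ∀ i, w (y - e i) = w y + b i - (2 * (h * (x - y) i) + h ^ 2) / ε := fun i => by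
    simp only [hb]
    rw [show x - (y - e i) = (x - y) + e i by abel, norm_add_sq_real, hi, hen]
    ring
  have hgrad : ∀ i, (discreteGradient h w y - (2 / ε) • (x - y)) i = (a i - b i) / (2 * h) := by
    intro i
    have h1 : discreteGradient h w y i = (w (y + e i) - w (y - e i)) / (2 * h) := rfl
    simp only [PiLp.sub_apply, PiLp.smul_apply, smul_eq_mul] at *
    rw [h1, hp, hm]
    field_simp
    ring
  have hlap : N * h * discreteLaplacian h w y =
      N / h * ∑ i, (a i + b i) - 2 * d * N * h / ε := by
    have h1 : discreteLaplacian h w y =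
        ∑ i, (w (y + e i) - 2 * w y + w (y - e i)) / h ^ 2 := rfl
    have h2 : ∀ i, (w (y + e i) - 2 * w y + w (y - e i)) / h ^ 2 =
        (1 / h ^ 2) * (a i + b i) - 2 / ε := fun i => by
      rw [hp, hm]; field_simp; ring
    rw [h1, Finset.sum_congr rfl fun i _ => h2 i, Finset.sum_sub_distrib, ← Finset.mul_sum]
    simp only [Finset.sum_const, Finset.card_univ, Fintype.card_fin, nsmul_eq_mul]
    field_simp
  -- The gaps `a`, `b` above the paraboloid change the gradient by at most this much. Multiplied by
  -- the Lipschitz constant `2N` of `G`, it is exactly the gain `(N/h) ∑ (a + b)` in the Laplacian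
  -- term.
  have hnorm : ‖(2 / ε) • (x - y) - discreteGradient h w y‖ ≤ 1 / (2 * h) * ∑ i, (a i + b i) := by
    rw [norm_sub_rev]
    refine (norm_le_sum_abs _).trans ?_
    rw [Finset.mul_sum]
    refine Finset.sum_le_sum fun i _ => ?_
    rw [hgrad i, abs_div, abs_of_pos (by positivity : 0 < 2 * h), div_eq_inv_mul, one_div]
    refine mul_le_mul_of_nonneg_left ?_ (by positivity)
    rw [abs_le]; constructor <;> linarith [ha0 i, hb0 i]
  have h3 := hG ((2 / ε) • (x - y)) (discreteGradient h w y)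
  have h4 := mul_le_mul_of_nonneg_left hnorm (by positivity : 0 ≤ 2 * N)
  have h5 : 2 * N * (1 / (2 * h) * ∑ i, (a i + b i)) = N / h * ∑ i, (a i + b i) := by
    field_simp
  rw [hlap]
  linarith

theorem hasGradientAt_mul_norm_sq (a : ℝ) (x y : E d) :
    HasGradientAt (fun z : E d => a * ‖z - y‖ ^ 2) ((2 * a) • (x - y)) x := by
  rw [hasGradientAt_iff_hasFDerivAt]
  have h := (((hasFDerivAt_id x).sub_const y).norm_sq).const_mul a
  refine h.congr_fderiv ?_
  ext z
  simp
  ring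

end Scheme

section Comparison

variable {d : ℕ} {T N K L h : ℝ} {H : ℝ → E d → E d → ℝ} {u v : ℝ → E d → ℝ}

theorem BoundedContinuous.continuousOn_time (hu : BoundedContinuous T u) (x : E d) :
    ContinuousOn (fun t => u t x) (Icc 0 T) :=
  hu.2.comp (f := fun t => (t, x)) (by fun_prop) fun t ht => ⟨ht, mem_univ _⟩

/-- By the equation this is minus the time derivative of `u`; its continuity allows `u (·, y₀)` to
enter a `C¹` test function. -/
theorem continuousOn_scheme
    (hH₁ : ∀ t ∈ Icc 0 T, ∀ x p p', H t x p - H t x p' ≤ 2 * N * ‖p - p'‖)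
    (hH₂ : ∀ t ∈ Icc 0 T, ∀ s ∈ Icc 0 T, ∀ x y p,
      |H t x p - H s y p| ≤ K * (1 + ‖p‖) * (|t - s| + ‖x - y‖))
    (hu : BoundedContinuous T u) (y : E d) :
    ContinuousOn (fun t => H t y (discreteGradient h (u t) y) +
      N * h * discreteLaplacian h (u t) y) (Icc 0 T) := by
  have hgc : ContinuousOn (fun t => discreteGradient h (u t) y) (Icc 0 T) := by
    refine (PiLp.continuous_toLp 2 _).comp_continuousOn (continuousOn_pi.2 fun i => ?_)
    exact ((hu.continuousOn_time _).sub (hu.continuousOn_time _)).div_const _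
  refine ContinuousOn.add ?_ (continuousOn_const.mul (continuousOn_finsetSum _ fun i _ =>
    (((hu.continuousOn_time _).sub ((hu.continuousOn_time _).const_mul 2)).add
      (hu.continuousOn_time _)).div_const _))
  intro s hs
  set P : ℝ → E d := fun t => discreteGradient h (u t) y with hP
  have hPs : Tendsto P (𝓝[Icc 0 T] s) (𝓝 (P s)) := hgc s hs
  have hbound : Tendsto (fun t => 2 * N * ‖P t - P s‖ + K * (1 + ‖P s‖) * (|t - s| + ‖y - y‖))
      (𝓝[Icc 0 T] s) (𝓝 0) := by
    have h1 : Tendsto (fun t => ‖P t - P s‖) (𝓝[Icc 0 T] s) (𝓝 0) := by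
      simpa using (hPs.sub_const (P s)).norm
    have h2 : Tendsto (fun t : ℝ => |t - s| + ‖y - y‖) (𝓝[Icc 0 T] s) (𝓝 0) :=
      (Continuous.tendsto' (by fun_prop) s 0 (by simp)).mono_left nhdsWithin_le_nhds
    simpa using (h1.const_mul (2 * N)).add (h2.const_mul (K * (1 + ‖P s‖)))
  refine tendsto_iff_norm_sub_tendsto_zero.2 ?_
  refine squeeze_zero' (Eventually.of_forall fun t => norm_nonneg _) ?_ hbound
  filter_upwards [self_mem_nhdsWithin] with t ht
  have a1 := hH₁ t ht y (P t) (P s)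
  have a2 := hH₁ t ht y (P s) (P t)
  have a3 := abs_le.1 (hH₂ t ht s hs y y (P s))
  rw [norm_sub_rev (P s)] at a2
  rw [Real.norm_eq_abs, abs_le]
  constructor <;> linarith [a3.1, a3.2]

/-- Time is not doubled, because `u` is `C¹` in time inside the interval. The terms `η / t` and `β
‖x‖²` confine the maximum to a compact set: outside `D` one penalty exceeds `B = 4M + η/T`, and the
value is below that at `(T, 0, 0)`. The term `k (T - t)` provides strictness later. -/
theorem exists_max_doubling (hT : 0 < T) (hv : BoundedContinuous T v) (hu : BoundedContinuous T u)
    {η β ε k M : ℝ} (hη : 0 < η) (hβ : 0 < β) (hε : 0 < ε) (hk : 0 ≤ k) (hM : 0 ≤ M)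
    (hMv : ∀ t ∈ Icc 0 T, ∀ x, |v t x| ≤ M) (hMu : ∀ t ∈ Icc 0 T, ∀ x, |u t x| ≤ M) :
    ∃ t₀ ∈ Ioc 0 T, ∃ x₀ y₀ : E d, (∀ t ∈ Ioc 0 T, ∀ x y,
      v t x - u t y - ‖x - y‖ ^ 2 / ε - β * ‖x‖ ^ 2 - η / t - k * (T - t) ≤
      v t₀ x₀ - u t₀ y₀ - ‖x₀ - y₀‖ ^ 2 / ε - β * ‖x₀‖ ^ 2 - η / t₀ - k * (T - t₀)) ∧
      β * ‖x₀‖ ^ 2 ≤ 4 * M + η / T := by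
  set B := 4 * M + η / T with hB
  have hB0 : 0 < B := by positivity
  set Φ : ℝ × E d × E d → ℝ := fun z => v z.1 z.2.1 - u z.1 z.2.2 - ‖z.2.1 - z.2.2‖ ^ 2 / ε -
    β * ‖z.2.1‖ ^ 2 - η / z.1 - k * (T - z.1) with hΦ
  set R₁ := √(B / β)
  set R₂ := √(B * ε)
  have hR₁ : β * R₁ ^ 2 = B := by
    simp only [R₁]; rw [Real.sq_sqrt (by positivity)]; field_simp
  have hR₂ : R₂ ^ 2 / ε = B := by
    simp only [R₂]; rw [Real.sq_sqrt (by positivity)]; field_simp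
  have hR₁0 : 0 ≤ R₁ := Real.sqrt_nonneg _
  have hR₂0 : 0 ≤ R₂ := Real.sqrt_nonneg _
  set τ := η / B with hτ
  have hτ0 : 0 < τ := by positivity
  have hτT : τ ≤ T := by
    rw [hτ, div_le_iff₀ hB0]
    have : T * (η / T) = η := by field_simp
    nlinarith
  set D : Set (ℝ × E d × E d) :=
    Icc τ T ×ˢ Metric.closedBall 0 R₁ ×ˢ Metric.closedBall 0 (R₁ + R₂) with hD
  have hDc : IsCompact D :=
    isCompact_Icc.prod ((isCompact_closedBall _ _).prod (isCompact_closedBall _ _))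
  have hsub : ∀ z ∈ D, z.1 ∈ Icc 0 T := fun z hz => ⟨hτ0.le.trans hz.1.1, hz.1.2⟩
  have hΦc : ContinuousOn Φ D := by
    have c1 : ContinuousOn (fun z : ℝ × E d × E d => v z.1 z.2.1) D :=
      hv.2.comp (f := fun z : ℝ × E d × E d => (z.1, z.2.1)) (by fun_prop)
        fun z hz => ⟨hsub z hz, mem_univ _⟩
    have c2 : ContinuousOn (fun z : ℝ × E d × E d => u z.1 z.2.2) D :=
      hu.2.comp (f := fun z : ℝ × E d × E d => (z.1, z.2.2)) (by fun_prop)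
        fun z hz => ⟨hsub z hz, mem_univ _⟩
    have c3 : ContinuousOn (fun z : ℝ × E d × E d => η / z.1) D :=
      continuousOn_const.div (by fun_prop) fun z hz => (hτ0.trans_le hz.1.1).ne'
    exact ((((c1.sub c2).sub (by fun_prop)).sub (by fun_prop)).sub c3).sub (by fun_prop)
  have hz0 : ((T, 0, 0) : ℝ × E d × E d) ∈ D :=
    ⟨⟨hτT, le_rfl⟩, by simpa using hR₁0, by simpa using add_nonneg hR₁0 hR₂0⟩
  have hΦ0 : -2 * M - η / T ≤ Φ (T, 0, 0) := by
    have b1 := abs_le.1 (hMv T ⟨hT.le, le_rfl⟩ 0)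
    have b2 := abs_le.1 (hMu T ⟨hT.le, le_rfl⟩ 0)
    simp only [hΦ, sub_self, norm_zero]
    norm_num
    linarith
  obtain ⟨z, hzD, hzmax⟩ := hDc.exists_isMaxOn ⟨_, hz0⟩ hΦc
  have hzT : z.1 ∈ Ioc 0 T := ⟨hτ0.trans_le hzD.1.1, hzD.1.2⟩
  have hupper : ∀ t ∈ Ioc 0 T, ∀ x y, Φ (t, x, y) ≤ 2 * M - ‖x - y‖ ^ 2 / ε - β * ‖x‖ ^ 2 - η / t := by
    intro t ht x y
    have b1 := abs_le.1 (hMv t (Ioc_subset_Icc_self ht) x)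
    have b2 := abs_le.1 (hMu t (Ioc_subset_Icc_self ht) y)
    have b3 := mul_nonneg hk (sub_nonneg.2 ht.2)
    simp only [hΦ]
    linarith
  have hz0max : Φ (T, 0, 0) ≤ Φ z := hzmax hz0
  refine ⟨z.1, hzT, z.2.1, z.2.2, ?_, ?_⟩
  · intro t ht x y
    change Φ (t, x, y) ≤ Φ z
    by_cases hmem : (t, x, y) ∈ D
    · exact hzmax hmem
    refine le_trans ?_ hz0max
    refine le_trans ?_ hΦ0
    refine (hupper t ht x y).trans ?_
    have p1 : 0 ≤ ‖x - y‖ ^ 2 / ε := by positivity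
    have p2 : 0 ≤ β * ‖x‖ ^ 2 := by positivity
    have p3 : 0 ≤ η / t := by have := ht.1; positivity
    by_contra hcon
    push Not at hcon
    refine hmem ⟨⟨?_, ht.2⟩, ?_, ?_⟩
    · rw [hτ, div_le_iff₀ hB0]
      have h1 : η / t ≤ B := by linarith
      rw [div_le_iff₀ ht.1] at h1
      linarith
    · rw [mem_closedBall_zero_iff]
      have h1 : β * ‖x‖ ^ 2 ≤ β * R₁ ^ 2 := by linarith
      exact le_of_sq_le_sq (le_of_mul_le_mul_left h1 hβ) hR₁0
    · rw [mem_closedBall_zero_iff]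
      have h1 : β * ‖x‖ ^ 2 ≤ β * R₁ ^ 2 := by linarith
      have h2 : ‖x‖ ≤ R₁ := le_of_sq_le_sq (le_of_mul_le_mul_left h1 hβ) hR₁0
      have h3 : ‖x - y‖ ^ 2 / ε ≤ R₂ ^ 2 / ε := by linarith
      have h4 : ‖x - y‖ ≤ R₂ := le_of_sq_le_sq ((div_le_div_iff_of_pos_right hε).1 h3) hR₂0
      have h5 : ‖y‖ ≤ ‖x‖ + ‖x - y‖ := by
        have := norm_sub_le x (x - y)
        rwa [sub_sub_cancel] at this
      linarith
  · have h1 := hupper z.1 hzT z.2.1 z.2.2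
    have p1 : 0 ≤ ‖z.2.1 - z.2.2‖ ^ 2 / ε := by positivity
    have p3 : 0 ≤ η / z.1 := by have := hzT.1; positivity
    have h2 : Φ (z.1, z.2.1, z.2.2) = Φ z := rfl
    linarith

/-- One-sided error estimate between a viscosity subsolution and a solution of the scheme. -/
theorem subsolution_sub_scheme_le (hT : 0 < T) (hN : 0 < N) (hK : 0 ≤ K) (hL : 0 ≤ L) (hh : 0 < h)
    (hH₁ : ∀ t ∈ Icc 0 T, ∀ x p p', H t x p - H t x p' ≤ 2 * N * ‖p - p'‖)
    (hH₂ : ∀ t ∈ Icc 0 T, ∀ s ∈ Icc 0 T, ∀ x y p,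
      |H t x p - H s y p| ≤ K * (1 + ‖p‖) * (|t - s| + ‖x - y‖))
    (hv : BoundedContinuous T v) (hu : BoundedContinuous T u)
    (hvT : ∀ x, v T x = u T x)
    (hsub : ∀ φ : ℝ → E d → ℝ, ContDiff ℝ 1 (fun z : ℝ × E d => φ z.1 z.2) →
      ∀ t ∈ Ioo 0 T, ∀ x : E d,
      IsLocalMax (fun z : ℝ × E d => v z.1 z.2 - φ z.1 z.2) (t, x) →
        0 ≤ deriv (fun s => φ s x) t + H t x (gradient (φ t) x))
    (hueq : ∀ t ∈ Ioo 0 T, ∀ x : E d, ∃ u' : ℝ, HasDerivAt (fun s => u s x) u' t ∧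
      u' + H t x (discreteGradient h (u t) x) = -(N * h * discreteLaplacian h (u t) x))
    (hulip : ∀ t ∈ Icc 0 T, ∀ x y, |u t x - u t y| ≤ L * ‖x - y‖) {ε : ℝ} (hε : 0 < ε) :
    ∀ t ∈ Icc 0 T, ∀ x, v t x - u t x ≤
      L ^ 2 * ε + T * (K * (1 + 2 * L) * (L * ε) + 2 * d * N * h / ε) := by
  obtain ⟨Mv, hMv⟩ := hv.1
  obtain ⟨Mu, hMu⟩ := hu.1
  set M := max Mv Mu
  have hMv' : ∀ t ∈ Icc 0 T, ∀ x, |v t x| ≤ M := fun t ht x => (hMv t ht x).trans (le_max_left _ _)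
  have hMu' : ∀ t ∈ Icc 0 T, ∀ x, |u t x| ≤ M := fun t ht x => (hMu t ht x).trans (le_max_right _ _)
  have hM : 0 ≤ M := (abs_nonneg _).trans (hMv' T ⟨hT.le, le_rfl⟩ 0)
  set k₀ := K * (1 + 2 * L) * (L * ε) + 2 * d * N * h / ε with hk₀
  have hk₀0 : 0 ≤ k₀ := by positivity
  have step : ∀ η > 0, ∀ β > 0, ∀ t ∈ Ioc 0 T, ∀ x,
      v t x - u t x ≤ L ^ 2 * ε + T * (k₀ + 4 * N * √(β * (4 * M + η / T))) +
        β * ‖x‖ ^ 2 + η / t := by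
    intro η hη β hβ t ht x
    -- `k` bounds the total error in the viscosity inequality: `k₀` from `x₀ ≠ y₀` and the
    -- discretization, the rest from the gradient `2 β x₀`. A maximum before `T` would then give `η
    -- / t₀² ≤ 0`.
    set k := k₀ + 4 * N * √(β * (4 * M + η / T)) with hk
    have hk0 : 0 ≤ k := by positivity
    obtain ⟨t₀, ht₀, x₀, y₀, hmax, hxb⟩ := exists_max_doubling hT hv hu hη hβ hε hk0 hM hMv' hMu'
    have ht₀c := Ioc_subset_Icc_self ht₀
    have hymin : ∀ z, u t₀ y₀ + ‖x₀ - y₀‖ ^ 2 / ε ≤ u t₀ z + ‖x₀ - z‖ ^ 2 / ε := fun z => by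
      linarith [hmax t₀ ht₀ x₀ z]
    have hxy : ‖x₀ - y₀‖ ≤ L * ε := by
      have h1 := hymin x₀
      have h2 := (abs_le.1 (hulip t₀ ht₀c x₀ y₀)).2
      rw [sub_self, norm_zero] at h1
      have h3 : ‖x₀ - y₀‖ ^ 2 / ε ≤ L * ‖x₀ - y₀‖ := by
        norm_num at h1
        linarith
      rw [div_le_iff₀ hε] at h3
      by_contra hc
      push Not at hc
      have h4 : 0 < ‖x₀ - y₀‖ := (by positivity : 0 ≤ L * ε).trans_lt hc
      nlinarith
    have htop : v t₀ x₀ - u t₀ y₀ - ‖x₀ - y₀‖ ^ 2 / ε - β * ‖x₀‖ ^ 2 - η / t₀ - k * (T - t₀) ≤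
        L ^ 2 * ε := by
      rcases ht₀.2.eq_or_lt with hTe | hTl
      · have h2 := (abs_le.1 (hulip t₀ ht₀c x₀ y₀)).2
        have h3 : v t₀ x₀ = u t₀ x₀ := by rw [hTe]; exact hvT x₀
        have h4 : 0 ≤ ‖x₀ - y₀‖ ^ 2 / ε := by positivity
        have h5 : 0 ≤ β * ‖x₀‖ ^ 2 := by positivity
        have h6 : 0 ≤ η / t₀ := by have := ht₀.1; positivity
        have h7 : 0 ≤ k * (T - t₀) := mul_nonneg hk0 (by linarith)
        have h8 := mul_le_mul_of_nonneg_left hxy hL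
        nlinarith
      · exfalso
        have ht₀o : t₀ ∈ Ioo 0 T := ⟨ht₀.1, hTl⟩
        set S : ℝ → ℝ := fun t => H t y₀ (discreteGradient h (u t) y₀) +
          N * h * discreteLaplacian h (u t) y₀ with hS
        have hSc : ContinuousOn S (Icc 0 T) := continuousOn_scheme hH₁ hH₂ hu y₀
        set g : ℝ → ℝ := fun t => u t y₀ + η / t + k * (T - t) with hg
        set g' : ℝ → ℝ := fun t => -S t + -(η / t ^ 2) + -k with hg'
        have hgd : ∀ t ∈ Ioo 0 T, HasDerivAt g (g' t) t := by
          intro t ht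
          obtain ⟨u', hu', e⟩ := hueq t ht y₀
          have e' : u' = -S t := by simp only [hS]; linarith
          rw [e'] at hu'
          have d1 : HasDerivAt (fun t => η / t) (-(η / t ^ 2)) t := by
            have := (hasDerivAt_inv ht.1.ne').const_mul η
            simp only [div_eq_mul_inv]
            exact this.congr_deriv (by ring)
          have d2 : HasDerivAt (fun t => k * (T - t)) (-k) t := by
            simpa using ((hasDerivAt_id t).const_sub T).const_mul k
          exact (hu'.add d1).add d2
        have hg'c : ContinuousOn g' (Ioo 0 T) := by
          refine (((hSc.mono Ioo_subset_Icc_self).neg).add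
            (ContinuousOn.neg ?_)).add continuousOn_const
          exact continuousOn_const.div (by fun_prop) fun t ht => by have := ht.1; positivity
        -- Test functions must be `C¹` globally, whereas `g` is only known to be `C¹` on `(0, T)`.
        obtain ⟨G, hGc, hGe⟩ := exists_contDiff_eventuallyEq hgd hg'c ht₀o
        set φ : ℝ → E d → ℝ := fun t x => G t + ((1 / ε) * ‖x - y₀‖ ^ 2 + β * ‖x - 0‖ ^ 2) with hφ
        have hφc : ContDiff ℝ 1 (fun z : ℝ × E d => φ z.1 z.2) := by
          simp only [hφ]
          exact (hGc.comp contDiff_fst).add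
            ((contDiff_const.mul ((contDiff_snd.sub contDiff_const).norm_sq ℝ)).add
              (contDiff_const.mul ((contDiff_snd.sub contDiff_const).norm_sq ℝ)))
        have hloc : IsLocalMax (fun z : ℝ × E d => v z.1 z.2 - φ z.1 z.2) (t₀, x₀) := by
          have h1 : ∀ᶠ z : ℝ × E d in 𝓝 (t₀, x₀), z.1 ∈ Ioc 0 T ∧ G z.1 = g z.1 := by
            have := (hGe.and (Ioo_mem_nhds ht₀o.1 ht₀o.2))
            have h2 : Tendsto (fun z : ℝ × E d => z.1) (𝓝 (t₀, x₀)) (𝓝 t₀) :=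
              continuous_fst.tendsto _
            filter_upwards [h2.eventually this] with z hz
            exact ⟨Ioo_subset_Ioc_self hz.2, hz.1⟩
          have h0 : G t₀ = g t₀ := hGe.self_of_nhds
          filter_upwards [h1] with z hz
          have := hmax z.1 hz.1 z.2 y₀
          simp only [hφ, hz.2, h0, hg, sub_zero]
          have e1 : (1 / ε) * ‖z.2 - y₀‖ ^ 2 = ‖z.2 - y₀‖ ^ 2 / ε := by ring
          have e2 : (1 / ε) * ‖x₀ - y₀‖ ^ 2 = ‖x₀ - y₀‖ ^ 2 / ε := by ring
          linarith
        have hmain := hsub φ hφc t₀ ht₀o x₀ hloc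
        have hder : deriv (fun s => φ s x₀) t₀ = g' t₀ := by
          have : HasDerivAt G (g' t₀) t₀ := (hgd t₀ ht₀o).congr_of_eventuallyEq hGe
          exact (this.add_const _).deriv
        set p : E d := (2 / ε) • (x₀ - y₀) with hp
        have hgrad : gradient (φ t₀) x₀ = p + (2 * β) • x₀ := by
          have h1 := hasGradientAt_mul_norm_sq (1 / ε) x₀ y₀
          have h2 := hasGradientAt_mul_norm_sq β x₀ 0
          rw [hasGradientAt_iff_hasFDerivAt] at h1 h2
          have h3 := (h1.add h2).const_add (G t₀)
          rw [← map_add] at h3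
          have h4 : HasGradientAt (φ t₀) ((2 * (1 / ε)) • (x₀ - y₀) + (2 * β) • (x₀ - 0)) x₀ := h3
          rw [h4.gradient, sub_zero, hp, show 2 * (1 / ε) = 2 / ε by ring]
        rw [hder, hgrad] at hmain
        have hscheme := scheme_ge_of_min hN hh (hH₁ t₀ ht₀c y₀) hymin
        rw [← hp] at hscheme
        have b1 := hH₁ t₀ ht₀c x₀ (p + (2 * β) • x₀) p
        rw [add_sub_cancel_left, norm_smul, Real.norm_of_nonneg (by positivity)] at b1
        have b2 := (abs_le.1 (hH₂ t₀ ht₀c t₀ ht₀c x₀ y₀ p)).2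
        rw [sub_self, abs_zero, zero_add] at b2
        have hpn : ‖p‖ ≤ 2 * L := by
          rw [hp, norm_smul, Real.norm_of_nonneg (by positivity)]
          calc 2 / ε * ‖x₀ - y₀‖ ≤ 2 / ε * (L * ε) := by gcongr
            _ = 2 * L := by field_simp
        have b3 : K * (1 + ‖p‖) * ‖x₀ - y₀‖ ≤ K * (1 + 2 * L) * (L * ε) := by gcongr
        have b4 : β * ‖x₀‖ ≤ √(β * (4 * M + η / T)) := by
          refine Real.le_sqrt_of_sq_le ?_
          nlinarith
        have b5 : 0 < η / t₀ ^ 2 := by have := ht₀.1; positivity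
        have b6 : 2 * N * (2 * β * ‖x₀‖) ≤ 4 * N * √(β * (4 * M + η / T)) := by
          nlinarith
        simp only [hg', hS] at hmain
        linarith
    have hfin := hmax t ht x x
    rw [sub_self, norm_zero] at hfin
    have h1 : k * (T - t) ≤ T * k := by nlinarith [ht.1]
    norm_num at hfin
    linarith
  have step2 : ∀ t ∈ Ioc 0 T, ∀ x, v t x - u t x ≤ L ^ 2 * ε + T * k₀ := by
    intro t ht x
    have hη : ∀ η > 0, v t x - u t x ≤ L ^ 2 * ε + T * k₀ + η / t := by
      intro η hη
      have hlim : Tendsto (fun β : ℝ => L ^ 2 * ε + T * (k₀ + 4 * N * √(β * (4 * M + η / T))) +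
          β * ‖x‖ ^ 2 + η / t) (𝓝[>] 0) (𝓝 (L ^ 2 * ε + T * k₀ + η / t)) :=
        (Continuous.tendsto' (by fun_prop) 0 _ (by simp)).mono_left nhdsWithin_le_nhds
      refine ge_of_tendsto hlim ?_
      filter_upwards [self_mem_nhdsWithin] with β hβ
      exact step η hη β hβ t ht x
    have hlim : Tendsto (fun η : ℝ => L ^ 2 * ε + T * k₀ + η / t) (𝓝[>] 0)
        (𝓝 (L ^ 2 * ε + T * k₀)) :=
      (Continuous.tendsto' (by fun_prop) 0 _ (by simp)).mono_left nhdsWithin_le_nhds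
    refine ge_of_tendsto hlim ?_
    filter_upwards [self_mem_nhdsWithin] with η h1
    exact hη η h1
  intro t ht x
  -- The penalty `η / t` excludes `t = 0`, which is recovered by continuity.
  rcases ht.1.eq_or_lt with h0 | h0
  · have hc : ContinuousWithinAt (fun t => v t x - u t x) (Icc 0 T) 0 :=
      ((hv.continuousOn_time x).sub (hu.continuousOn_time x)) 0 ⟨le_rfl, hT.le⟩
    have hc' : Tendsto (fun t => v t x - u t x) (𝓝[>] 0) (𝓝 (v 0 x - u 0 x)) := by
      rw [← nhdsWithin_Ioc_eq_nhdsGT hT]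
      exact hc.mono Ioc_subset_Icc_self
    rw [← h0]
    refine le_of_tendsto hc' ?_
    filter_upwards [Ioc_mem_nhdsGT hT] with s hs
    exact step2 s hs x
  · exact step2 t ⟨h0, ht.2⟩ x

end Comparison

end PolicyIteration

namespace PolicyIteration

section ErrorBound

variable {d m : ℕ} {T N K L : ℝ} {A : Set (E m)} {c : ℝ → E d → E m → ℝ}
  {f : ℝ → E d → E m → E d} {H : ℝ → E d → E d → ℝ} {q : E d → ℝ} {v : ℝ → E d → ℝ}

theorem BoundedContinuous.neg {u : ℝ → E d → ℝ} (hu : BoundedContinuous T u) :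
    BoundedContinuous T (fun t x => -u t x) := by
  obtain ⟨⟨M, hM⟩, hc⟩ := hu
  exact ⟨⟨M, fun t ht x => by rw [abs_neg]; exact hM t ht x⟩, hc.neg⟩

theorem discreteGradient_neg (h : ℝ) (φ : E d → ℝ) (x : E d) :
    discreteGradient h (fun y => -φ y) x = -discreteGradient h φ x := by
  ext i
  simp only [discreteGradient, PiLp.neg_apply]
  ring

theorem discreteLaplacian_neg (h : ℝ) (φ : E d → ℝ) (x : E d) :
    discreteLaplacian h (fun y => -φ y) x = -discreteLaplacian h φ x := by
  simp only [discreteLaplacian, ← Finset.sum_neg_distrib]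
  refine Finset.sum_congr rfl fun i _ => ?_
  ring

theorem gradient_neg (φ : E d → ℝ) (x : E d) :
    gradient (fun y => -φ y) x = -gradient φ x := by
  simp only [gradient]
  rw [show (fun y => -φ y) = -φ from rfl, fderiv_neg, map_neg]

/-- The scheme converges to the viscosity solution with rate `√h`. -/
theorem RegularControl.exists_error_bound (hR : RegularControl T N K A c f H) (hT : 0 < T)
    (hL : 0 ≤ L) (hv : IsViscositySolution T H q v) :
    ∃ C : ℝ, 0 ≤ C ∧ ∀ h > 0, ∀ u, IsSemiDiscreteSolution T H q N h u →
      (∀ t ∈ Icc 0 T, ∀ x y, |u t x - u t y| ≤ L * ‖x - y‖) →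
      ∀ t ∈ Icc 0 T, ∀ x, |v t x - u t x| ≤ C * √h := by
  have hK : 0 ≤ K := zero_le_one.trans hR.one_le_K
  have hN := hR.N_pos
  refine ⟨L ^ 2 + T * (K * (1 + 2 * L) * L + 2 * d * N), by positivity,
    fun h hh u hu hlip t ht x => ?_⟩
  have hε : 0 < √h := Real.sqrt_pos.2 hh
  have hdiv : h / √h = √h := Real.div_sqrt
  have e : L ^ 2 * √h + T * (K * (1 + 2 * L) * (L * √h) + 2 * d * N * h / √h) =
      (L ^ 2 + T * (K * (1 + 2 * L) * L + 2 * d * N)) * √h := by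
    rw [mul_div_assoc, hdiv]; ring
  have h1 := subsolution_sub_scheme_le hT hN hK hL hh
    (fun t ht x p p' => hR.H_sub_le ht x p p')
    (fun t ht s hs x y p => hR.abs_H_sub_le ht hs x y p) hv.boundedContinuous
    hu.boundedContinuous (fun x => by rw [hv.terminal, hu.terminal]) hv.subsolution hu.equation
    hlip hε t ht x
  -- The reverse inequality is the same lemma after changing the sign of both solutions. It applies
  -- since only the Lipschitz bounds of `H`, not its concavity, were used there.
  have h2 := subsolution_sub_scheme_le (H := fun t x p => -H t x (-p))
    (v := fun t x => -v t x) (u := fun t x => -u t x) hT hN hK hL hh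
    (fun t ht x p p' => by
      have := hR.H_sub_le ht x (-p') (-p)
      rw [show -p' - -p = p - p' by abel] at this
      linarith)
    (fun t ht s hs x y p => by
      have := hR.abs_H_sub_le ht hs x y (-p)
      rwa [norm_neg, abs_sub_comm, ← neg_sub_neg] at this)
    hv.boundedContinuous.neg hu.boundedContinuous.neg
    (fun x => by rw [hv.terminal, hu.terminal])
    (fun φ hφ t ht x hmax => by
      have hmin : IsLocalMin (fun z : ℝ × E d => v z.1 z.2 - -φ z.1 z.2) (t, x) := by
        filter_upwards [hmax] with z hz
        linarith
      have := hv.supersolution (fun t x => -φ t x) hφ.neg t ht x hmin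
      rw [gradient_neg, deriv.fun_neg] at this
      linarith)
    (fun t ht x => by
      obtain ⟨u', hu', e⟩ := hu.equation t ht x
      refine ⟨-u', hu'.neg, ?_⟩
      rw [discreteGradient_neg, discreteLaplacian_neg, neg_neg]
      linarith)
    (fun t ht x y => by
      have := hlip t ht x y
      rwa [abs_sub_comm, ← neg_sub_neg] at this)
    hε t ht x
  rw [e] at h1 h2
  rw [abs_le]
  constructor <;> linarith

end ErrorBound

end PolicyIteration

/-! ### From local slopes to macroscopic slopes -/

namespace PolicyIteration

section Slopes

variable {d : ℕ}

/-- Backward slopes at scale `ρ` are controlled by backward slopes at scale `2 ^ k * ρ`. -/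
theorem slope_le_dyadic_slope {φ : E d → ℝ} {e : E d} {C μ r : ℝ} (hC : 0 ≤ C) (hμ : 0 ≤ μ)
    (k : ℕ) : ∀ ρ : ℝ, 0 < ρ → 2 ^ k * ρ ≤ 2 * r →
    (∀ s, ρ ≤ s → s ≤ r → ∀ x, φ (x + s • e) + φ (x - s • e) - 2 * φ x ≤ C * (s ^ 2 + √(μ * s))) →
    ∀ x, (φ x - φ (x - ρ • e)) / ρ ≤
      (φ x - φ (x - (2 ^ k * ρ) • e)) / (2 ^ k * ρ) + C * ((2 ^ k - 1) * ρ + 4 * √(μ / ρ)) := by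
  induction k with
  | zero =>
    intro ρ hρ _ _ x
    have : 0 ≤ C * (4 * √(μ / ρ)) := by positivity
    simp only [pow_zero, one_mul, sub_self, zero_mul, zero_add]
    linarith
  | succ k ih =>
    intro ρ hρ hr hW x
    have hpow : (1 : ℝ) ≤ 2 ^ k := one_le_pow₀ (by norm_num)
    have hρr : ρ ≤ r := by rw [pow_succ] at hr; nlinarith
    have h1 := ih (2 * ρ) (by positivity) (by rw [pow_succ] at hr; linarith)
      (fun s hs hsr x => hW s (by linarith) hsr x) x
    have h2 := hW ρ le_rfl hρr (x - ρ • e)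
    rw [sub_add_cancel, show x - ρ • e - ρ • e = x - (2 * ρ) • e by module] at h2
    have e1 : (2 : ℝ) ^ k * (2 * ρ) = 2 ^ (k + 1) * ρ := by ring
    rw [e1] at h1
    have e2 : (φ x - φ (x - ρ • e)) / ρ = (φ x - φ (x - (2 * ρ) • e)) / (2 * ρ) +
        (φ x + φ (x - (2 * ρ) • e) - 2 * φ (x - ρ • e)) / (2 * ρ) := by
      field_simp; ring
    have h3 : (φ x + φ (x - (2 * ρ) • e) - 2 * φ (x - ρ • e)) / (2 * ρ) ≤
        C * (ρ / 2 + √(μ / ρ) / 2) := by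
      rw [div_le_iff₀ (by positivity)]
      refine h2.trans (le_of_eq ?_)
      have : √(μ * ρ) = √(μ / ρ) * ρ := by
        rw [show μ * ρ = μ / ρ * ρ ^ 2 by field_simp, Real.sqrt_mul (by positivity),
          Real.sqrt_sq hρ.le]
      rw [this]; ring
    -- Doubling `ρ` shrinks the error geometrically, and `1/2 + 4 · (3/4) ≤ 4` closes the induction
    -- with constant `4`.
    have h4 : √(μ / (2 * ρ)) ≤ 3 / 4 * √(μ / ρ) := by
      refine Real.sqrt_le_iff.2 ⟨by positivity, ?_⟩
      rw [mul_pow, Real.sq_sqrt (by positivity), show μ / (2 * ρ) = 1 / 2 * (μ / ρ) by field_simp]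
      nlinarith [(by positivity : 0 ≤ μ / ρ)]
    have h5 : C * (ρ / 2 + √(μ / ρ) / 2) + C * ((2 ^ k - 1) * (2 * ρ) + 4 * √(μ / (2 * ρ))) ≤
        C * ((2 ^ (k + 1) - 1) * ρ + 4 * √(μ / ρ)) := by
      rw [← mul_add]
      refine mul_le_mul_of_nonneg_left ?_ hC
      rw [pow_succ]
      nlinarith [Real.sqrt_nonneg (μ / ρ)]
    rw [e2]
    linarith

theorem exists_dyadic_mem {ρ r : ℝ} (hρ : 0 < ρ) (hr : ρ ≤ r) :
    ∃ k : ℕ, r ≤ 2 ^ k * ρ ∧ 2 ^ k * ρ ≤ 2 * r := by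
  obtain ⟨k, hk1, hk2⟩ := exists_nat_pow_near (x := r / ρ) (y := 2)
    ((one_le_div hρ).2 hr) (by norm_num)
  rw [le_div_iff₀ hρ] at hk1
  rw [div_lt_iff₀ hρ] at hk2
  refine ⟨k + 1, hk2.le, ?_⟩
  rw [pow_succ]
  linarith

/-- Forward slopes of approximations `φ' i` of `φ`, at scales `ρ i → 0` and points `y i → x`,
are asymptotically bounded by the derivative of `φ` at `x`. -/
theorem eventually_slope_le {ι : Type*} {l : Filter ι} {φ : E d → ℝ} {φ' : ι → E d → ℝ}
    {x p e : E d} {y : ι → E d} {ρ μ δ : ι → ℝ} {C L σ : ℝ} (hC : 0 ≤ C)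
    (he : ‖e‖ = 1) (hφ : HasGradientAt φ p x) (hlip : ∀ x y, |φ x - φ y| ≤ L * ‖x - y‖)
    (hρ : ∀ᶠ i in l, 0 < ρ i) (hρ0 : Tendsto ρ l (𝓝 0)) (hμ : ∀ᶠ i in l, 0 ≤ μ i)
    (hσ : ∀ᶠ i in l, √(μ i / ρ i) ≤ σ) (hy : Tendsto y l (𝓝 x))
    (hδ : Tendsto δ l (𝓝 0)) (happ : ∀ᶠ i in l, ∀ z, |φ' i z - φ z| ≤ δ i)
    (hW : ∀ᶠ i in l, ∀ s, ρ i ≤ s → s ≤ 1 → ∀ z,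
      φ' i (z + s • e) + φ' i (z - s • e) - 2 * φ' i z ≤ C * (s ^ 2 + √(μ i * s)))
    {ε : ℝ} (hε : 0 < ε) :
    ∀ᶠ i in l, (φ' i (y i + ρ i • e) - φ' i (y i)) / ρ i ≤ inner ℝ p e + 4 * C * σ + ε := by
  rw [hasGradientAt_iff_hasFDerivAt, hasFDerivAt_iff_isLittleO_nhds_zero] at hφ
  obtain ⟨r₀, hr₀, hball⟩ := Metric.eventually_nhds_iff_ball.1 (hφ.def (by positivity : 0 < ε / 4))
  obtain ⟨r, hr, hr1, hr2, hr3⟩ : ∃ r > 0, r ≤ 1 ∧ 2 * r < r₀ ∧ C * (2 * r) ≤ ε / 4 := by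
    refine ⟨min 1 (min (r₀ / 4) (ε / (8 * (C + 1)))), by positivity, min_le_left _ _, ?_, ?_⟩
    · have := (min_le_right 1 (min (r₀ / 4) (ε / (8 * (C + 1))))).trans (min_le_left _ _)
      linarith
    · have := (min_le_right 1 (min (r₀ / 4) (ε / (8 * (C + 1))))).trans (min_le_right _ _)
      have h2 : (C + 1) * (ε / (8 * (C + 1))) = ε / 8 := by field_simp
      have h3 := mul_le_mul_of_nonneg_left this hC
      have h4 : 0 ≤ ε / (8 * (C + 1)) := by positivity
      linarith
  have herr : Tendsto (fun i => (2 * δ i + 2 * L * ‖y i + ρ i • e - x‖) / r) l (𝓝 0) := by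
    have h1 : Tendsto (fun i => ‖y i + ρ i • e - x‖) l (𝓝 0) := by
      simpa using ((hy.add (hρ0.smul_const e)).sub_const x).norm
    simpa using ((hδ.const_mul 2).add (h1.const_mul (2 * L))).div_const r
  filter_upwards [hρ, hρ0.eventually (eventually_le_nhds hr), hμ, hσ, happ, hW,
    herr.eventually (eventually_le_nhds (by positivity : (0 : ℝ) < ε / 4))] with i hρi hρr hμi hσi
    happi hWi herri
  -- The forward slope at `y i` is the backward slope at `z`. It is raised to a scale `r'` between
  -- `r` and `2r`, fixed while `ρ i → 0`, where `φ' i` may be replaced by `φ` and differentiability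
  -- at `x` applies. Only `4 C σ`, from the smallest scales, survives.
  obtain ⟨k, hk1, hk2⟩ := exists_dyadic_mem hρi hρr
  set r' := 2 ^ k * ρ i with hr'
  have hr'0 : 0 < r' := by positivity
  set z := y i + ρ i • e with hz
  have h1 := slope_le_dyadic_slope (φ := φ' i) (e := e) (r := r) hC hμi k (ρ i) hρi hk2
    (fun s hs hsr w => hWi s hs (hsr.trans hr1) w) z
  rw [hz, add_sub_cancel_right, ← hz, ← hr'] at h1
  have h2 : φ x - φ (x - r' • e) ≤ r' * inner ℝ p e + ε / 4 * r' := by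
    have hn : ‖-(r' • e)‖ = r' := by rw [norm_neg, norm_smul, he, Real.norm_of_nonneg hr'0.le, mul_one]
    have := hball (-(r' • e)) (by rw [mem_ball_zero_iff, hn]; linarith)
    rw [hn] at this
    simp only [InnerProductSpace.toDual_apply_apply, inner_neg_right, inner_smul_right,
      ← sub_eq_add_neg, Real.norm_eq_abs] at this
    have := (abs_le.1 this).1
    linarith
  have h3 : φ' i z - φ' i (z - r' • e) ≤ φ x - φ (x - r' • e) + (2 * δ i + 2 * L * ‖z - x‖) := by
    have a1 := abs_le.1 (happi z)
    have a2 := abs_le.1 (happi (z - r' • e))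
    have a3 := abs_le.1 (hlip z x)
    have a4 := abs_le.1 (hlip (z - r' • e) (x - r' • e))
    rw [sub_sub_sub_cancel_right] at a4
    linarith [a1.1, a1.2, a2.1, a2.2, a3.1, a3.2, a4.1, a4.2]
  have h4 : (φ' i z - φ' i (z - r' • e)) / r' ≤ inner ℝ p e + ε / 4 + ε / 4 := by
    have a5 : 2 * δ i + 2 * L * ‖z - x‖ ≤ ε / 4 * r' := by
      rw [div_le_iff₀ hr] at herri
      refine herri.trans (mul_le_mul_of_nonneg_left hk1 (by positivity))
    rw [div_le_iff₀ hr'0]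
    linarith
  have h5 : C * ((2 ^ k - 1) * ρ i + 4 * √(μ i / ρ i)) ≤ ε / 4 + 4 * C * σ := by
    have b1 : (2 ^ k - 1) * ρ i ≤ 2 * r := by linarith
    have b2 := mul_le_mul_of_nonneg_left b1 hC
    have b3 := mul_le_mul_of_nonneg_left hσi hC
    linarith
  linarith

end Slopes

/-! ### Rigidity of blow-up profiles -/

section BlowUpProfile

variable {d : ℕ}

/-- Equality of the `ℓ¹` and `ℓ²` norms means `∑ |x j| (ℓ - |x j|) = 0`, with nonnegative terms. -/
theorem eq_single_of_sum_abs_le_norm {x : E d} (hx : ∑ j, |x j| ≤ ‖x‖) {i : Fin d}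
    (hi : x i ≠ 0) : x = x i • EuclideanSpace.single i (1 : ℝ) := by
  set ℓ := ∑ j, |x j| with hℓ
  have hle : ∀ j, |x j| ≤ ℓ := fun j =>
    Finset.single_le_sum (f := fun j => |x j|) (fun _ _ => abs_nonneg _) (Finset.mem_univ j)
  have hℓ0 : 0 ≤ ℓ := Finset.sum_nonneg fun _ _ => abs_nonneg _
  have hsq : ‖x‖ ^ 2 = ∑ j, |x j| ^ 2 := by
    rw [EuclideanSpace.norm_sq_eq]; simp
  have hsum : ∑ j, |x j| * (ℓ - |x j|) ≤ 0 := by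
    have : ∑ j, |x j| * (ℓ - |x j|) = ℓ * ℓ - ‖x‖ ^ 2 := by
      rw [hsq]
      simp only [mul_sub, Finset.sum_sub_distrib, ← Finset.sum_mul]
      rw [← hℓ]
      congr 1
      exact Finset.sum_congr rfl fun j _ => by ring
    rw [this]
    nlinarith [norm_nonneg x]
  have hzero := (Finset.sum_eq_zero_iff_of_nonneg (s := Finset.univ)
    (f := fun j => |x j| * (ℓ - |x j|))
    (fun j _ => mul_nonneg (abs_nonneg _) (sub_nonneg.2 (hle j)))).1
    (le_antisymm hsum (Finset.sum_nonneg
      fun j _ => mul_nonneg (abs_nonneg _) (sub_nonneg.2 (hle j))))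
  ext j
  by_cases hj : j = i
  · subst hj; simp
  · have h1 : |x i| + |x j| ≤ ℓ := by
      rw [← Finset.sum_pair (f := fun k => |x k|) (Ne.symm hj)]
      exact Finset.sum_le_sum_of_subset_of_nonneg (Finset.subset_univ _)
        fun _ _ _ => abs_nonneg _
    have h2 : 0 < |x i| := abs_pos.2 hi
    have h3 : |x j| = 0 := by
      rcases mul_eq_zero.1 (hzero j (Finset.mem_univ j)) with h | h
      · exact h
      · linarith
    simp [hj, abs_eq_zero.1 h3]

/-- The chain `N ∑ (a + b) ≤ G P - G Q ≤ 2N ‖P - Q‖ ≤ 2N ∑ |(P - Q) j| ≤ N ∑ (a + b)` consists of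
equalities. The last makes one of `a i`, `b i` vanish; the third puts `P - Q` on a single axis. -/
theorem rigidity_of_increment_ge {N : ℝ} (hN : 0 < N) {G : E d → ℝ}
    (hG : ∀ p p', G p - G p' ≤ 2 * N * ‖p - p'‖) {P Q : E d} {a b : Fin d → ℝ}
    (ha : ∀ j, 0 ≤ a j) (hb : ∀ j, 0 ≤ b j) (hPQ : ∀ j, (P - Q) j = (b j - a j) / 2)
    (hinc : N * ∑ j, (a j + b j) ≤ G P - G Q) {i : Fin d} (hi : a i + b i ≠ 0) :
    (a i = 0 ∨ b i = 0) ∧ P = Q + ((b i - a i) / 2) • EuclideanSpace.single i (1 : ℝ) ∧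
      N * (a i + b i) ≤ G P - G Q := by
  have h1 : ∑ j, (a j + b j) ≤ 2 * ‖P - Q‖ := by
    have := hinc.trans (hG P Q)
    rw [show 2 * N * ‖P - Q‖ = N * (2 * ‖P - Q‖) by ring] at this
    exact le_of_mul_le_mul_left this hN
  have h2 : ‖P - Q‖ ≤ ∑ j, |(P - Q) j| := norm_le_sum_abs _
  have hterm : ∀ j, 2 * |(P - Q) j| ≤ a j + b j := fun j => by
    rw [hPQ j, abs_div, abs_two]
    have : |b j - a j| ≤ a j + b j := abs_le.2 ⟨by linarith [hb j], by linarith [ha j]⟩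
    linarith
  have h3 : 2 * ∑ j, |(P - Q) j| ≤ ∑ j, (a j + b j) := by
    rw [Finset.mul_sum]; exact Finset.sum_le_sum fun j _ => hterm j
  have h4 : a i = 0 ∨ b i = 0 := by
    have hz := (Finset.sum_eq_zero_iff_of_nonneg (s := Finset.univ)
      (f := fun j => a j + b j - 2 * |(P - Q) j|) (fun j _ => sub_nonneg.2 (hterm j))).1 (by
        rw [Finset.sum_sub_distrib, ← Finset.mul_sum]; linarith) i (Finset.mem_univ i)
    rw [hPQ i, abs_div, abs_two] at hz
    rcases abs_cases (b i - a i) with ⟨h, _⟩ | ⟨h, _⟩ <;> rw [h] at hz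
    · left; linarith
    · right; linarith
  have h5 : (P - Q) i ≠ 0 := by
    rw [hPQ i]
    intro h
    rcases h4 with h0 | h0 <;> rw [h0] at h hi <;> apply hi <;> linarith
  refine ⟨h4, ?_, ?_⟩
  · have := eq_single_of_sum_abs_le_norm (x := P - Q) (by linarith) h5
    rw [hPQ i] at this
    rw [← this]; abel
  · refine le_trans (mul_le_mul_of_nonneg_left ?_ hN.le) hinc
    exact Finset.single_le_sum (f := fun j => a j + b j)
      (fun j _ => add_nonneg (ha j) (hb j)) (Finset.mem_univ i)

/-- A concave function with supergradients of norm at most `2N` cannot have the extreme slopes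
`-2N` to the left of one point and `2N` to the left of another point of the same hyperplane. -/
theorem no_opposite_extreme_slopes {N : ℝ} (hN : 0 < N) {G : E d → ℝ}
    (hG : ∀ p, ∃ b : E d, ‖b‖ ≤ 2 * N ∧ ∀ p', G p' ≤ G p + inner ℝ (p' - p) b)
    {e P Q : E d} (he : ‖e‖ = 1) (hPQ : inner ℝ P e = inner ℝ Q e) {a b : ℝ} (ha : 0 < a)
    (hb : 0 < b) (hQ : G Q + 2 * N * a ≤ G (Q - a • e)) (hP : G (P - b • e) + 2 * N * b ≤ G P) :
    False := by
  have hlip : ∀ p p', G p - G p' ≤ 2 * N * ‖p - p'‖ := fun p p' => by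
    obtain ⟨b, hb, hle⟩ := hG p'
    have h1 := real_inner_le_norm (p - p') b
    have h2 := mul_le_mul_of_nonneg_left hb (norm_nonneg (p - p'))
    linarith [hle p]
  have hee : inner ℝ e e = 1 := by rw [real_inner_self_eq_norm_sq, he]; norm_num
  have hns : ∀ s : ℝ, 0 ≤ s → ‖s • e‖ = s := fun s hs => by
    rw [norm_smul, he, Real.norm_of_nonneg hs, mul_one]
  set s := min (b / 2) (a / 4) with hs
  have hs0 : 0 < s := by positivity
  have hsb : s ≤ b / 2 := min_le_left _ _
  have hsa : s ≤ a / 4 := min_le_right _ _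
  -- A midpoint has room on both sides, so the extreme slope forces `⟨e, β⟩ ≤ -2N`; with `‖β‖ ≤ 2N`
  -- this means `β = -2N e`, and likewise `γ = 2N e` at `Y`. As `s ≤ a/4`, `X` lies below `Y` in
  -- direction `e`, which contradicts monotonicity of supergradients.
  set X := Q - (a / 2) • e with hX
  set Y := P - s • e with hY
  obtain ⟨β, hβ, hβle⟩ := hG X
  obtain ⟨γ, hγ, hγle⟩ := hG Y
  have hβe : inner ℝ e β ≤ -(2 * N) := by
    have h1 := hβle (Q - a • e)
    rw [show Q - a • e - X = -((a / 2) • e) by rw [hX]; module, inner_neg_left,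
      real_inner_smul_left] at h1
    have h2 := hlip X Q
    rw [show X - Q = -((a / 2) • e) by rw [hX]; module, norm_neg, hns _ (by positivity)] at h2
    nlinarith
  have hγe : 2 * N ≤ inner ℝ e γ := by
    have h1 := hγle P
    rw [show P - Y = s • e by rw [hY]; module, real_inner_smul_left] at h1
    have h2 := hlip Y (P - b • e)
    rw [show Y - (P - b • e) = (b - s) • e by rw [hY]; module, hns _ (by linarith)] at h2
    nlinarith
  have hβeq : β = -((2 * N) • e) := by
    have : ‖β + (2 * N) • e‖ ^ 2 ≤ 0 := by
      rw [norm_add_sq_real, hns _ (by positivity), inner_smul_right, real_inner_comm]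
      nlinarith [norm_nonneg β]
    have h0 : β + (2 * N) • e = 0 := by
      rw [← norm_eq_zero]; exact pow_eq_zero_iff (two_ne_zero) |>.1 (le_antisymm this (sq_nonneg _))
    exact eq_neg_of_add_eq_zero_left h0
  have hγeq : γ = (2 * N) • e := by
    have : ‖γ - (2 * N) • e‖ ^ 2 ≤ 0 := by
      rw [norm_sub_sq_real, hns _ (by positivity), inner_smul_right, real_inner_comm]
      nlinarith [norm_nonneg γ]
    have h0 : γ - (2 * N) • e = 0 := by
      rw [← norm_eq_zero]; exact pow_eq_zero_iff (two_ne_zero) |>.1 (le_antisymm this (sq_nonneg _))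
    exact sub_eq_zero.1 h0
  have h1 := hβle Y
  have h2 := hγle X
  have hYX : inner ℝ (Y - X) e = a / 2 - s := by
    rw [hX, hY]
    simp only [inner_sub_left, real_inner_smul_left, hee, hPQ]
    ring
  have hXY : inner ℝ (X - Y) e = s - a / 2 := by
    rw [← neg_sub, inner_neg_left, hYX]; ring
  rw [hβeq, inner_neg_right, inner_smul_right, hYX] at h1
  rw [hγeq, inner_smul_right, hXY] at h2
  nlinarith

/-- Rigidity of blow-up profiles: if the maximal slope `S` in the direction `e` is attained,
then it is attained on arbitrarily long segments. -/
theorem exists_long_maximal_slope {N S : ℝ} (hN : 0 < N) {G : E d → ℝ}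
    (hG : ∀ p, ∃ b : E d, ‖b‖ ≤ 2 * N ∧ ∀ p', G p' ≤ G p + inner ℝ (p' - p) b)
    {i : Fin d} {e : E d} (he : e = EuclideanSpace.single i (1 : ℝ) ∨
      e = -EuclideanSpace.single i (1 : ℝ))
    {V : E d → ℝ} (hS : ∀ w, V (w + e) - V w ≤ S) {w₀ : E d} (hw₀ : V (w₀ + e) - V w₀ = S)
    (heq : ∀ w, V (w + e) - V w = S →
      G (discreteGradient 1 V w) + N * discreteLaplacian 1 V w ≤
        G (discreteGradient 1 V (w + e)) + N * discreteLaplacian 1 V (w + e)) (n : ℕ) :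
    ∃ w, V (w + ((n : ℝ) + 1) • e) - V w = (n + 1) * S := by
  have hlip : ∀ p p', G p - G p' ≤ 2 * N * ‖p - p'‖ := fun p p' => by
    obtain ⟨b, hb, hle⟩ := hG p'
    have h1 := real_inner_le_norm (p - p') b
    have h2 := mul_le_mul_of_nonneg_left hb (norm_nonneg (p - p'))
    linarith [hle p]
  have hen : ‖e‖ = 1 := by rcases he with h | h <;> simp [h]
  have he0 : e ≠ 0 := by intro h; rw [h, norm_zero] at hen; exact zero_ne_one hen
  -- `D` is the defect from maximal slope. Differences of gradients and Laplacians between `w` and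
  -- `w + e` are expressed by `D` at the neighbours of `w`, which is the setting of
  -- `rigidity_of_increment_ge`.
  set D : E d → ℝ := fun w => S - (V (w + e) - V w) with hD
  have hD0 : ∀ w, 0 ≤ D w := fun w => sub_nonneg.2 (hS w)
  set ε : Fin d → E d := fun j => EuclideanSpace.single j (1 : ℝ) with hε
  have hgradj : ∀ w j, discreteGradient 1 V w j = (V (w + ε j) - V (w - ε j)) / 2 := by
    intro w j; simp [discreteGradient, hε]
  have hgrade : ∀ w, inner ℝ (discreteGradient 1 V w) e = S - (D w + D (w - e)) / 2 := by
    intro w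
    have h1 : inner ℝ (discreteGradient 1 V w) (ε i) = (V (w + ε i) - V (w - ε i)) / 2 := by
      rw [← hgradj, hε, EuclideanSpace.inner_single_right]; simp
    have h2 : S - (D w + D (w - e)) / 2 = (V (w + e) - V (w - e)) / 2 := by
      simp only [hD, sub_add_cancel]; ring
    rw [h2]
    rcases he with h | h <;> rw [h]
    · exact h1
    · rw [inner_neg_right]
      change -inner ℝ (discreteGradient 1 V w) (ε i) = (V (w + -ε i) - V (w - -ε i)) / 2
      rw [h1, sub_neg_eq_add, ← sub_eq_add_neg]; ring
  have hrig : ∀ w, D w = 0 → D (w + e) + D (w - e) ≠ 0 →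
      (D (w + e) = 0 ∨ D (w - e) = 0) ∧
      discreteGradient 1 V (w + e) =
        discreteGradient 1 V w + ((D (w - e) - D (w + e)) / 2) • e ∧
      N * (D (w + e) + D (w - e)) ≤
        G (discreteGradient 1 V (w + e)) - G (discreteGradient 1 V w) := by
    intro w hw hne
    have hcontact : V (w + e) - V w = S := by simp only [hD] at hw; linarith
    have hPQ : ∀ j, (discreteGradient 1 V (w + e) - discreteGradient 1 V w) j =
        (D (w - ε j) - D (w + ε j)) / 2 := by
      intro j
      rw [PiLp.sub_apply, hgradj, hgradj]
      simp only [hD]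
      rw [show w + e + ε j = w + ε j + e by abel, show w + e - ε j = w - ε j + e by abel]
      ring
    have hlap : discreteLaplacian 1 V (w + e) - discreteLaplacian 1 V w =
        -∑ j, (D (w + ε j) + D (w - ε j)) := by
      simp only [discreteLaplacian, one_smul, one_pow, div_one]
      rw [← Finset.sum_sub_distrib, ← Finset.sum_neg_distrib]
      refine Finset.sum_congr rfl fun j _ => ?_
      simp only [hD]
      change V (w + e + ε j) - 2 * V (w + e) + V (w + e - ε j) -
        (V (w + ε j) - 2 * V w + V (w - ε j)) = _
      rw [show w + e + ε j = w + ε j + e by abel, show w + e - ε j = w - ε j + e by abel]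
      linarith
    have hinc : N * ∑ j, (D (w + ε j) + D (w - ε j)) ≤
        G (discreteGradient 1 V (w + e)) - G (discreteGradient 1 V w) := by
      have h1 := heq w hcontact
      have h2 : N * (discreteLaplacian 1 V (w + e) - discreteLaplacian 1 V w) =
        -(N * ∑ j, (D (w + ε j) + D (w - ε j))) := by rw [hlap]; ring
      linarith
    have hrigid := rigidity_of_increment_ge hN hlip (fun j => hD0 (w + ε j))
      (fun j => hD0 (w - ε j)) hPQ hinc (i := i)
    rcases he with h | h
    · have h' : e = ε i := h
      rw [h'] at hne ⊢
      rw [h'] at hrigid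
      exact hrigid hne
    · have h' : e = -ε i := h
      rw [h', ← sub_eq_add_neg, sub_neg_eq_add] at hne ⊢
      rw [h', ← sub_eq_add_neg] at hrigid
      obtain ⟨r1, r2, r3⟩ := hrigid (by rwa [add_comm])
      refine ⟨r1.symm, ?_, by rwa [add_comm (D (w - ε i))]⟩
      rw [r2]
      module
  have hseg : ∀ n : ℕ, ∃ w, ∀ k : ℕ, k ≤ n → D (w + (k : ℝ) • e) = 0 := by
    intro n
    induction n with
    | zero =>
      refine ⟨w₀, fun k hk => ?_⟩
      obtain rfl : k = 0 := Nat.le_zero.1 hk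
      simp [hD, hw₀]
    | succ n ih =>
      obtain ⟨w, hw⟩ := ih
      have hwr := hw n le_rfl
      have hwl : D w = 0 := by simpa using hw 0 (Nat.zero_le _)
      set wr := w + (n : ℝ) • e with hwrdef
      have hnext : wr + e = w + ((n + 1 : ℕ) : ℝ) • e := by rw [hwrdef]; push_cast; module
      by_cases hr : D (wr + e) = 0
      · refine ⟨w, fun k hk => ?_⟩
        rcases Nat.le_succ_iff.1 hk with h | h
        · exact hw k h
        · rw [h, ← hnext, hr]
      by_cases hl : D (w - e) = 0
      · refine ⟨w - e, fun k hk => ?_⟩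
        rcases Nat.eq_zero_or_pos k with h | h
        · simpa [h] using hl
        · obtain ⟨k', rfl⟩ : ∃ k', k = k' + 1 := ⟨k - 1, by omega⟩
          have : w - e + ((k' + 1 : ℕ) : ℝ) • e = w + (k' : ℝ) • e := by push_cast; module
          rw [this]
          exact hw k' (by omega)
      -- If the contact segment extends at neither end, `H` has an extreme slope at each end, with
      -- opposite signs, at gradients with the same `e`-component `S`. A one-point segment is
      -- separate: there rigidity already gives contact on one side.
      exfalso
      have hr0 := lt_of_le_of_ne (hD0 _) (Ne.symm hr)
      have hl0 := lt_of_le_of_ne (hD0 _) (Ne.symm hl)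
      obtain ⟨ra, rb, rc⟩ := hrig wr hwr (by linarith [hD0 (wr - e)])
      obtain ⟨la, lb, lc⟩ := hrig w hwl (by linarith [hD0 (w + e)])
      have ra' := ra.resolve_left hr
      have la' := la.resolve_right hl
      rw [ra'] at rb rc
      rw [la'] at lb lc
      rcases Nat.eq_zero_or_pos n with h | h
      · have hww : wr = w := by rw [hwrdef, h]; simp
        rw [hww] at rb rc ra' hr0
        linarith
      · have hpred : wr - e = w + ((n - 1 : ℕ) : ℝ) • e := by
          rw [hwrdef, Nat.cast_sub h]; push_cast; module
        have hsucc : D (w + e) = 0 := by simpa using hw 1 h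
        refine no_opposite_extreme_slopes hN hG hen (P := discreteGradient 1 V (w + e))
          (Q := discreteGradient 1 V wr) (a := D (wr + e) / 2) (b := D (w - e) / 2) ?_
          (by positivity) (by positivity) ?_ ?_
        · rw [hgrade, hgrade, add_sub_cancel_right, hsucc, hwl, hwr, ra']
        · rw [show discreteGradient 1 V wr - (D (wr + e) / 2) • e =
            discreteGradient 1 V (wr + e) by rw [rb]; module]
          linarith
        · rw [show discreteGradient 1 V (w + e) - (D (w - e) / 2) • e =
            discreteGradient 1 V w by rw [lb]; module]
          linarith
  obtain ⟨w, hw⟩ := hseg n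
  have htel : ∀ k : ℕ, k ≤ n + 1 → V (w + (k : ℝ) • e) = V w + k * S := by
    intro k
    induction k with
    | zero => intro _; simp
    | succ k ih =>
      intro hk
      have h1 := ih (by omega)
      have h2 := hw k (by omega)
      simp only [hD] at h2
      have h3 : w + ((k + 1 : ℕ) : ℝ) • e = w + (k : ℝ) • e + e := by push_cast; module
      rw [h3]
      push_cast
      linarith
  refine ⟨w, ?_⟩
  have := htel (n + 1) le_rfl
  push_cast at this
  rw [this]; ring

end BlowUpProfile

end PolicyIteration

/-! ### Rescaling, and the evolution of one-step slopes -/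

namespace PolicyIteration

section Rescaling

variable {d : ℕ}

theorem discreteGradient_rescale {h : ℝ} (hh : h ≠ 0) (φ : E d → ℝ) (y w : E d) :
    discreteGradient 1 (fun w => (φ (y + h • w) - φ y) / h) w =
      discreteGradient h φ (y + h • w) := by
  ext i
  simp only [discreteGradient, one_smul, smul_add, smul_sub]
  rw [← add_assoc, ← add_sub_assoc]
  field_simp
  ring

theorem discreteLaplacian_rescale {h : ℝ} (hh : h ≠ 0) (φ : E d → ℝ) (y w : E d) :
    discreteLaplacian 1 (fun w => (φ (y + h • w) - φ y) / h) w =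
      h * discreteLaplacian h φ (y + h • w) := by
  simp only [discreteLaplacian, one_smul, smul_add, smul_sub, Finset.mul_sum]
  refine Finset.sum_congr rfl fun i _ => ?_
  rw [← add_assoc, ← add_sub_assoc]
  field_simp
  ring

theorem norm_discreteGradient_le {h L : ℝ} (hh : 0 < h) {φ : E d → ℝ}
    (hlip : ∀ x y, |φ x - φ y| ≤ L * ‖x - y‖) (x : E d) : ‖discreteGradient h φ x‖ ≤ d * L := by
  refine (norm_le_sum_abs _).trans ?_
  refine (Finset.sum_le_card_nsmul _ _ L fun i _ => ?_).trans (le_of_eq (by simp))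
  simp only [discreteGradient]
  have := hlip (x + h • EuclideanSpace.single i (1 : ℝ)) (x - h • EuclideanSpace.single i (1 : ℝ))
  rw [show x + h • EuclideanSpace.single i (1 : ℝ) - (x - h • EuclideanSpace.single i (1 : ℝ)) =
    (2 * h) • (EuclideanSpace.single i (1 : ℝ) : E d) by module,
    norm_smul_single (by positivity)] at this
  rw [abs_div, abs_of_pos (by positivity : 0 < 2 * h), div_le_iff₀ (by positivity)]
  exact this

theorem norm_discreteGradient_sub_le {h δ : ℝ} (hh : 0 < h) {φ ψ : E d → ℝ}
    (hδ : ∀ x, |φ x - ψ x| ≤ δ) (x : E d) :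
    ‖discreteGradient h φ x - discreteGradient h ψ x‖ ≤ d * (δ / h) := by
  refine (norm_le_sum_abs _).trans ?_
  refine (Finset.sum_le_card_nsmul _ _ (δ / h) fun i _ => ?_).trans (le_of_eq (by simp))
  simp only [discreteGradient, PiLp.sub_apply]
  rw [← sub_div, abs_div, abs_of_pos (by positivity : 0 < 2 * h), div_le_div_iff₀ (by positivity) hh]
  have h1 := abs_le.1 (hδ (x + h • EuclideanSpace.single i (1 : ℝ)))
  have h2 := abs_le.1 (hδ (x - h • EuclideanSpace.single i (1 : ℝ)))
  have h3 : |φ (x + h • EuclideanSpace.single i (1 : ℝ)) -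
      φ (x - h • EuclideanSpace.single i (1 : ℝ)) -
      (ψ (x + h • EuclideanSpace.single i (1 : ℝ)) -
        ψ (x - h • EuclideanSpace.single i (1 : ℝ)))| ≤ 2 * δ :=
    abs_le.2 ⟨by linarith, by linarith⟩
  nlinarith

theorem abs_discreteLaplacian_sub_le {h δ : ℝ} (hh : 0 < h) {φ ψ : E d → ℝ}
    (hδ : ∀ x, |φ x - ψ x| ≤ δ) (x : E d) :
    |h * discreteLaplacian h φ x - h * discreteLaplacian h ψ x| ≤ d * (4 * (δ / h)) := by
  simp only [discreteLaplacian]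
  rw [← mul_sub, ← Finset.sum_sub_distrib, Finset.mul_sum]
  refine (Finset.abs_sum_le_sum_abs _ _).trans ?_
  refine (Finset.sum_le_card_nsmul _ _ (4 * (δ / h)) fun i _ => ?_).trans (le_of_eq (by simp))
  have h1 := abs_le.1 (hδ (x + h • EuclideanSpace.single i (1 : ℝ)))
  have h2 := abs_le.1 (hδ (x - h • EuclideanSpace.single i (1 : ℝ)))
  have h3 := abs_le.1 (hδ x)
  rw [← sub_div, abs_mul, abs_div, abs_of_pos hh, abs_of_pos (by positivity : 0 < h ^ 2)]
  rw [show ∀ z : ℝ, h * (z / h ^ 2) = z / h from fun z => by field_simp, ← mul_div_assoc]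
  refine div_le_div_of_nonneg_right ?_ hh.le
  exact abs_le.2 ⟨by linarith, by linarith⟩

end Rescaling

section BlowUp

variable {d m : ℕ} {T N K L L' : ℝ} {A : Set (E m)} {c : ℝ → E d → E m → ℝ}
  {f : ℝ → E d → E m → E d} {H : ℝ → E d → E d → ℝ} {q : E d → ℝ}

/-- The change in time of a one-step slope is driven by the spatial increment of the scheme. -/
theorem RegularControl.slope_time_increment (hR : RegularControl T N K A c f H) {h : ℝ}
    (hh : 0 < h) {u : ℝ → E d → ℝ} (hu : IsSemiDiscreteSolution T H q N h u) (hL : 0 ≤ L)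
    (hL' : 0 ≤ L')
    (hlip : ∀ t ∈ Icc 0 T, ∀ x y, |u t x - u t y| ≤ L * ‖x - y‖)
    (htime : ∀ t ∈ Icc 0 T, ∀ s ∈ Icc 0 T, ∀ x, |u t x - u s x| ≤ L' * |t - s|)
    {t s θ : ℝ} (ht : t ∈ Icc 0 T) (hs : s ∈ Icc 0 T) (hθ : 0 < θ) (hsθ : s + h * θ ≤ T)
    {e : E d} (he : ‖e‖ = 1) (x y : E d) :
    -(θ * (H t x (discreteGradient h (u s) (y + h • e)) +
        N * (h * discreteLaplacian h (u s) (y + h • e)) -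
        (H t x (discreteGradient h (u s) y) + N * (h * discreteLaplacian h (u s) y)))) ≤
      (u (s + h * θ) (y + h • e) - u (s + h * θ) y) / h - (u s (y + h • e) - u s y) / h +
      θ * (12 * N * d * L' * θ + 2 * K * (1 + d * L) * (|s - t| + h * θ + ‖y - x‖ + h)) := by
  have hK : 0 ≤ K := zero_le_one.trans hR.one_le_K
  have hN := hR.N_pos
  have hhθ : 0 < h * θ := by positivity
  set P : ℝ → E d → ℝ := fun r z => H r z (discreteGradient h (u r) z) +
    N * (h * discreteLaplacian h (u r) z) with hP
  set P₀ : E d → ℝ := fun z => H t x (discreteGradient h (u s) z) +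
    N * (h * discreteLaplacian h (u s) z) with hP₀
  have hder : ∀ r ∈ Ioo s (s + h * θ), HasDerivAt (fun r => u r (y + h • e) - u r y)
      (-(P r (y + h • e) - P r y)) r := by
    intro r hr
    have hr' : r ∈ Ioo 0 T := ⟨hs.1.trans_lt hr.1, hr.2.trans_le hsθ⟩
    obtain ⟨u₁, hu₁, e₁⟩ := hu.equation r hr' (y + h • e)
    obtain ⟨u₂, hu₂, e₂⟩ := hu.equation r hr' y
    refine (hu₁.sub hu₂).congr_deriv ?_
    simp only [hP]
    linarith
  -- The time step is `h θ`, matching the rescaling of space by `h`. Going back from the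
  -- intermediate time `r` to `s` changes `u` by at most `L' h θ`, hence discrete gradients by
  -- `O(θ)`.
  obtain ⟨r, hr, hslope⟩ := exists_hasDerivAt_eq_slope _ _ (by linarith : s < s + h * θ)
    (((hu.continuousOn_time _).sub (hu.continuousOn_time _)).mono (Icc_subset_Icc hs.1 hsθ)) hder
  have hrc : r ∈ Icc 0 T := ⟨hs.1.trans hr.1.le, hr.2.le.trans hsθ⟩
  have hclose : ∀ z, |P r z - P₀ z| ≤
      6 * N * d * L' * θ + K * (1 + d * L) * (|s - t| + h * θ + ‖z - x‖) := by
    intro z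
    have hrs : |r - s| ≤ h * θ := abs_le.2 ⟨by linarith [hr.1], by linarith [hr.2]⟩
    have hδ : ∀ w, |u r w - u s w| ≤ L' * (h * θ) := fun w =>
      (htime r hrc s hs w).trans (mul_le_mul_of_nonneg_left hrs hL')
    have hδh : L' * (h * θ) / h = L' * θ := by field_simp
    have g1 := norm_discreteGradient_sub_le hh hδ z
    have g2 := abs_discreteLaplacian_sub_le hh hδ z
    have g3 := norm_discreteGradient_le hh (hlip s hs) z
    rw [hδh] at g1 g2
    have a1 := hR.H_sub_le hrc z (discreteGradient h (u r) z) (discreteGradient h (u s) z)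
    have a2 := hR.H_sub_le hrc z (discreteGradient h (u s) z) (discreteGradient h (u r) z)
    rw [norm_sub_rev] at a2
    have a3 := hR.abs_H_sub_le hrc ht z x (discreteGradient h (u s) z)
    have a4 : K * (1 + ‖discreteGradient h (u s) z‖) * (|r - t| + ‖z - x‖) ≤
        K * (1 + d * L) * (|s - t| + h * θ + ‖z - x‖) := by
      have : |r - t| ≤ |s - t| + h * θ := by
        have := abs_sub_le r s t
        linarith
      gcongr
    have a5 := abs_le.1 (a3.trans a4)
    have a6 := mul_le_mul_of_nonneg_left g1 (by positivity : 0 ≤ 2 * N)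
    have a7 := abs_le.1 g2
    have a8 := mul_le_mul_of_nonneg_left a7.1 hN.le
    have a9 := mul_le_mul_of_nonneg_left a7.2 hN.le
    simp only [hP, hP₀]
    rw [abs_le]
    constructor
    · linarith [a5.1]
    · linarith [a5.2]
  have c1 := abs_le.1 (hclose (y + h • e))
  have c2 := abs_le.1 (hclose y)
  have hyn : ‖y + h • e - x‖ ≤ ‖y - x‖ + h := by
    rw [show y + h • e - x = (y - x) + h • e by abel]
    refine (norm_add_le _ _).trans ?_
    rw [norm_smul, he, Real.norm_of_nonneg hh.le, mul_one]
  have hc3 : K * (1 + d * L) * (|s - t| + h * θ + ‖y + h • e - x‖) ≤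
      K * (1 + d * L) * (|s - t| + h * θ + ‖y - x‖ + h) := by
    refine mul_le_mul_of_nonneg_left (by linarith) (by positivity)
  have hc4 : K * (1 + d * L) * (|s - t| + h * θ + ‖y - x‖) ≤
      K * (1 + d * L) * (|s - t| + h * θ + ‖y - x‖ + h) := by
    refine mul_le_mul_of_nonneg_left (by linarith) (by positivity)
  have hinc : (u (s + h * θ) (y + h • e) - u (s + h * θ) y) / h - (u s (y + h • e) - u s y) / h =
      -(θ * (P r (y + h • e) - P r y)) := by
    rw [add_sub_cancel_left, eq_div_iff hhθ.ne'] at hslope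
    simp only [Pi.sub_apply] at hslope
    field_simp
    linarith
  rw [hinc]
  have hmain : P r (y + h • e) - P r y - (P₀ (y + h • e) - P₀ y) ≤
      12 * N * d * L' * θ + 2 * K * (1 + d * L) * (|s - t| + h * θ + ‖y - x‖ + h) := by
    linarith [c1.2, c2.1]
  have := mul_le_mul_of_nonneg_left hmain hθ.le
  simp only [hP₀] at this
  linarith

theorem RegularControl.continuous_H (hR : RegularControl T N K A c f H) {t : ℝ}
    (ht : t ∈ Icc 0 T) (x : E d) : Continuous (H t x) := by
  have : LipschitzWith (Real.toNNReal (2 * N)) (H t x) := by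
    refine LipschitzWith.of_dist_le_mul fun p p' => ?_
    rw [Real.coe_toNNReal _ (by linarith [hR.N_pos]), Real.dist_eq, dist_eq_norm, abs_le]
    have h1 := hR.H_sub_le ht x p p'
    have h2 := hR.H_sub_le ht x p' p
    rw [norm_sub_rev] at h2
    constructor <;> linarith
  exact this.continuous

theorem tendsto_discreteGradient {ι : Type*} {l : Filter ι} {φ : ι → E d → ℝ} {V : E d → ℝ}
    (hφ : ∀ w, Tendsto (fun i => φ i w) l (𝓝 (V w))) (h : ℝ) (w : E d) :
    Tendsto (fun i => discreteGradient h (φ i) w) l (𝓝 (discreteGradient h V w)) :=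
  ((PiLp.continuous_toLp 2 _).tendsto _).comp
    (tendsto_pi_nhds.2 fun _ => ((hφ _).sub (hφ _)).div_const _)

theorem tendsto_discreteLaplacian {ι : Type*} {l : Filter ι} {φ : ι → E d → ℝ} {V : E d → ℝ}
    (hφ : ∀ w, Tendsto (fun i => φ i w) l (𝓝 (V w))) (h : ℝ) (w : E d) :
    Tendsto (fun i => discreteLaplacian h (φ i) w) l (𝓝 (discreteLaplacian h V w)) :=
  tendsto_finsetSum _ fun _ _ =>
    (((hφ _).sub ((hφ w).const_mul 2)).add (hφ _)).div_const _

/-- The filter of `(h, s, y)` with `h → 0⁺`, `s → t` in `[0,T]` and `y → x`. -/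
def approachFilter (T t : ℝ) (x : E d) : Filter (ℝ × ℝ × E d) :=
  𝓝[>] 0 ×ˢ 𝓝[Icc 0 T] t ×ˢ 𝓝 x

section

variable {t : ℝ} {x : E d}

theorem approachFilter_neBot (ht : t ∈ Icc 0 T) : (approachFilter T t x).NeBot := by
  have : (𝓝[Icc 0 T] t).NeBot := mem_closure_iff_nhdsWithin_neBot.1 (subset_closure ht)
  unfold approachFilter
  infer_instance

theorem approachFilter_tendsto_h :
    Tendsto (fun z : ℝ × ℝ × E d => z.1) (approachFilter T t x) (𝓝[>] 0) := tendsto_fst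

theorem approachFilter_tendsto_s :
    Tendsto (fun z : ℝ × ℝ × E d => z.2.1) (approachFilter T t x) (𝓝[Icc 0 T] t) :=
  tendsto_fst.comp tendsto_snd

theorem approachFilter_tendsto_y :
    Tendsto (fun z : ℝ × ℝ × E d => z.2.2) (approachFilter T t x) (𝓝 x) :=
  tendsto_snd.comp tendsto_snd

theorem approachFilter_eventually_h :
    ∀ᶠ z : ℝ × ℝ × E d in approachFilter T t x, z.1 ∈ Ioo (0 : ℝ) 1 :=
  approachFilter_tendsto_h.eventually (Ioo_mem_nhdsGT one_pos)

theorem approachFilter_eventually_s :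
    ∀ᶠ z : ℝ × ℝ × E d in approachFilter T t x, z.2.1 ∈ Icc 0 T :=
  approachFilter_tendsto_s.eventually self_mem_nhdsWithin

theorem approachFilter_tendsto_translate (w : E d) :
    Tendsto (fun z : ℝ × ℝ × E d => z.2.2 + z.1 • w) (approachFilter T t x) (𝓝 x) := by
  have h1 : Tendsto (fun z : ℝ × ℝ × E d => z.1) (approachFilter T t x) (𝓝 0) :=
    approachFilter_tendsto_h.mono_right nhdsWithin_le_nhds
  simpa using approachFilter_tendsto_y.add (h1.smul_const w)

end

end BlowUp

end PolicyIteration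

/-! ### Blow-up and convergence of the discrete gradients -/

namespace PolicyIteration

/-- Solutions `vh h` of the scheme with estimates uniform in `h`, approximating `v`. -/
structure UniformApproximation {d : ℕ} (T N C : ℝ) (H : ℝ → E d → E d → ℝ) (q : E d → ℝ)
    (v : ℝ → E d → ℝ) (vh : ℝ → ℝ → E d → ℝ) : Prop where
  nonneg : 0 ≤ C
  sol : ∀ h ∈ Ioo (0 : ℝ) 1, IsSemiDiscreteSolution T H q N h (vh h)
  lip : ∀ h ∈ Ioo (0 : ℝ) 1, ∀ t ∈ Icc 0 T, ∀ x y, |vh h t x - vh h t y| ≤ C * ‖x - y‖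
  time : ∀ h ∈ Ioo (0 : ℝ) 1, ∀ t ∈ Icc 0 T, ∀ s ∈ Icc 0 T, ∀ x,
    |vh h t x - vh h s x| ≤ C * |t - s|
  second : ∀ h ∈ Ioo (0 : ℝ) 1, ∀ μ, h ≤ μ → μ ≤ 1 → ∀ t ∈ Icc 0 T, ∀ x y,
    vh h t (x + y) + vh h t (x - y) - 2 * vh h t x ≤ C * (‖y‖ ^ 2 + μ + h / μ * ‖y‖)
  err : ∀ h ∈ Ioo (0 : ℝ) 1, ∀ t ∈ Icc 0 T, ∀ x, |v t x - vh h t x| ≤ C * √h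
  terminal : ∀ x, v T x = q x

section

variable {d m : ℕ} {T N K C : ℝ} {A : Set (E m)} {c : ℝ → E d → E m → ℝ}
  {f : ℝ → E d → E m → E d} {H : ℝ → E d → E d → ℝ} {q : E d → ℝ} {v : ℝ → E d → ℝ}
  {vh : ℝ → ℝ → E d → ℝ}

theorem tendsto_const_mul_sqrt (C : ℝ) : Tendsto (fun h : ℝ => C * √h) (𝓝[>] 0) (𝓝 0) :=
  (Continuous.tendsto' (by fun_prop) 0 _ (by simp)).mono_left nhdsWithin_le_nhds

theorem UniformApproximation.tendsto (hU : UniformApproximation T N C H q v vh) {t : ℝ}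
    (ht : t ∈ Icc 0 T) (x : E d) : Tendsto (fun h => vh h t x) (𝓝[>] 0) (𝓝 (v t x)) := by
  refine tendsto_iff_norm_sub_tendsto_zero.2
    (squeeze_zero' (Eventually.of_forall fun _ => norm_nonneg _) ?_ (tendsto_const_mul_sqrt C))
  filter_upwards [Ioo_mem_nhdsGT one_pos] with h hh
  rw [norm_sub_rev]
  exact hU.err h hh t ht x

theorem UniformApproximation.lip_limit (hU : UniformApproximation T N C H q v vh) {t : ℝ}
    (ht : t ∈ Icc 0 T) (x y : E d) : |v t x - v t y| ≤ C * ‖x - y‖ := by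
  refine le_of_tendsto ((hU.tendsto ht x).sub (hU.tendsto ht y)).abs ?_
  filter_upwards [Ioo_mem_nhdsGT one_pos] with h hh
  exact hU.lip h hh t ht x y

/-- With `μ = √h` both error terms of the weak semi-concavity vanish as `h → 0`. -/
theorem UniformApproximation.semiconcave_limit (hU : UniformApproximation T N C H q v vh) {t : ℝ}
    (ht : t ∈ Icc 0 T) : SemiconcaveWith C (v t) := by
  intro x y
  have hlim : Tendsto (fun h : ℝ => C * (‖y‖ ^ 2 + √h + √h * ‖y‖)) (𝓝[>] 0)
      (𝓝 (C * ‖y‖ ^ 2)) :=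
    (Continuous.tendsto' (by fun_prop) 0 _ (by simp)).mono_left nhdsWithin_le_nhds
  refine le_of_tendsto_of_tendsto (((hU.tendsto ht (x + y)).add (hU.tendsto ht (x - y))).sub
    ((hU.tendsto ht x).const_mul 2)) hlim ?_
  filter_upwards [Ioo_mem_nhdsGT one_pos] with h hh
  have h1 : h ≤ √h := Real.le_sqrt_of_sq_le (by nlinarith [hh.1, hh.2])
  have h2 : √h ≤ 1 := Real.sqrt_le_one.2 hh.2.le
  have := hU.second h hh (√h) h1 h2 t ht x y
  rwa [Real.div_sqrt] at this

/-- The choice `μ = √(h s)` balances `μ` against `(h/μ) s`. -/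
theorem UniformApproximation.second_dyadic (hU : UniformApproximation T N C H q v vh) {h : ℝ}
    (hh : h ∈ Ioo (0 : ℝ) 1) {t : ℝ} (ht : t ∈ Icc 0 T) {e : E d} (he : ‖e‖ = 1) {s : ℝ}
    (hs : h ≤ s) (hs1 : s ≤ 1) (z : E d) :
    vh h t (z + s • e) + vh h t (z - s • e) - 2 * vh h t z ≤ 2 * C * (s ^ 2 + √(h * s)) := by
  have hs0 : 0 < s := hh.1.trans_le hs
  have h1 : h ≤ √(h * s) := Real.le_sqrt_of_sq_le (by nlinarith [hh.1])
  have h2 : √(h * s) ≤ 1 := Real.sqrt_le_one.2 (by nlinarith [hh.1, hh.2])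
  have h3 := hU.second h hh _ h1 h2 t ht z (s • e)
  have h4 : ‖s • e‖ = s := by rw [norm_smul, he, Real.norm_of_nonneg hs0.le, mul_one]
  rw [h4, div_mul_eq_mul_div, Real.div_sqrt] at h3
  have h5 : 0 ≤ C * s ^ 2 := mul_nonneg hU.nonneg (sq_nonneg _)
  linarith

theorem UniformApproximation.abs_slope_le (hU : UniformApproximation T N C H q v vh) {h : ℝ}
    (hh : h ∈ Ioo (0 : ℝ) 1) {t : ℝ} (ht : t ∈ Icc 0 T) (y w : E d) :
    |(vh h t (y + h • w) - vh h t y) / h| ≤ C * ‖w‖ := by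
  have := hU.lip h hh t ht (y + h • w) y
  rw [add_sub_cancel_left, norm_smul, Real.norm_of_nonneg hh.1.le] at this
  rw [abs_div, abs_of_pos hh.1, div_le_iff₀ hh.1]
  linarith

/-- Slopes over `n + 1` grid steps, along points converging to `(t, x)`. -/
theorem UniformApproximation.eventually_block_slope_le
    (hU : UniformApproximation T N C H q v vh) {t : ℝ} (ht : t ∈ Icc 0 T) {x p e : E d}
    (hx : HasGradientAt (v t) p x) (he : ‖e‖ = 1) (n : ℕ) (w : E d) {ε : ℝ} (hε : 0 < ε) :
    ∀ᶠ z : ℝ × ℝ × E d in approachFilter T t x,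
      (vh z.1 z.2.1 (z.2.2 + z.1 • w + (z.1 * (n + 1)) • e) - vh z.1 z.2.1 (z.2.2 + z.1 • w)) /
        (z.1 * (n + 1)) ≤ inner ℝ p e + 4 * (2 * C) * √(1 / (n + 1)) + ε := by
  have hC := hU.nonneg
  have hpos := (approachFilter_eventually_h (d := d) (T := T) (t := t) (x := x))
  have hh0 : Tendsto (fun z : ℝ × ℝ × E d => z.1) (approachFilter T t x) (𝓝 0) :=
    approachFilter_tendsto_h.mono_right nhdsWithin_le_nhds
  have hs0 : Tendsto (fun z : ℝ × ℝ × E d => z.2.1) (approachFilter T t x) (𝓝 t) :=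
    approachFilter_tendsto_s.mono_right nhdsWithin_le_nhds
  refine eventually_slope_le (φ' := fun z : ℝ × ℝ × E d => vh z.1 z.2.1)
    (y := fun z => z.2.2 + z.1 • w) (ρ := fun z => z.1 * (n + 1)) (μ := fun z => z.1)
    (δ := fun z => C * |z.2.1 - t| + C * √z.1) (L := C) (by positivity) he hx
    (fun x y => hU.lip_limit ht x y) ?_ ?_ ?_ ?_ (approachFilter_tendsto_translate w) ?_ ?_ ?_ hε
  · filter_upwards [hpos] with z hz
    have := hz.1
    positivity
  · simpa using hh0.mul_const ((n : ℝ) + 1)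
  · filter_upwards [hpos] with z hz using hz.1.le
  · filter_upwards [hpos] with z hz
    have := hz.1
    refine le_of_eq ?_
    congr 1
    field_simp
  · have h1 : Tendsto (fun z : ℝ × ℝ × E d => C * |z.2.1 - t|) (approachFilter T t x) (𝓝 0) := by
      simpa using (hs0.sub_const t).abs.const_mul C
    simpa using h1.add ((tendsto_const_mul_sqrt C).comp approachFilter_tendsto_h)
  · filter_upwards [hpos, approachFilter_eventually_s] with z hz hzs y
    have h1 := hU.time z.1 hz z.2.1 hzs t ht y
    have h2 := hU.err z.1 hz t ht y
    rw [abs_sub_comm] at h2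
    exact (abs_sub_le _ (vh z.1 t y) _).trans (add_le_add h1 h2)
  · filter_upwards [hpos, approachFilter_eventually_s] with z hz hzs s hs hs1 y
    refine hU.second_dyadic hz hzs he ?_ hs1 y
    have : (0 : ℝ) ≤ n := n.cast_nonneg
    nlinarith [hz.1]

/-- One-step slopes of solutions of the scheme do not exceed the slope of the limit. -/
theorem UniformApproximation.eventually_step_slope_le (hR : RegularControl T N K A c f H)
    (hq : ∀ x y, |q x - q y| ≤ K * ‖x - y‖)
    (hqs : ∀ x y, q (x + y) + q (x - y) - 2 * q x ≤ K * ‖y‖ ^ 2)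
    (hU : UniformApproximation T N C H q v vh) {t : ℝ} (ht : t ∈ Icc 0 T) {x p e : E d}
    (hx : HasGradientAt (v t) p x) {i : Fin d} (he : e = EuclideanSpace.single i (1 : ℝ) ∨
      e = -EuclideanSpace.single i (1 : ℝ)) {ε : ℝ} (hε : 0 < ε) :
    ∀ᶠ z : ℝ × ℝ × E d in approachFilter T t x,
      (vh z.1 z.2.1 (z.2.2 + z.1 • e) - vh z.1 z.2.1 z.2.2) / z.1 ≤ inner ℝ p e + ε := by
  have hC := hU.nonneg
  have hN := hR.N_pos
  have hK : 0 ≤ K := zero_le_one.trans hR.one_le_K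
  have hen : ‖e‖ = 1 := by rcases he with h | h <;> simp [h]
  have hne : (approachFilter T t x).NeBot := approachFilter_neBot ht
  set F := approachFilter T t x with hF
  set slope : ℝ × ℝ × E d → ℝ := fun z =>
    (vh z.1 z.2.1 (z.2.2 + z.1 • e) - vh z.1 z.2.1 z.2.2) / z.1 with hslope
  have hhev : ∀ᶠ z in F, z.1 ∈ Ioo (0 : ℝ) 1 := approachFilter_eventually_h
  have hsev : ∀ᶠ z in F, z.2.1 ∈ Icc 0 T := approachFilter_eventually_s
  have hslopeb : ∀ᶠ z in F, |slope z| ≤ C := by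
    filter_upwards [hhev, hsev] with z hz hzs
    have := hU.abs_slope_le hz hzs z.2.2 e
    rwa [hen, mul_one] at this
  have hbdd : F.IsBoundedUnder (· ≤ ·) slope :=
    isBoundedUnder_of_eventually_le (a := C) (by
      filter_upwards [hslopeb] with z hz using (abs_le.1 hz).2)
  have hbdd' : F.IsBoundedUnder (· ≥ ·) slope :=
    isBoundedUnder_of_eventually_ge (a := -C) (by
      filter_upwards [hslopeb] with z hz using (abs_le.1 hz).1)
  set S := limsup slope F with hS
  suffices hSp : S ≤ inner ℝ p e by
    filter_upwards [eventually_lt_of_limsup_lt (by linarith : S < inner ℝ p e + ε) hbdd] with z hz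
    exact hz.le
  -- An ultrafilter along which the limsup is attained replaces the extraction of subsequences: all
  -- bounded rescaled quantities converge along it.
  obtain ⟨U, hUF, hUS⟩ := mapClusterPt_iff_ultrafilter.1
    (MapClusterPt.limsup (u := slope) (f := F) hbdd'.isCoboundedUnder_le hbdd)
  have hupper : ∀ g : ℝ × ℝ × E d → ℝ × ℝ × E d, Tendsto g U F → ∀ δ > 0,
      ∀ᶠ z in (U : Filter (ℝ × ℝ × E d)), slope (g z) < S + δ := fun g hg δ hδ =>
    hg.eventually (eventually_lt_of_limsup_lt (by linarith : S < S + δ) hbdd)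
  have hUh : Tendsto (fun z : ℝ × ℝ × E d => z.1) U (𝓝[>] 0) := approachFilter_tendsto_h.mono_left hUF
  have hUh0 : Tendsto (fun z : ℝ × ℝ × E d => z.1) U (𝓝 0) := hUh.mono_right nhdsWithin_le_nhds
  have hUs : Tendsto (fun z : ℝ × ℝ × E d => z.2.1) U (𝓝[Icc 0 T] t) :=
    approachFilter_tendsto_s.mono_left hUF
  have hUs0 : Tendsto (fun z : ℝ × ℝ × E d => z.2.1) U (𝓝 t) := hUs.mono_right nhdsWithin_le_nhds
  have hUhev : ∀ᶠ z in (U : Filter (ℝ × ℝ × E d)), z.1 ∈ Ioo (0 : ℝ) 1 := hhev.filter_mono hUF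
  have hUsev : ∀ᶠ z in (U : Filter (ℝ × ℝ × E d)), z.2.1 ∈ Icc 0 T := hsev.filter_mono hUF
  have hUy : ∀ w, Tendsto (fun z : ℝ × ℝ × E d => z.2.2 + z.1 • w) U (𝓝 x) := fun w =>
    (approachFilter_tendsto_translate w).mono_left hUF
  -- The blow-up looks forward in time by `h θ` and needs room before `T`. Otherwise `T - s = o(h)`
  -- along `U`, and slopes can be compared with those of the terminal datum.
  by_cases hcase : ∃ θ₀ > 0, ∀ᶠ z in (U : Filter (ℝ × ℝ × E d)), z.2.1 + z.1 * θ₀ ≤ T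
  · obtain ⟨θ₀, hθ₀, hθev⟩ := hcase
    set W : ℝ × ℝ × E d → E d → ℝ := fun z w =>
      (vh z.1 z.2.1 (z.2.2 + z.1 • w) - vh z.1 z.2.1 z.2.2) / z.1 with hW
    have hVex : ∀ w, ∃ V, Tendsto (fun z => W z w) U (𝓝 V) := by
      intro w
      obtain ⟨V, -, hV⟩ := (isCompact_Icc (a := -(C * ‖w‖)) (b := C * ‖w‖)).ultrafilter_le_nhds
        (U.map fun z => W z w) (by
          rw [le_principal_iff, Ultrafilter.coe_map, mem_map]
          filter_upwards [hUhev, hUsev] with z hz hzs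
          exact abs_le.1 (hU.abs_slope_le hz hzs z.2.2 w))
      exact ⟨V, hV⟩
    choose V hV using hVex
    have hslopeW : ∀ w, ∀ᶠ z in (U : Filter (ℝ × ℝ × E d)), slope (z.1, z.2.1, z.2.2 + z.1 • w) = W z (w + e) - W z w := by
      intro w
      filter_upwards with z
      simp only [hslope, hW, smul_add, ← add_assoc]
      ring
    have hslopeV : ∀ w, Tendsto (fun z : ℝ × ℝ × E d => slope (z.1, z.2.1, z.2.2 + z.1 • w)) U
        (𝓝 (V (w + e) - V w)) := fun w =>
      ((hV (w + e)).sub (hV w)).congr' ((hslopeW w).mono fun z hz => hz.symm)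
    have htrans : ∀ w, Tendsto (fun z : ℝ × ℝ × E d => (z.1, z.2.1, z.2.2 + z.1 • w)) U F :=
      fun w => hUh.prodMk (hUs.prodMk (hUy w))
    have hVS : ∀ w, V (w + e) - V w ≤ S := fun w =>
      le_of_forall_pos_le_add fun δ hδ =>
        le_of_tendsto (hslopeV w) ((hupper _ (htrans w) δ hδ).mono fun z hz => hz.le)
    have hV0 : V (0 + e) - V 0 = S := by
      refine tendsto_nhds_unique (hslopeV 0) ?_
      simpa using hUS
    have hcontact : ∀ w, V (w + e) - V w = S →
        H t x (discreteGradient 1 V w) + N * discreteLaplacian 1 V w ≤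
          H t x (discreteGradient 1 V (w + e)) + N * discreteLaplacian 1 V (w + e) := by
      intro w hw
      set P : (E d → ℝ) → E d → ℝ := fun φ w =>
        H t x (discreteGradient 1 φ w) + N * discreteLaplacian 1 φ w with hP
      have hPlim : ∀ w, Tendsto (fun z => P (W z) w) U (𝓝 (P V w)) := fun w =>
        (((hR.continuous_H ht x).tendsto _).comp (tendsto_discreteGradient hV 1 w)).add
          ((tendsto_discreteLaplacian hV 1 w).const_mul N)
      suffices hθ : ∀ θ, 0 < θ → θ ≤ θ₀ → P V w - P V (w + e) ≤ 12 * N * d * C * θ by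
        have hlim : Tendsto (fun θ : ℝ => 12 * N * d * C * θ) (𝓝[>] 0) (𝓝 0) :=
          (Continuous.tendsto' (by fun_prop) 0 _ (by simp)).mono_left nhdsWithin_le_nhds
        have := ge_of_tendsto hlim (by
          filter_upwards [Ioc_mem_nhdsGT hθ₀] with θ h using hθ θ h.1 h.2)
        change P V w ≤ P V (w + e)
        linarith
      intro θ hθ hθle
      have hsθ : ∀ᶠ z in (U : Filter (ℝ × ℝ × E d)), z.2.1 + z.1 * θ ≤ T := by
        filter_upwards [hθev, hUhev] with z hz hzh
        nlinarith [hzh.1]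
      have hshift : Tendsto (fun z : ℝ × ℝ × E d => (z.1, z.2.1 + z.1 * θ, z.2.2 + z.1 • w)) U F := by
        refine hUh.prodMk (Tendsto.prodMk ?_ (hUy w))
        refine tendsto_nhdsWithin_iff.2 ⟨by simpa using hUs0.add (hUh0.mul_const θ), ?_⟩
        filter_upwards [hsθ, hUsev, hUhev] with z hz hzs hzh
        have := hzh.1
        exact ⟨add_nonneg hzs.1 (by positivity), hz⟩
      have herr : Tendsto (fun z : ℝ × ℝ × E d => θ * (12 * N * d * C * θ + 2 * K * (1 + d * C) *
          (|z.2.1 - t| + z.1 * θ + ‖z.2.2 + z.1 • w - x‖ + z.1))) U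
          (𝓝 (θ * (12 * N * d * C * θ))) := by
        have h1 : Tendsto (fun z : ℝ × ℝ × E d => |z.2.1 - t|) U (𝓝 0) := by
          simpa using (hUs0.sub_const t).abs
        have h2 : Tendsto (fun z : ℝ × ℝ × E d => ‖z.2.2 + z.1 • w - x‖) U (𝓝 0) := by
          simpa using ((hUy w).sub_const x).norm
        have h3 := ((((h1.add (hUh0.mul_const θ)).add h2).add hUh0).const_mul
          (2 * K * (1 + d * C))).const_add (12 * N * d * C * θ)
        simpa using h3.const_mul θ
      -- At a contact point the slope at time `s` tends to `S`, while at time `s + h θ` it is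
      -- eventually below `S + δ`; hence it grows by at most `δ + o(1)`. First `δ → 0`, then
      -- division by `θ`, then `θ → 0`.
      have hmain : ∀ δ > 0, θ * (P V w - P V (w + e)) ≤ δ + θ * (12 * N * d * C * θ) := by
        intro δ hδ
        have hslopew := hslopeV w
        rw [hw] at hslopew
        have hlimR : Tendsto (fun z : ℝ × ℝ × E d => S + δ - slope (z.1, z.2.1, z.2.2 + z.1 • w) +
          θ * (12 * N * d * C * θ + 2 * K * (1 + d * C) *
          (|z.2.1 - t| + z.1 * θ + ‖z.2.2 + z.1 • w - x‖ + z.1))) U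
          (𝓝 (δ + θ * (12 * N * d * C * θ))) := by
          have := (hslopew.const_sub (S + δ)).add herr
          rwa [add_sub_cancel_left] at this
        refine le_of_tendsto_of_tendsto (((hPlim w).sub (hPlim (w + e))).const_mul θ) hlimR ?_
        filter_upwards [hUhev, hUsev, hsθ, hupper _ hshift δ hδ] with z hz hzs hzθ hlt
        have hinc := hR.slope_time_increment hz.1 (hU.sol z.1 hz) hC hC (hU.lip z.1 hz)
          (hU.time z.1 hz) ht hzs hθ hzθ hen x (z.2.2 + z.1 • w)
        simp only [hP, hW]
        rw [discreteGradient_rescale hz.1.ne', discreteGradient_rescale hz.1.ne',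
          discreteLaplacian_rescale hz.1.ne', discreteLaplacian_rescale hz.1.ne',
          smul_add, ← add_assoc]
        simp only [hslope] at hlt ⊢
        linarith
      have := le_of_forall_pos_le_add (a := θ * (P V w - P V (w + e)))
        (b := θ * (12 * N * d * C * θ)) fun δ hδ => by linarith [hmain δ hδ]
      exact le_of_mul_le_mul_left this hθ
    have hlong := exists_long_maximal_slope hN (fun p => hR.exists_supergradient ht x p) he hVS
      hV0 hcontact
    have hSn : ∀ n : ℕ, S ≤ inner ℝ p e + 4 * (2 * C) * √(1 / (n + 1)) := by
      intro n
      obtain ⟨w, hw⟩ := hlong n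
      have hn : (0 : ℝ) < n + 1 := by positivity
      refine le_of_forall_pos_le_add fun δ hδ => ?_
      have hlim : Tendsto (fun z => (W z (w + ((n : ℝ) + 1) • e) - W z w) / (n + 1)) U (𝓝 S) := by
        have := ((hV (w + ((n : ℝ) + 1) • e)).sub (hV w)).div_const ((n : ℝ) + 1)
        rwa [hw, mul_div_cancel_left₀ _ hn.ne'] at this
      refine le_of_tendsto hlim ?_
      filter_upwards [hUhev, (hU.eventually_block_slope_le ht hx hen n w hδ).filter_mono hUF]
        with z hz hle
      refine le_trans (le_of_eq ?_) hle
      have := hz.1.ne'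
      simp only [hW, smul_add, smul_smul, ← add_assoc]
      field_simp
      ring
    have hlim : Tendsto (fun n : ℕ => inner ℝ p e + 4 * (2 * C) * √(1 / ((n : ℝ) + 1))) atTop
        (𝓝 (inner ℝ p e)) := by
      have h1 : Tendsto (fun n : ℕ => √(1 / ((n : ℝ) + 1))) atTop (𝓝 0) := by
        have := (Real.continuous_sqrt.tendsto 0).comp
          (tendsto_one_div_add_atTop_nhds_zero_nat (𝕜 := ℝ))
        rwa [Real.sqrt_zero] at this
      simpa using (h1.const_mul (4 * (2 * C))).const_add (inner ℝ p e)
    exact ge_of_tendsto' hlim hSn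
  · have hclose : ∀ θ > 0, ∀ᶠ z in (U : Filter (ℝ × ℝ × E d)), T < z.2.1 + z.1 * θ := by
      intro θ hθ
      by_contra hcon
      refine hcase ⟨θ, hθ, ?_⟩
      rw [← Ultrafilter.eventually_not] at hcon
      exact hcon.mono fun z hz => not_lt.1 hz
    have htT : t = T := by
      refine le_antisymm ht.2 ?_
      have h1 : Tendsto (fun z : ℝ × ℝ × E d => z.2.1 + z.1 * 1) U (𝓝 t) := by
        simpa using hUs0.add (hUh0.mul_const 1)
      exact ge_of_tendsto h1 ((hclose 1 one_pos).mono fun z hz => hz.le)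
    have hvq : v t = q := by rw [htT]; exact funext hU.terminal
    rw [hvq] at hx
    have hT : T ∈ Icc 0 T := htT ▸ ht
    refine le_of_forall_pos_le_add fun δ hδ => ?_
    -- The datum `q` is genuinely semi-concave, so `μ = 0` and `σ = 0` are allowed and one-step
    -- slopes carry no residual error.
    have hqslope := eventually_slope_le (l := (U : Filter (ℝ × ℝ × E d))) (φ' := fun _ => q)
      (y := fun z => z.2.2) (ρ := fun z => z.1) (μ := fun _ => 0) (δ := fun _ => 0) (σ := 0)
      hK hen hx hq (hUhev.mono fun z hz => hz.1) hUh0 (Eventually.of_forall fun _ => le_rfl)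
      (Eventually.of_forall fun z => by simp) (by simpa using hUy 0) tendsto_const_nhds
      (Eventually.of_forall fun z y => by simp)
      (hUhev.mono fun z hz s hs _ y => by
        have := hqs y (s • e)
        rw [norm_smul, hen, mul_one, Real.norm_eq_abs, sq_abs] at this
        simpa using this) (by positivity : 0 < δ / 2)
    refine le_of_tendsto hUS ?_
    have hθ : 0 < δ / (4 * (C + 1)) := by positivity
    filter_upwards [hqslope, hclose _ hθ, hUhev, hUsev] with z hz hzT hzh hzs
    have h1 := abs_le.1 (hU.time z.1 hzh z.2.1 hzs T hT (z.2.2 + z.1 • e))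
    have h2 := abs_le.1 (hU.time z.1 hzh z.2.1 hzs T hT z.2.2)
    rw [(hU.sol z.1 hzh).terminal, abs_sub_comm, abs_of_nonneg (sub_nonneg.2 hzs.2)] at h1 h2
    rw [div_le_iff₀ hzh.1] at hz
    simp only [hslope]
    rw [div_le_iff₀ hzh.1]
    have h3 : C * (T - z.2.1) ≤ z.1 * (δ / 4) := by
      calc C * (T - z.2.1) ≤ (C + 1) * (z.1 * (δ / (4 * (C + 1)))) :=
            mul_le_mul (by linarith) (by linarith) (by linarith [hzs.2]) (by positivity)
        _ = z.1 * (δ / 4) := by field_simp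
    linarith [h1.2, h2.1]

/-- Convergence of the discrete gradients at points of differentiability of the limit. -/
theorem UniformApproximation.tendsto_discreteGradient (hR : RegularControl T N K A c f H)
    (hq : ∀ x y, |q x - q y| ≤ K * ‖x - y‖)
    (hqs : ∀ x y, q (x + y) + q (x - y) - 2 * q x ≤ K * ‖y‖ ^ 2)
    (hU : UniformApproximation T N C H q v vh) {t : ℝ} (ht : t ∈ Icc 0 T) {x p : E d}
    (hx : HasGradientAt (v t) p x) :
    Tendsto (fun z : ℝ × ℝ × E d => discreteGradient z.1 (vh z.1 z.2.1) z.2.2)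
      (approachFilter T t x) (𝓝 p) := by
  have hcoord : ∀ i : Fin d, Tendsto
      (fun z : ℝ × ℝ × E d => discreteGradient z.1 (vh z.1 z.2.1) z.2.2 i)
      (approachFilter T t x) (𝓝 (p i)) := by
    intro i
    set e : E d := EuclideanSpace.single i (1 : ℝ) with he
    have hpe : inner ℝ p e = p i := by
      rw [he, EuclideanSpace.inner_single_right]; simp
    have hshift : ∀ w : E d, Tendsto (fun z : ℝ × ℝ × E d => (z.1, z.2.1, z.2.2 + z.1 • w))
        (approachFilter T t x) (approachFilter T t x) := fun w =>
      approachFilter_tendsto_h.prodMk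
        (approachFilter_tendsto_s.prodMk (approachFilter_tendsto_translate w))
    rw [Metric.tendsto_nhds]
    intro δ hδ
    have hδ2 : 0 < δ / 2 := by positivity
    have f1 := hU.eventually_step_slope_le hR hq hqs ht hx (e := e) (Or.inl he) hδ2
    have f2 := hU.eventually_step_slope_le hR hq hqs ht hx (e := -e) (Or.inr (by rw [he])) hδ2
    -- The central difference is the mean of the two one-step slopes meeting at `y`. Upper bounds
    -- for direction `-e` are lower bounds for `e`, and shifting the base point by one step covers
    -- both halves.
    filter_upwards [f1, f2, (hshift (-e)).eventually f1, (hshift e).eventually f2,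
      approachFilter_eventually_h] with z g1 g2 g3 g4 hz
    simp only [inner_neg_right, hpe, smul_neg, ← sub_eq_add_neg, sub_add_cancel,
      add_sub_cancel_right] at g1 g2 g3 g4
    rw [div_le_iff₀ hz.1] at g1 g2 g3 g4
    have hD : discreteGradient z.1 (vh z.1 z.2.1) z.2.2 i =
        (vh z.1 z.2.1 (z.2.2 + z.1 • e) - vh z.1 z.2.1 (z.2.2 - z.1 • e)) / (2 * z.1) := rfl
    have h2 : 0 < 2 * z.1 := by linarith [hz.1]
    rw [hD, Real.dist_eq, abs_lt]
    constructor
    · rw [lt_sub_iff_add_lt, lt_div_iff₀ h2]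
      nlinarith [hz.1]
    · rw [sub_lt_iff_lt_add, div_lt_iff₀ h2]
      nlinarith [hz.1]
  exact ((PiLp.continuous_toLp 2 _).tendsto (WithLp.ofLp p)).comp (tendsto_pi_nhds.2 hcoord)

end

end PolicyIteration

namespace PolicyIteration

/-! ### Verification of the quantitative hypotheses, and the theorem -/

section Assembly

variable {d m : ℕ} {T N : ℝ} {A : Set (E m)} {c : ℝ → E d → E m → ℝ}
  {f : ℝ → E d → E m → E d} {q : E d → ℝ} {v : ℝ → E d → ℝ} {vh : ℝ → ℝ → E d → ℝ}

theorem norm_sub_le_of_lipschitzOn {F : Type*} [NormedAddCommGroup F] {g : ℝ → E d → E m → F}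
    {L : ℝ≥0} (hL : LipschitzOnWith L (fun z : ℝ × E d × E m => g z.1 z.2.1 z.2.2)
      (Icc 0 T ×ˢ univ ×ˢ A)) {t s : ℝ} (ht : t ∈ Icc 0 T) (hs : s ∈ Icc 0 T) (x y : E d)
    {a : E m} (ha : a ∈ A) : ‖g t x a - g s y a‖ ≤ L * (|t - s| + ‖x - y‖) := by
  have h := hL.dist_le_mul (t, x, a) ⟨ht, mem_univ _, ha⟩ (s, y, a) ⟨hs, mem_univ _, ha⟩
  rw [dist_eq_norm] at h
  refine h.trans (mul_le_mul_of_nonneg_left ?_ L.2)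
  rw [Prod.dist_eq, Prod.dist_eq, dist_self, Real.dist_eq, dist_eq_norm]
  refine max_le ?_ (max_le ?_ ?_)
  · linarith [norm_nonneg (x - y)]
  · linarith [abs_nonneg (t - s)]
  · positivity

theorem hamiltonian_spec {α : ℝ → E d → E d → E m} (hα : IsArgminPolicy T A c f α) {t : ℝ}
    (ht : t ∈ Icc 0 T) (x p : E d) : α t x p ∈ A ∧
      hamiltonian A c f t x p = c t x (α t x p) + inner ℝ p (f t x (α t x p)) ∧
      ∀ a ∈ A, hamiltonian A c f t x p ≤ c t x a + inner ℝ p (f t x a) := by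
  have hmem : α t x p ∈ {a | a ∈ A ∧ IsMinOn (fun b => c t x b + inner ℝ p (f t x b)) A a} := by
    rw [hα t ht x p]; exact mem_singleton _
  obtain ⟨hA, hmin⟩ := hmem
  have hbdd : BddBelow (range fun a : A => c t x a + inner ℝ p (f t x a)) :=
    ⟨c t x (α t x p) + inner ℝ p (f t x (α t x p)), by
      rintro _ ⟨a, rfl⟩; exact hmin a.2⟩
  have hle : ∀ a ∈ A, hamiltonian A c f t x p ≤ c t x a + inner ℝ p (f t x a) :=
    fun a ha => ciInf_le hbdd ⟨a, ha⟩
  refine ⟨hA, le_antisymm (hle _ hA) ?_, hle⟩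
  have : Nonempty A := ⟨⟨_, hA⟩⟩
  exact le_ciInf fun a => hmin a.2

theorem exists_regularControl {α : ℝ → E d → E d → E m}
    (hα : IsArgminPolicy T A c f α) (hc : BoundedLipschitz T A c) (hf : BoundedLipschitz T A f)
    (hq_lip : ∃ L : ℝ≥0, LipschitzWith L q) (hN : 1 ≤ N)
    (hNf : ∀ t ∈ Icc 0 T, ∀ x, ∀ a ∈ A, ‖f t x a‖ / 2 ≤ N)
    (hq_sc : ∃ C > 0, SemiconcaveWith C q)
    (hcf : ∃ K : ℝ≥0, ∀ t ∈ Icc 0 T, ∀ a ∈ A,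
      W2InftyBoundedBy K (fun x => c t x a) ∧ W2InftyBoundedBy K (fun x => f t x a)) :
    ∃ K : ℝ, RegularControl T N K A c f (hamiltonian A c f) ∧
      (∀ x y, |q x - q y| ≤ K * ‖x - y‖) ∧
      ∀ x y, q (x + y) + q (x - y) - 2 * q x ≤ K * ‖y‖ ^ 2 := by
  obtain ⟨⟨Mc, hMc⟩, Lc, hLc⟩ := hc
  obtain ⟨-, Lf, hLf⟩ := hf
  obtain ⟨Lq, hLq⟩ := hq_lip
  obtain ⟨Cq, hCq, hq⟩ := hq_sc
  obtain ⟨K₂, hK₂⟩ := hcf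
  have hcont : ∀ {F : Type} [NormedAddCommGroup F] {g : ℝ → E d → E m → F} {L : ℝ≥0},
      LipschitzOnWith L (fun z : ℝ × E d × E m => g z.1 z.2.1 z.2.2) (Icc 0 T ×ˢ univ ×ˢ A) →
      ∀ t ∈ Icc 0 T, ∀ a ∈ A, Continuous fun x => g t x a := by
    intro F _ g L hL t ht a ha
    refine (LipschitzWith.of_dist_le_mul (K := L) fun x y => ?_).continuous
    rw [dist_eq_norm, dist_eq_norm]
    simpa using norm_sub_le_of_lipschitzOn hL ht ht x y ha
  have hLc0 : (0 : ℝ) ≤ Lc := Lc.2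
  have hLf0 : (0 : ℝ) ≤ Lf := Lf.2
  have hLq0 : (0 : ℝ) ≤ Lq := Lq.2
  have hK0 : (0 : ℝ) ≤ 2 * (d * d * K₂) := by positivity
  have hM0 := abs_nonneg Mc
  set K : ℝ := 1 + |Mc| + Lc + Lf + Lq + Cq + 2 * (d * d * K₂) with hK
  refine ⟨K, ⟨by linarith, by linarith, ?_, ?_, ?_, ?_, ?_, ?_, ?_, ?_⟩, ?_, ?_⟩
  · intro t ht x a ha
    have := hMc t ht x a ha
    rw [Real.norm_eq_abs] at this
    linarith [le_abs_self Mc]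
  · intro t ht x a ha
    linarith [hNf t ht x a ha]
  · intro t ht s hs x y a ha
    refine (norm_sub_le_of_lipschitzOn hLc ht hs x y ha).trans ?_
    exact mul_le_mul_of_nonneg_right (by linarith) (by positivity)
  · intro t ht s hs x y a ha
    refine (norm_sub_le_of_lipschitzOn hLf ht hs x y ha).trans ?_
    exact mul_le_mul_of_nonneg_right (by linarith) (by positivity)
  · intro t ht x y a ha
    refine ((hK₂ t ht a ha).1.norm_secondDiff_le (hcont hLc t ht a ha) x y).trans ?_
    exact mul_le_mul_of_nonneg_right (by linarith) (by positivity)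
  · intro t ht x y a ha
    refine ((hK₂ t ht a ha).2.norm_secondDiff_le (hcont hLf t ht a ha) x y).trans ?_
    exact mul_le_mul_of_nonneg_right (by linarith) (by positivity)
  · intro t ht x p a ha
    exact (hamiltonian_spec hα ht x p).2.2 a ha
  · intro t ht x p
    exact ⟨_, (hamiltonian_spec hα ht x p).1, (hamiltonian_spec hα ht x p).2.1⟩
  · intro x y
    have := hLq.dist_le_mul x y
    rw [Real.dist_eq, dist_eq_norm] at this
    exact this.trans (mul_le_mul_of_nonneg_right (by linarith) (norm_nonneg _))
  · intro x y
    exact (hq x y).trans (mul_le_mul_of_nonneg_right (by linarith) (by positivity))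

theorem exists_uniformApproximation {K : ℝ} {H : ℝ → E d → E d → ℝ} (hT : 0 < T)
    (hR : RegularControl T N K A c f H) (hq : ∀ x y, |q x - q y| ≤ K * ‖x - y‖)
    (hqs : ∀ x y, q (x + y) + q (x - y) - 2 * q x ≤ K * ‖y‖ ^ 2)
    (hv : IsViscositySolution T H q v)
    (hvh : ∀ h ∈ Ioo (0 : ℝ) 1, IsSemiDiscreteSolution T H q N h (vh h)) :
    ∃ C, UniformApproximation T N C H q v vh := by
  obtain ⟨L, hL, hlip⟩ := hR.exists_lipschitz_bound hq
  obtain ⟨L', hL', htime⟩ := hR.exists_time_lipschitz_bound (q := q) hL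
  obtain ⟨C₂, hC₂, hsecond⟩ := hR.exists_weak_semiconcavity hq hqs
  obtain ⟨C₀, hC₀, herr⟩ := hR.exists_error_bound hT hL hv
  have hl : ∀ h ∈ Ioo (0 : ℝ) 1, _ := fun h hh => hlip h hh.1 (vh h) (hvh h hh)
  refine ⟨L + L' + C₂ + C₀, by positivity, hvh, ?_, ?_, ?_, ?_, hv.terminal⟩
  · intro h hh t ht x y
    exact (hl h hh t ht x y).trans (mul_le_mul_of_nonneg_right (by linarith) (norm_nonneg _))
  · intro h hh t ht s hs x
    exact (htime h hh.1 _ (hvh h hh) (hl h hh) t ht s hs x).trans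
      (mul_le_mul_of_nonneg_right (by linarith) (abs_nonneg _))
  · intro h hh μ hμ hμ1 t ht x y
    refine (hsecond h hh.1 μ hμ hμ1 _ (hvh h hh) t ht x y).trans
      (mul_le_mul_of_nonneg_right (by linarith) ?_)
    have := hh.1
    have := this.trans_le hμ
    positivity
  · intro h hh t ht x
    exact (herr h hh.1 _ (hvh h hh) (hl h hh) t ht x).trans
      (mul_le_mul_of_nonneg_right (by linarith) (Real.sqrt_nonneg _))

end Assembly

end PolicyIteration

theorem theorem2p8 {d m : ℕ} (T N : ℝ) (hT : 0 < T)
    (A : Set (PolicyIteration.E m)) (hA : IsCompact A)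
    (c : ℝ → PolicyIteration.E d → PolicyIteration.E m → ℝ)
    (f : ℝ → PolicyIteration.E d → PolicyIteration.E m → PolicyIteration.E d)
    (q : PolicyIteration.E d → ℝ)
    (α : ℝ → PolicyIteration.E d → PolicyIteration.E d → PolicyIteration.E m)
    -- `α` is the unique minimizing policy
    (hα : PolicyIteration.IsArgminPolicy T A c f α)
    -- (A1)
    (hc : PolicyIteration.BoundedLipschitz T A c)
    (hf : PolicyIteration.BoundedLipschitz T A f)
    (hq_bdd : ∃ M : ℝ, ∀ x, |q x| ≤ M)
    (hq_lip : ∃ L : ℝ≥0, LipschitzWith L q)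
    -- (A2)
    (hα_lip : ∃ L : ℝ≥0, LipschitzOnWith L
      (fun z : ℝ × PolicyIteration.E d × PolicyIteration.E d => α z.1 z.2.1 z.2.2)
      (Icc 0 T ×ˢ univ))
    -- `N ≥ max {1, ‖f‖_∞ / 2}`
    (hN : 1 ≤ N) (hNf : ∀ t ∈ Icc 0 T, ∀ x, ∀ a ∈ A, ‖f t x a‖ / 2 ≤ N)
    -- (A3)
    (hq_sc : ∃ C > 0, PolicyIteration.SemiconcaveWith C q)
    (hcf : ∃ K : ℝ≥0, ∀ t ∈ Icc 0 T, ∀ a ∈ A,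
      PolicyIteration.W2InftyBoundedBy K (fun x => c t x a) ∧
      PolicyIteration.W2InftyBoundedBy K (fun x => f t x a))
    -- the viscosity solution and the solutions of the semi-discrete problems
    (v : ℝ → PolicyIteration.E d → ℝ)
    (hv : PolicyIteration.IsViscositySolution T (PolicyIteration.hamiltonian A c f) q v)
    (vh : ℝ → ℝ → PolicyIteration.E d → ℝ)
    (hvh : ∀ h ∈ Ioo (0 : ℝ) 1, PolicyIteration.IsSemiDiscreteSolution T
      (PolicyIteration.hamiltonian A c f) q N h (vh h)) :
    (∃ C > 0, ∀ t ∈ Icc 0 T, PolicyIteration.SemiconcaveWith C (v t)) ∧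
    ∀ t ∈ Icc 0 T, ∀ᵐ x : PolicyIteration.E d, DifferentiableAt ℝ (v t) x ∧
      ∀ (th : ℝ → ℝ) (xh : ℝ → PolicyIteration.E d),
        (∀ h ∈ Ioo (0 : ℝ) 1, th h ∈ Icc 0 T) →
        Tendsto th (𝓝[>] 0) (𝓝 t) → Tendsto xh (𝓝[>] 0) (𝓝 x) →
        Tendsto
          (fun h => α (th h) (xh h)
            (PolicyIteration.discreteGradient h (vh h (th h)) (xh h)))
          (𝓝[>] 0) (𝓝 (α t x (gradient (v t) x))) := by
  obtain ⟨K, hR, hq, hqs⟩ := PolicyIteration.exists_regularControl hα hc hf hq_lip hN hNf hq_sc hcf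
  obtain ⟨C, hU⟩ := PolicyIteration.exists_uniformApproximation hT hR hq hqs hv hvh
  refine ⟨⟨C + 1, by linarith [hU.nonneg], fun t ht x y => ?_⟩, fun t ht => ?_⟩
  · exact (hU.semiconcave_limit ht x y).trans
      (mul_le_mul_of_nonneg_right (by linarith) (by positivity))
  have hlip : LipschitzWith (Real.toNNReal C) (v t) := by
    refine LipschitzWith.of_dist_le_mul fun x y => ?_
    rw [Real.coe_toNNReal _ hU.nonneg, Real.dist_eq, dist_eq_norm]
    exact hU.lip_limit ht x y
  -- Rademacher's theorem. The exceptional set depends on `t` only, not on the approximating family,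
  -- because convergence holds along the whole of `approachFilter`.
  filter_upwards [hlip.ae_differentiableAt] with x hx
  refine ⟨hx, fun th xh hth hth' hxh => ?_⟩
  obtain ⟨Lα, hLα⟩ := hα_lip
  have hz : Tendsto (fun h => (h, th h, xh h)) (𝓝[>] 0)
      (PolicyIteration.approachFilter T t x) := by
    refine tendsto_id.prodMk (Tendsto.prodMk ?_ hxh)
    refine tendsto_nhdsWithin_iff.2 ⟨hth', ?_⟩
    filter_upwards [Ioo_mem_nhdsGT one_pos] with h hh using hth h hh
  have hgrad := (hU.tendsto_discreteGradient hR hq hqs ht hx.hasGradientAt).comp hz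
  have hcont := hLα.continuousOn (t, x, gradient (v t) x) ⟨ht, mem_univ _⟩
  refine hcont.tendsto.comp (tendsto_nhdsWithin_iff.2
    ⟨hth'.prodMk_nhds (hxh.prodMk_nhds hgrad), ?_⟩)
  filter_upwards [Ioo_mem_nhdsGT one_pos] with h hh using ⟨hth h hh, mem_univ _⟩
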